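/- **Conventions.** ${}^n2$ is the set of binary sequences of length $n$, ${}^{\omega>}2=\bigcup_n{}^n2$, ${}^\omega2$ is the Cantor space, $+$ is coordinatewise addition mod 2, $\trianglelefteq$ ($\vartriangleleft$) is "(proper) initial segment". A tree is a $\vartriangleleft$-downward closed $T\subseteq{}^{\omega>}2$, and $\lim(T)$ is the set of its infinite branches. $u^{\langle2\rangle}=\{(x,y)\in u\times u:x\ne y\}$. **Systems.** Let $0<\varepsilon<\omega_1$. A $\mathcal{YZR}(\varepsilon)$-system is $s=(X,\bar r,\bar\jmath,\bar k)$ where $X$ is a nonempty set of ordinals, $\bar r:[X]^{<\omega}\setminus\{\emptyset\}\to\varepsilon+1$, $\bar\jmath,\bar k:[X]^{<\omega}\setminus\{\emptyset\}\to\omega$, such that $\bar r(u)\ge\bar r(w)$ whenever $\emptyset\ne u\subseteq w$; $\bar r(\{a\})>0$; and if $w=\{a_0<\dots<a_{n-1}\}$ is nonempty then $\bar k(w)<n$ and there is no $b\in X\setminus w$ with $|w\cap b|=\bar k(w)$, $\bar\jmath((w\setminus\{a_{\bar k(w)}\})\cup\{b\})=\bar\jmath(w)$ and $\bar r(w\cup\{b\})=\bar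 r(w)$. A quasi-embedding of $q$ in $s$ is an increasing injection $\varphi:X^q\to X^s$ such that for all nonempty finite $v\subseteq X^q$: $\bar r^s(\varphi[v])=\bar r^q(v)$, $\bar k^s(\varphi[v])=\bar k^q(v)$, and, if $\bar r^q(v)>0$, $\bar\jmath^s(\varphi[v])=\bar\jmath^q(v)$. For $w\subseteq X^s$, a map $w\to X^s$ is a quasi-embedding if it is one of the restricted system $s{\restriction}w$ in $s$. A system $S$ is cute if $X^S=\omega$ and for every finite $\mathcal{YZR}(\varepsilon)$-system $q$ and $M<\omega$ there is a quasi-embedding of $q$ in $S$ with range in $[M,\omega)$. **Rank.** Let $\bar T=\langle T_m:m<\omega\rangle$ be trees and $2\le\iota<\omega$. $\mathbf M_{\bar T,\iota}$ is the set of $\mathbf m=(\ell,u,\langle h_i\rangle_{i<\iota},\langle g_i\rangle_{i<\iota})$ with $0<\ell<\omega$, $u\subseteq{}^\ell2$, $|u|\ge2$, $h_i:u^{\langle2\rangle}\to\omega$, $g_i(\eta,\nu)\in T_{h_i(\eta,\nu)}\cap{}^\ell2$, $\eta+g_i(\eta,\nu)=\nu+g_i(\nu,\eta)$, no repetitions in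 $\langle g_i(\eta,\nu),g_i(\nu,\eta):i<\iota\rangle$ for each $(\eta,\nu)\in u^{\langle 2\rangle}$, and such that there are $F(\eta)\in{}^\omega2$, $G_i(\eta,\nu)\in\lim(T_{h_i(\eta,\nu)})$ with $\eta\vartriangleleft F(\eta)$, $g_i(\eta,\nu)\vartriangleleft G_i(\eta,\nu)$ and $F(\eta)+G_i(\eta,\nu)=F(\nu)+G_i(\nu,\eta)$. Write $\mathbf m\sqsubseteq\mathbf n$ if $\ell_{\mathbf m}\le\ell_{\mathbf n}$, $u_{\mathbf m}=\{\eta{\restriction}\ell_{\mathbf m}:\eta\in u_{\mathbf n}\}$ and, for all $i<\iota$ and $\eta,\nu\in u_{\mathbf n}$ with $\eta{\restriction}\ell_{\mathbf m}\ne\nu{\restriction}\ell_{\mathbf m}$, $h_i^{\mathbf m}(\eta{\restriction}\ell_{\mathbf m},\nu{\restriction}\ell_{\mathbf m})=h_i^{\mathbf n}(\eta,\nu)$ and $g_i^{\mathbf m}(\eta{\restriction}\ell_{\mathbf m},\nu{\restriction}\ell_{\mathbf m})=g_i^{\mathbf n}(\eta,\nu){\restriction}\ell_{\mathbf m}$.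 Let $\mathrm{ndrk}_\iota(\mathbf m)\ge0$ always; for limit $\alpha$, $\mathrm{ndrk}_\iota(\mathbf m)\ge\alpha$ iff $\mathrm{ndrk}_\iota(\mathbf m)\ge\beta$ for all $\beta<\alpha$; and $\mathrm{ndrk}_\iota(\mathbf m)\ge\beta+1$ iff for every $\nu\in u_{\mathbf m}$ there is $\mathbf n\in\mathbf M_{\bar T,\iota}$ with $\ell_{\mathbf n}>\ell_{\mathbf m}$, $\mathbf m\sqsubseteq\mathbf n$, $\mathrm{ndrk}_\iota(\mathbf n)\ge\beta$ and $|\{\eta\in u_{\mathbf n}:\nu\vartriangleleft\eta\}|\ge2$; this defines $\mathrm{ndrk}_\iota(\mathbf m)\in\mathrm{ON}\cup\{\infty\}$. Put $\mathrm{ndrk}_\iota(\bar T)=\sup\{\mathrm{ndrk}_\iota(\mathbf m):\mathbf m\in\mathbf M_{\bar T,\iota}\}$. Write $\mathbf m\sqsubseteq^*\mathbf n$ if $\ell_{\mathbf m}\le\ell_{\mathbf n}$, $u_{\mathbf m}=\{\eta{\restriction}\ell_{\mathbf m}:\eta\in u_{\mathbf n}\}$ and for all $\eta,\nu\in u_{\mathbf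 n}$ with $\eta'=\eta{\restriction}\ell_{\mathbf m}\neq\nu'=\nu{\restriction}\ell_{\mathbf m}$: $\{\{g^{\mathbf m}_i(\eta',\nu'),g^{\mathbf m}_i(\nu',\eta')\}:i<\iota\}=\{\{g^{\mathbf n}_i(\eta,\nu){\restriction}\ell_{\mathbf m},g^{\mathbf n}_i(\nu,\eta){\restriction}\ell_{\mathbf m}\}:i<\iota\}$, and for $i,j<\iota$, $g^{\mathbf m}_i(\eta',\nu')=g^{\mathbf n}_j(\eta,\nu){\restriction}\ell_{\mathbf m}$ implies $h^{\mathbf m}_i(\eta',\nu')=h^{\mathbf n}_j(\eta,\nu)$, and $g^{\mathbf m}_i(\eta',\nu')=g^{\mathbf n}_j(\nu,\eta){\restriction}\ell_{\mathbf m}$ implies $h^{\mathbf m}_i(\eta',\nu')=h^{\mathbf n}_j(\nu,\eta)$. Write $\mathbf m\doteqdot\mathbf n$ if $\ell_{\mathbf m}=\ell_{\mathbf n}$ and $\mathbf m\sqsubseteq^*\mathbf n$. For $\rho\in{}^{\ell_{\mathbf m}}2$, $\mathbf m+\rho$ is obtained by replacing $u$ by $u+\rho$ and setting $h_i'(\eta+\rho,\nu+\rho)=h_i(\eta,\nu)$,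 $g_i'(\eta+\rho,\nu+\rho)=g_i(\eta,\nu)$. **Bricks.** Let $S=(\omega,\bar r,\bar\jmath,\bar k)$ be a cute $\mathcal{YZR}(\varepsilon)$-system and $\bar c=\langle c_m:m<\omega\rangle\subseteq\omega$. An $(S,\iota,\bar T,\bar c)$-brick is $\mathfrak b=(w,n,\bar\eta,\bar h,\bar g,\mathcal M)$ such that: $w\in[\omega]^{<\omega}$, $|w|\ge3$, $0<n<\omega$; $\langle\eta_a:a\in w\rangle$ are linearly independent in ${}^n2$ over $\mathbb Z_2$; for $i<\iota$, $h_i:w^{\langle2\rangle}\to\omega$ with $c_{h_i(a,b)}\le n$, and $g_i:w^{\langle2\rangle}\to\bigcup_m(T_m\cap{}^n2)$; the tuple $(n,\{\eta_a:a\in w\},\bar h^*,\bar g^*)$ with $h_i^*(\eta_a,\eta_b)=h_i(a,b)$, $g_i^*(\eta_a,\eta_b)=g_i(a,b)$ is in $\mathbf M_{\bar T,\iota}$; $\mathcal M$ is the set of all $\mathbf m=\mathbf m(\ell,v)\in\mathbf M_{\bar T,\iota}$ with $v\subseteq w$, $|v|\ge3$, $0<\ell\le n$, $c_{h_i(a,b)}\le\ell$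 for $(a,b)\in v^{\langle2\rangle}$, the $\eta_a{\restriction}\ell$ $(a\in v)$ pairwise distinct, $\ell_{\mathbf m}=\ell$, $u_{\mathbf m}=\{\eta_a{\restriction}\ell:a\in v\}$, $h^{\mathbf m}_i(\eta_a{\restriction}\ell,\eta_b{\restriction}\ell)=h_i(a,b)$, $g^{\mathbf m}_i(\eta_a{\restriction}\ell,\eta_b{\restriction}\ell)=g_i(a,b){\restriction}\ell$; and * if $\mathbf m(\ell,w_0),\mathbf m(\ell,w_1)\in\mathcal M$, $\rho\in{}^\ell2$ and $\mathbf m(\ell,w_0)\doteqdot\mathbf m(\ell,w_1)+\rho$, then the order isomorphism $\pi:w_0\to w_1$ is a quasi-embedding (into $S$) and $(\eta_a{\restriction}\ell)+\rho=\eta_{\pi(a)}{\restriction}\ell$ for $a\in w_0$; * if $\mathbf m(\ell,v)\in\mathcal M$, $a\in v$, $|a\cap v|=\bar k(v)$, $\bar r(v)=0$ and $\mathbf m(\ell,v)\sqsubseteq^*\mathbf n\in\mathcal M$, then $|\{\nu\in u_{\mathbf n}:\eta_a{\restriction}\ell\trianglelefteq\nu\}|=1$. Write $\mathfrak b_0\Subset\mathfrak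 b_1$ if $w^{\mathfrak b_0}\subseteq w^{\mathfrak b_1}$, $n^{\mathfrak b_0}\le n^{\mathfrak b_1}$, $\eta^{\mathfrak b_0}_a\trianglelefteq\eta^{\mathfrak b_1}_a$, $h_i^{\mathfrak b_1}(a,b)=h_i^{\mathfrak b_0}(a,b)$ and $g_i^{\mathfrak b_0}(a,b)\trianglelefteq g_i^{\mathfrak b_1}(a,b)$ for all $i<\iota$ and distinct $a,b\in w^{\mathfrak b_0}$. For $v\subseteq w^{\mathfrak b}$ with $|v|\ge3$, $\mathfrak b{\restriction}v$ is the brick with $w=v$, the same $n$, and the restricted $\bar\eta,\bar h,\bar g$; for a quasi-embedding $\varphi:w^{\mathfrak b}\to\omega$, $\varphi(\mathfrak b)$ is the copy of $\mathfrak b$ along $\varphi$. **Controlled amalgamation.** $\bar T$ has the $(\bar c,S)$-controlled amalgamation property if there are $(S,\iota,\bar T,\bar c)$-bricks $\mathfrak b_n$ $(n<\omega)$ such that (1) $\mathfrak b_n\Subset\mathfrak b_{n+1}$; (2) $\bigcup_nw^{\mathfrak b_n}=\omega$ and $n^{\mathfrak b_n}\to\infty$; (3) if $u\subseteq w\subseteq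 w^{\mathfrak b_n}$, $|w|\ge3$, $\bar k(v\cup\{\delta\})\ne|\delta\cap v|$ whenever $v\subseteq u$, $\delta\in w\setminus u$ and $\bar r(v\cup\{\delta\})=0$, and $\pi_0,\pi_1:w\to\omega$ are quasi-embeddings (into $S$) agreeing on $u$ with $\pi_0[w\setminus u]\cap\pi_1[w\setminus u]=\emptyset$, then there are $K<\omega$ and a quasi-embedding $\pi:\mathrm{rng}(\pi_0)\cup\mathrm{rng}(\pi_1)\to w^{\mathfrak b_K}$ with $(\pi\circ\pi_j)(\mathfrak b_n{\restriction}w)\Subset\mathfrak b_K{\restriction}(\pi\circ\pi_j)[w]$ for $j=0,1$; (4) if $w\subseteq w^{\mathfrak b_n}$, $|w|\ge3$, $\pi_0:w\to\omega$ is a quasi-embedding and $\mathrm{rng}(\pi_0)\subseteq u\in[\omega]^{<\omega}$, then there are $K<\omega$ and a quasi-embedding $\pi:u\to w^{\mathfrak b_K}$ with $(\pi\circ\pi_0)(\mathfrak b_n{\restriction}w)\Subset\mathfrak b_K{\restriction}(\pi\circ\pi_0)[w]$. **Theorem.** Let $0<\varepsilon<\omega_1$, $2\le\iota<\omega$, and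 let $S=(\omega,\bar r,\bar\jmath,\bar k)$ be a cute $\mathcal{YZR}(\varepsilon)$-system. Then there are a sequence $\bar T=\langle T_m:m<\omega\rangle$ of trees $T_m\subseteq{}^{\omega>}2$ without maximal nodes and a sequence $\bar c=\langle c_m:m<\omega\rangle$ of non-negative integers such that 1. $\bar T$ has the $(\bar c,S)$-controlled amalgamation property (for this $\iota$), and 2. $\varepsilon\le\mathrm{ndrk}_\iota(\bar T)\le\omega\cdot(\varepsilon+2)+2$ (ordinal operations). -/

import Mathlib

open Set Filter Ordinal

/-! ### Systems of ranks on finite sets -/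

/-- The number of elements of `w` below `b`, i.e. `|w ∩ b|` when `b` is an ordinal. -/
def countBelow {α : Type*} [LinearOrder α] (w : Finset α) (b : α) : ℕ :=
  (w.filter (fun x => x < b)).card

/-- A `YZR(ε)`-system whose underlying nonempty set `X` is a subset of the well-order `α`.
For `α = Ordinal` these are the systems on sets of ordinals; for `α = ℕ` the systems on subsets of
`ω`. The functions `r`, `j`, `k` matter only on nonempty finite subsets of `X`. -/
structure YZRSystem (ε : Ordinal.{0}) (α : Type*) [LinearOrder α] [WellFoundedLT α] where
  X : Set α
  r : Finset α → Ordinal.{0}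
  j : Finset α → ℕ
  k : Finset α → ℕ
  nonempty : X.Nonempty
  r_le : ∀ w : Finset α, w.Nonempty → (w : Set α) ⊆ X → r w ≤ ε
  r_anti : ∀ u w : Finset α, u.Nonempty → u ⊆ w → (w : Set α) ⊆ X → r w ≤ r u
  r_singleton : ∀ a ∈ X, 0 < r {a}
  k_lt : ∀ w : Finset α, w.Nonempty → (w : Set α) ⊆ X → k w < w.card
  /-- Here `a` is the element of `w` with index `k w` in the increasing enumeration of `w`. -/
  no_twin : ∀ w : Finset α, w.Nonempty → (w : Set α) ⊆ X →
    ∀ a ∈ w, countBelow w a = k w →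
      ¬ ∃ b ∈ X, b ∉ w ∧ countBelow w b = k w ∧ j (insert b (w.erase a)) = j w ∧
        r (insert b w) = r w

/-- `φ` restricted to `w ⊆ X^q` is an increasing map into `X^s` preserving `r`, `k`, and, for sets
of positive rank, `j`; that is, a quasi-embedding into `s` of the restriction of `q` to `w`. -/
structure IsQuasiEmbedding {ε : Ordinal.{0}} {α β : Type*} [LinearOrder α] [WellFoundedLT α]
    [LinearOrder β] [WellFoundedLT β] (q : YZRSystem ε α) (s : YZRSystem ε β) (w : Set α)
    (φ : α → β) : Prop where
  subset : w ⊆ q.X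
  mapsTo : MapsTo φ w s.X
  strictMono : StrictMonoOn φ w
  r_eq : ∀ v : Finset α, v.Nonempty → (v : Set α) ⊆ w → s.r (v.image φ) = q.r v
  k_eq : ∀ v : Finset α, v.Nonempty → (v : Set α) ⊆ w → s.k (v.image φ) = q.k v
  j_eq : ∀ v : Finset α, v.Nonempty → (v : Set α) ⊆ w → 0 < q.r v → s.j (v.image φ) = q.j v

/-- A system on all of `ω` into which every finite system (on a set of ordinals) quasi-embeds,
arbitrarily far out. -/
def YZRSystem.IsCute {ε : Ordinal.{0}} (S : YZRSystem ε ℕ) : Prop :=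
  S.X = Set.univ ∧
    ∀ q : YZRSystem ε Ordinal.{0}, q.X.Finite → ∀ M : ℕ,
      ∃ φ : Ordinal.{0} → ℕ, IsQuasiEmbedding q S q.X φ ∧ ∀ x ∈ q.X, M ≤ φ x

/-! ### Binary sequences and trees -/

/-- Binary sequences of length `n`, with coordinatewise addition modulo 2. -/
abbrev Node (n : ℕ) : Type := Fin n → ZMod 2

/-- The restriction of a finite sequence to a shorter length. -/
def Node.res {m n : ℕ} (h : m ≤ n) (η : Node n) : Node m := fun i => η (Fin.castLE h i)

/-- `η` is a (not necessarily proper) initial segment of `ν`. -/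
def Node.IsInitSeg {m n : ℕ} (η : Node m) (ν : Node n) : Prop := ∃ h : m ≤ n, ν.res h = η

/-- The restriction to length `n` of a point of the Cantor space. -/
def cantorRes (x : ℕ → ZMod 2) (n : ℕ) : Node n := fun i => x i

/-- A tree of finite binary sequences: a set of sequences closed under initial segments,
given by its levels. -/
structure BinTree where
  level : (n : ℕ) → Set (Node n)
  closed : ∀ {m n : ℕ} (h : m ≤ n) (η : Node n), η ∈ level n → η.res h ∈ level m

/-- Every node has a proper extension in the tree. -/
def BinTree.NoMaximal (T : BinTree) : Prop :=
  ∀ (m : ℕ) (η : Node m), η ∈ T.level m →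
    ∃ (n : ℕ) (h : m < n) (ν : Node n), ν ∈ T.level n ∧ ν.res h.le = η

/-- The set of infinite branches. -/
def BinTree.lim (T : BinTree) : Set (ℕ → ZMod 2) := {x | ∀ n, cantorRes x n ∈ T.level n}

/-! ### Configurations and the non-disjointness rank -/

/-- Tuples `(ℓ, u, h, g)`. The functions `h i`, `g i` matter only on pairs of distinct elements
of `u`; their other values are irrelevant. -/
structure Config (ι : ℕ) where
  len : ℕ
  u : Finset (Node len)
  h : Fin ι → Node len → Node len → ℕ
  g : Fin ι → Node len → Node len → Node len

/-- Membership of a tuple in the family `M_{T,ι}`. -/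
structure IsConfig {ι : ℕ} (T : ℕ → BinTree) (m : Config ι) : Prop where
  len_pos : 0 < m.len
  two_le : 2 ≤ m.u.card
  g_mem : ∀ p ∈ m.u.offDiag, ∀ i, m.g i p.1 p.2 ∈ (T (m.h i p.1 p.2)).level m.len
  add_eq : ∀ p ∈ m.u.offDiag, ∀ i, p.1 + m.g i p.1 p.2 = p.2 + m.g i p.2 p.1
  no_rep : ∀ p ∈ m.u.offDiag,
    Function.Injective (Sum.elim (fun i => m.g i p.1 p.2) (fun i => m.g i p.2 p.1))
  branches : ∃ (F : Node m.len → ℕ → ZMod 2)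
      (G : Fin ι → Node m.len → Node m.len → ℕ → ZMod 2),
    (∀ η ∈ m.u, cantorRes (F η) m.len = η) ∧
    ∀ p ∈ m.u.offDiag, ∀ i,
      cantorRes (G i p.1 p.2) m.len = m.g i p.1 p.2 ∧
      G i p.1 p.2 ∈ (T (m.h i p.1 p.2)).lim ∧
      F p.1 + G i p.1 p.2 = F p.2 + G i p.2 p.1

/-- The family `M_{T,ι}`. -/
def configs (T : ℕ → BinTree) (ι : ℕ) : Set (Config ι) := {m | IsConfig T m}

/-- The translation `m + ρ`. -/
def Config.translate {ι : ℕ} (m : Config ι) (ρ : Node m.len) : Config ι where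
  len := m.len
  u := m.u.image (fun η => η + ρ)
  h := fun i η ν => m.h i (η - ρ) (ν - ρ)
  g := fun i η ν => m.g i (η - ρ) (ν - ρ)

/-- `n` extends `m`. -/
def Config.Extends {ι : ℕ} (m n : Config ι) : Prop :=
  ∃ hl : m.len ≤ n.len,
    m.u = n.u.image (fun η => η.res hl) ∧
    ∀ p ∈ n.u.offDiag, p.1.res hl ≠ p.2.res hl → ∀ i,
      m.h i (p.1.res hl) (p.2.res hl) = n.h i p.1 p.2 ∧
      m.g i (p.1.res hl) (p.2.res hl) = (n.g i p.1 p.2).res hl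

/-- `n` essentially extends `m`: as extension, but up to permuting the indices `i` and swapping
`g i η ν` with `g i ν η`. -/
def Config.EssExtends {ι : ℕ} (m n : Config ι) : Prop :=
  ∃ hl : m.len ≤ n.len,
    m.u = n.u.image (fun η => η.res hl) ∧
    ∀ p ∈ n.u.offDiag, p.1.res hl ≠ p.2.res hl →
      (Set.range (fun i => s(m.g i (p.1.res hl) (p.2.res hl), m.g i (p.2.res hl) (p.1.res hl))) =
        Set.range (fun i => s((n.g i p.1 p.2).res hl, (n.g i p.2 p.1).res hl))) ∧
      ∀ i i' : Fin ι,
        (m.g i (p.1.res hl) (p.2.res hl) = (n.g i' p.1 p.2).res hl →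
          m.h i (p.1.res hl) (p.2.res hl) = n.h i' p.1 p.2) ∧
        (m.g i (p.1.res hl) (p.2.res hl) = (n.g i' p.2 p.1).res hl →
          m.h i (p.1.res hl) (p.2.res hl) = n.h i' p.2 p.1)

/-- `m` and `n` are essentially the same: equal lengths and (hence) equal sets `u`, and the
conditions of `EssExtends` for all pairs of distinct elements of `u`. -/
def Config.EssSame {ι : ℕ} (m n : Config ι) : Prop := m.len = n.len ∧ m.EssExtends n

/-- `NdrkGE T α m` is the relation `ndrk_ι(m) ≥ α`, defined by recursion on `α`. -/
noncomputable def NdrkGE {ι : ℕ} (T : ℕ → BinTree) (α : Ordinal.{0}) : Config ι → Prop :=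
  Ordinal.limitRecOn (motive := fun _ => Config ι → Prop) α
    (fun _ => True)
    (fun _ P m => ∀ ν ∈ m.u, ∃ n ∈ configs T ι,
      m.len < n.len ∧ m.Extends n ∧ P n ∧ 2 ≤ {η | η ∈ n.u ∧ ν.IsInitSeg η}.ncard)
    (fun _ _ P m => ∀ β hβ, P β hβ m)

/-- The rank `ndrk_ι(m)`, an ordinal or `⊤`. -/
noncomputable def ndrk {ι : ℕ} (T : ℕ → BinTree) (m : Config ι) : WithTop Ordinal.{0} :=
  sSup ((fun α : Ordinal.{0} => (α : WithTop Ordinal.{0})) '' {α | NdrkGE T α m})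

/-- The rank `ndrk_ι(T)`, the supremum over `M_{T,ι}`. -/
noncomputable def ndrkTree (T : ℕ → BinTree) (ι : ℕ) : WithTop Ordinal.{0} :=
  ⨆ m ∈ configs T ι, ndrk T m

/-! ### Bricks -/

/-- The data of a brick, without its last component, which is determined by the others (see
`BrickData.family`). Only the values at elements of `w`, or at pairs of distinct elements of `w`,
matter. -/
structure BrickData (ι : ℕ) where
  w : Finset ℕ
  n : ℕ
  η : ℕ → Node n
  h : Fin ι → ℕ → ℕ → ℕ
  g : Fin ι → ℕ → ℕ → Node n

/-- The tuple `m(ℓ, v)`: it has `u = {η a ↾ ℓ : a ∈ v}`, and `h`, `g` are carried over along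
`a ↦ η a ↾ ℓ`, which is meant to be injective on `v`. -/
noncomputable def BrickData.trace {ι : ℕ} (b : BrickData ι) {l : ℕ} (hl : l ≤ b.n)
    (v : Finset ℕ) : Config ι where
  len := l
  u := v.image (fun a => (b.η a).res hl)
  h := fun i x y => b.h i (Function.invFunOn (fun a => (b.η a).res hl) v x)
    (Function.invFunOn (fun a => (b.η a).res hl) v y)
  g := fun i x y => (b.g i (Function.invFunOn (fun a => (b.η a).res hl) v x)
    (Function.invFunOn (fun a => (b.η a).res hl) v y)).res hl

/-- The pair `(ℓ, v)` gives rise to a member `m(ℓ, v)` of the family of the brick. -/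
structure BrickData.Admissible {ι : ℕ} (b : BrickData ι) (T : ℕ → BinTree) (c : ℕ → ℕ)
    {l : ℕ} (hl : l ≤ b.n) (v : Finset ℕ) : Prop where
  subset : v ⊆ b.w
  three_le : 3 ≤ v.card
  pos : 0 < l
  c_le : ∀ p ∈ v.offDiag, ∀ i, c (b.h i p.1 p.2) ≤ l
  inj : Set.InjOn (fun a => (b.η a).res hl) v
  mem : b.trace hl v ∈ configs T ι

/-- The last component of a brick: all members of `M_{T,ι}` of the form `m(ℓ, v)`. -/
def BrickData.family {ι : ℕ} (b : BrickData ι) (T : ℕ → BinTree) (c : ℕ → ℕ) :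
    Set (Config ι) :=
  {m | ∃ (l : ℕ) (hl : l ≤ b.n) (v : Finset ℕ), b.Admissible T c hl v ∧ m = b.trace hl v}

/-- `b` is an `(S, ι, T, c)`-brick. -/
structure IsBrick {ε : Ordinal.{0}} (S : YZRSystem ε ℕ) {ι : ℕ} (T : ℕ → BinTree) (c : ℕ → ℕ)
    (b : BrickData ι) : Prop where
  three_le : 3 ≤ b.w.card
  n_pos : 0 < b.n
  linInd : LinearIndependent (ZMod 2) (fun a : b.w => b.η a)
  c_le : ∀ p ∈ b.w.offDiag, ∀ i, c (b.h i p.1 p.2) ≤ b.n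
  g_mem : ∀ p ∈ b.w.offDiag, ∀ i, ∃ m, b.g i p.1 p.2 ∈ (T m).level b.n
  top_mem : b.trace le_rfl b.w ∈ configs T ι
  /-- `π` is the order isomorphism of `v₀` onto `v₁`. -/
  rigid : ∀ (l : ℕ) (hl : l ≤ b.n) (v₀ v₁ : Finset ℕ),
    b.Admissible T c hl v₀ → b.Admissible T c hl v₁ → ∀ ρ : Node l,
    (b.trace hl v₀).EssSame ((b.trace hl v₁).translate ρ) →
    ∃ π : ℕ → ℕ, StrictMonoOn π v₀ ∧ v₀.image π = v₁ ∧ IsQuasiEmbedding S S v₀ π ∧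
      ∀ a ∈ v₀, (b.η a).res hl + ρ = (b.η (π a)).res hl
  no_split : ∀ (l : ℕ) (hl : l ≤ b.n) (v : Finset ℕ), b.Admissible T c hl v →
    ∀ a ∈ v, countBelow v a = S.k v → S.r v = 0 →
    ∀ n ∈ b.family T c, (b.trace hl v).EssExtends n →
      {ν | ν ∈ n.u ∧ ((b.η a).res hl).IsInitSeg ν}.ncard = 1

/-- The relation `b₀ ⋐ b₁`. -/
def BrickData.Below {ι : ℕ} (b₀ b₁ : BrickData ι) : Prop :=
  b₀.w ⊆ b₁.w ∧ b₀.n ≤ b₁.n ∧ (∀ a ∈ b₀.w, (b₀.η a).IsInitSeg (b₁.η a)) ∧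
    ∀ p ∈ b₀.w.offDiag, ∀ i,
      b₁.h i p.1 p.2 = b₀.h i p.1 p.2 ∧ (b₀.g i p.1 p.2).IsInitSeg (b₁.g i p.1 p.2)

/-- The restriction of a brick to `v ⊆ w`. -/
def BrickData.restrict {ι : ℕ} (b : BrickData ι) (v : Finset ℕ) : BrickData ι where
  w := v
  n := b.n
  η := b.η
  h := b.h
  g := b.g

/-- The copy `φ(b)` of a brick along a map `φ` that is injective on `w`. -/
noncomputable def BrickData.map {ι : ℕ} (φ : ℕ → ℕ) (b : BrickData ι) : BrickData ι where
  w := b.w.image φ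
  n := b.n
  η := fun x => b.η (Function.invFunOn φ b.w x)
  h := fun i x y => b.h i (Function.invFunOn φ b.w x) (Function.invFunOn φ b.w y)
  g := fun i x y => b.g i (Function.invFunOn φ b.w x) (Function.invFunOn φ b.w y)

/-- The sequence of trees `T` has the `(c, S)`-controlled amalgamation property (for `ι`). -/
def ControlledAmalgamation {ε : Ordinal.{0}} (S : YZRSystem ε ℕ) (ι : ℕ) (T : ℕ → BinTree)
    (c : ℕ → ℕ) : Prop :=
  ∃ b : ℕ → BrickData ι,
    (∀ n, IsBrick S T c (b n)) ∧
    (∀ n, (b n).Below (b (n + 1))) ∧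
    (∀ a : ℕ, ∃ n, a ∈ (b n).w) ∧
    Tendsto (fun n => (b n).n) atTop atTop ∧
    (∀ (n : ℕ) (u w : Finset ℕ), u ⊆ w → w ⊆ (b n).w → 3 ≤ w.card →
      (∀ v ⊆ u, ∀ δ ∈ w \ u, S.r (insert δ v) = 0 → S.k (insert δ v) ≠ countBelow v δ) →
      ∀ π₀ π₁ : ℕ → ℕ, IsQuasiEmbedding S S w π₀ → IsQuasiEmbedding S S w π₁ →
        (∀ a ∈ u, π₀ a = π₁ a) → Disjoint ((w \ u).image π₀) ((w \ u).image π₁) →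
        ∃ (K : ℕ) (π : ℕ → ℕ),
          IsQuasiEmbedding S S (w.image π₀ ∪ w.image π₁ : Finset ℕ) π ∧
          (w.image π₀ ∪ w.image π₁).image π ⊆ (b K).w ∧
          (((b n).restrict w).map (π ∘ π₀)).Below ((b K).restrict (w.image (π ∘ π₀))) ∧
          (((b n).restrict w).map (π ∘ π₁)).Below ((b K).restrict (w.image (π ∘ π₁)))) ∧
    (∀ (n : ℕ) (w : Finset ℕ), w ⊆ (b n).w → 3 ≤ w.card →
      ∀ (π₀ : ℕ → ℕ) (u : Finset ℕ), IsQuasiEmbedding S S w π₀ → w.image π₀ ⊆ u →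
        ∃ (K : ℕ) (π : ℕ → ℕ),
          IsQuasiEmbedding S S u π ∧ u.image π ⊆ (b K).w ∧
          (((b n).restrict w).map (π ∘ π₀)).Below ((b K).restrict (w.image (π ∘ π₀))))

/-!
The trees are read off from a tower of finite sets `w K` exhausting `ω` (`Tower`). At each step two
new sets `left K` and `right K` are added which are copies, under quasi-embeddings, of a part of
`w K`, and the map `fold K` sends them back to `w K`. A bookkeeping argument (`exists_tower`)
produces a tower which is universal: every admissible amalgam of two copies is realized. The one
restriction, the field `guarded`, keeps a point `a` from being doubled over a set `v` if `a` is the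
distinguished point of `v` and `r v = 0`; it is exactly what the amalgamation property permits.

At stage `K` each `a ∈ w K` gets a finite sequence `node K a`, and each index `i` and pair `(a, b)`
a sequence `brNode K i a b`. On the coordinates added at stage `K` these contain distinct unit
vectors; on the earlier coordinates they are copied along `fold`. The tree `tree m` consists of the
initial segments of the sequences of the pairs whose stage of birth is `m`, a copied pair having
the stage of birth of its original. The stages `brick K` are the bricks. Since the unit vectors
are linearly independent, initial segments and differences determine the points up to pulling back
along the maps `fold` (`eq_of_node_add`, `pull_eq_of_res_eq`), and pulling back is a
quasi-embedding on sets all of whose pairs are old enough (`pull_quasiEmbedding`). This gives the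
rigidity of bricks, while `not_doubled`, hence `brick_no_split`, comes from `guarded`.

For the lower bound, a finite set `w` with `r w > β` can be amalgamated with itself over the
complement of any point so that the union has rank at least `β`
(`YZRSystem.IsCute.exists_doubling`); so the configuration carried by `w` has rank at least `r w`
(`ndrkGE_trace`).

For the upper bound, a configuration with at least five elements is a translate of a configuration
carried by a finite set of some stage (`exists_isRep`): each difference of two elements is in `ι`
ways a difference of two branches, and comparing coordinates in the last block leaves only the
differences of two nodes, apart from exceptional ones which cannot occur among five elements. If
such a configuration is longer than the stages of birth of its pairs and its distinguished point is
split, then the value of `r` at the representing set drops (`IsRep.rank_lt`), by `no_twin` if it was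
positive and by `not_doubled` if it was zero. Lengthening costs finitely many steps of the rank, a
number not known in advance, hence `ω` for each value of `r` (`not_ndrkGE_of_isRep`), and three
further splittings reach five elements from two (`ndrkTree_le`).
-/

/-! ### Quasi-embeddings -/

theorem countBelow_image {α β : Type*} [LinearOrder α] [LinearOrder β] {A : Set α} {φ : α → β}
    (h : StrictMonoOn φ A) {v : Finset α} (hv : (v : Set α) ⊆ A) {x : α} (hx : x ∈ A) :
    countBelow (v.image φ) (φ x) = countBelow v x := by
  unfold countBelow
  have : (v.image φ).filter (fun y => y < φ x) = (v.filter (fun y => y < x)).image φ := by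
    ext y
    simp only [Finset.mem_filter, Finset.mem_image]
    constructor
    · rintro ⟨⟨a, ha, rfl⟩, hlt⟩
      exact ⟨a, ⟨ha, (h.lt_iff_lt (hv ha) hx).1 hlt⟩, rfl⟩
    · rintro ⟨a, ⟨ha, hlt⟩, rfl⟩
      exact ⟨⟨a, ha, rfl⟩, h (hv ha) hx hlt⟩
  rw [this, Finset.card_image_of_injOn]
  exact h.injOn.mono fun a ha => hv (Finset.mem_filter.1 ha).1

section QuasiEmbedding

variable {ε : Ordinal.{0}} {α β γ : Type*} [LinearOrder α] [WellFoundedLT α]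
  [LinearOrder β] [WellFoundedLT β] [LinearOrder γ] [WellFoundedLT γ]
  {q : YZRSystem ε α} {s : YZRSystem ε β} {t : YZRSystem ε γ}

theorem IsQuasiEmbedding.mono {A B : Set α} {φ : α → β} (h : IsQuasiEmbedding q s B φ)
    (hAB : A ⊆ B) : IsQuasiEmbedding q s A φ where
  subset := hAB.trans h.subset
  mapsTo := h.mapsTo.mono_left hAB
  strictMono := h.strictMono.mono hAB
  r_eq v hv hvA := h.r_eq v hv (hvA.trans hAB)
  k_eq v hv hvA := h.k_eq v hv (hvA.trans hAB)
  j_eq v hv hvA := h.j_eq v hv (hvA.trans hAB)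

theorem IsQuasiEmbedding.comp {A : Set α} {B : Set β} {φ : α → β} {ψ : β → γ}
    (hψ : IsQuasiEmbedding s t B ψ) (hφ : IsQuasiEmbedding q s A φ) (hAB : MapsTo φ A B) :
    IsQuasiEmbedding q t A (ψ ∘ φ) where
  subset := hφ.subset
  mapsTo := hψ.mapsTo.comp hAB
  strictMono := hψ.strictMono.comp hφ.strictMono hAB
  r_eq v hv hvA := by
    rw [← Finset.image_image, hψ.r_eq _ (hv.image φ), hφ.r_eq v hv hvA]
    simpa using (Set.image_mono hvA).trans hAB.image_subset
  k_eq v hv hvA := by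
    rw [← Finset.image_image, hψ.k_eq _ (hv.image φ), hφ.k_eq v hv hvA]
    simpa using (Set.image_mono hvA).trans hAB.image_subset
  j_eq v hv hvA hr := by
    have hvB : ((v.image φ : Finset β) : Set β) ⊆ B := by
      simpa using (Set.image_mono hvA).trans hAB.image_subset
    rw [← Finset.image_image, hψ.j_eq _ (hv.image φ) hvB, hφ.j_eq v hv hvA hr]
    rwa [hφ.r_eq v hv hvA]

theorem IsQuasiEmbedding.congr {A : Set α} {φ ψ : α → β} (h : IsQuasiEmbedding q s A φ)
    (he : EqOn φ ψ A) : IsQuasiEmbedding q s A ψ := by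
  have him : ∀ v : Finset α, (v : Set α) ⊆ A → v.image ψ = v.image φ := fun v hv =>
    Finset.image_congr fun x hx => (he (hv hx)).symm
  exact
  { subset := h.subset
    mapsTo := h.mapsTo.congr he
    strictMono := h.strictMono.congr he
    r_eq := fun v hv hvA => by rw [him v hvA]; exact h.r_eq v hv hvA
    k_eq := fun v hv hvA => by rw [him v hvA]; exact h.k_eq v hv hvA
    j_eq := fun v hv hvA => by rw [him v hvA]; exact h.j_eq v hv hvA }

theorem isQuasiEmbedding_id {A : Set α} (hA : A ⊆ q.X) : IsQuasiEmbedding q q A id where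
  subset := hA
  mapsTo := fun _ hx => hA hx
  strictMono := fun _ _ _ _ h => h
  r_eq v _ _ := by simp
  k_eq v _ _ := by simp
  j_eq v _ _ _ := by simp

/-- The inverse of a quasi-embedding is a quasi-embedding of its range. -/
theorem IsQuasiEmbedding.inverse {A : Set α} {φ : α → β} {ψ : β → α}
    (h : IsQuasiEmbedding q s A φ) (hψ : LeftInvOn ψ φ A) :
    IsQuasiEmbedding s q (φ '' A) ψ := by
  have key : ∀ v : Finset β, (v : Set β) ⊆ φ '' A → ((v.image ψ : Finset α) : Set α) ⊆ A ∧
      (v.image ψ).image φ = v := by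
    intro v hv
    have h1 : ∀ x ∈ v, ψ x ∈ A ∧ φ (ψ x) = x := by
      intro x hx
      obtain ⟨a, ha, rfl⟩ := hv hx
      rw [hψ ha]; exact ⟨ha, rfl⟩
    constructor
    · intro a ha
      obtain ⟨x, hx, rfl⟩ := Finset.mem_image.1 (Finset.mem_coe.1 ha)
      exact (h1 x hx).1
    · rw [Finset.image_image]
      conv_rhs => rw [← Finset.image_id (s := v)]
      exact Finset.image_congr fun x hx => (h1 x hx).2
  exact
  { subset := h.mapsTo.image_subset
    mapsTo := by
      rintro _ ⟨a, ha, rfl⟩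
      rw [hψ ha]; exact h.subset ha
    strictMono := by
      rintro _ ⟨a, ha, rfl⟩ _ ⟨b, hb, rfl⟩ hab
      rw [hψ ha, hψ hb]; exact (h.strictMono.lt_iff_lt ha hb).1 hab
    r_eq := fun v hv hvA => by
      have := h.r_eq _ (hv.image ψ) (key v hvA).1
      rw [(key v hvA).2] at this; exact this.symm
    k_eq := fun v hv hvA => by
      have := h.k_eq _ (hv.image ψ) (key v hvA).1
      rw [(key v hvA).2] at this; exact this.symm
    j_eq := fun v hv hvA hr => by
      have h1 := h.r_eq _ (hv.image ψ) (key v hvA).1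
      have := h.j_eq _ (hv.image ψ) (key v hvA).1
      rw [(key v hvA).2] at this h1
      exact (this (h1 ▸ hr)).symm }

end QuasiEmbedding

/-! ### Towers of finite sets with copies -/

/-- The combinatorial skeleton of the construction: an increasing sequence of finite sets `w K`
exhausting `ω`.  The set `w (K + 1)` contains two distinguished sets `left K` and `right K` of new
points, each of which `fold K` identifies, by a quasi-embedding, with a subset of `w K`; the map
`fold K` retracts `w (K + 1)` onto `w K`, and its values at the remaining new points are
irrelevant.  The condition `guarded` keeps a point from being doubled over a set `v` when this is
forbidden by a vanishing rank. -/
structure Tower {ε : Ordinal.{0}} (S : YZRSystem ε ℕ) where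
  w : ℕ → Finset ℕ
  left : ℕ → Finset ℕ
  right : ℕ → Finset ℕ
  fold : ℕ → ℕ → ℕ
  three_le : 3 ≤ (w 0).card
  sub_succ : ∀ K, w K ⊆ w (K + 1)
  mem_succ : ∀ K, K ∈ w (K + 1)
  left_sub : ∀ K, left K ⊆ w (K + 1)
  right_sub : ∀ K, right K ⊆ w (K + 1)
  left_disj : ∀ K, Disjoint (left K) (w K)
  right_disj : ∀ K, Disjoint (right K) (w K)
  fold_mem : ∀ K, ∀ a ∈ w (K + 1), fold K a ∈ w K
  fold_id : ∀ K, ∀ a ∈ w K, fold K a = a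
  fold_left : ∀ K, IsQuasiEmbedding S S (left K) (fold K)
  fold_right : ∀ K, IsQuasiEmbedding S S (right K) (fold K)
  guarded : ∀ K, ∀ v ⊆ left K ∩ right K, ∀ x ∈ left K ∪ right K, x ∉ left K ∩ right K →
    S.r (insert x v) = 0 → S.k (insert x v) ≠ countBelow v x

namespace Tower

variable {ε : Ordinal.{0}} {S : YZRSystem ε ℕ} (𝒯 : Tower S)

/-- The pair `{a, b}` of points of `w (K + 1)` is old: it lies in `w K` or in one of the two
distinguished copies of parts of `w K`. -/
def Old (K a b : ℕ) : Prop :=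
  (a ∈ 𝒯.w K ∧ b ∈ 𝒯.w K) ∨ (a ∈ 𝒯.left K ∧ b ∈ 𝒯.left K) ∨ (a ∈ 𝒯.right K ∧ b ∈ 𝒯.right K)

theorem Old.symm {𝒯 : Tower S} {K a b : ℕ} (h : 𝒯.Old K a b) : 𝒯.Old K b a := by
  unfold Old at *; tauto

theorem old_comm {K a b : ℕ} : 𝒯.Old K a b ↔ 𝒯.Old K b a := ⟨Old.symm, Old.symm⟩

theorem old_of_mem {K a b : ℕ} (ha : a ∈ 𝒯.w K) (hb : b ∈ 𝒯.w K) : 𝒯.Old K a b := Or.inl ⟨ha, hb⟩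

theorem mono {K N : ℕ} (h : K ≤ N) : 𝒯.w K ⊆ 𝒯.w N :=
  monotone_nat_of_le_succ (f := 𝒯.w) 𝒯.sub_succ h

theorem mem_w {a K : ℕ} (h : a < K) : a ∈ 𝒯.w K := 𝒯.mono (Nat.succ_le_of_lt h) (𝒯.mem_succ a)

theorem three_le_card (K : ℕ) : 3 ≤ (𝒯.w K).card :=
  𝒯.three_le.trans (Finset.card_le_card (𝒯.mono (Nat.zero_le K)))

theorem disjoint_charts {K x : ℕ} (hx : x ∈ 𝒯.w K) : x ∉ 𝒯.left K ∧ x ∉ 𝒯.right K :=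
  ⟨fun h => (Finset.disjoint_left.1 (𝒯.left_disj K)) h hx,
    fun h => (Finset.disjoint_left.1 (𝒯.right_disj K)) h hx⟩

/-- A nontrivial set all of whose pairs are old lies in `w K` or in one of the two copies. -/
theorem exists_chart {K : ℕ} {X : Finset ℕ} (h2 : X.Nontrivial)
    (hX : ∀ a ∈ X, ∀ b ∈ X, a ≠ b → 𝒯.Old K a b) :
    X ⊆ 𝒯.w K ∨ X ⊆ 𝒯.left K ∨ X ⊆ 𝒯.right K := by
  have hmem : ∀ a ∈ X, a ∈ 𝒯.w K ∨ a ∈ 𝒯.left K ∨ a ∈ 𝒯.right K := by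
    intro a ha
    obtain ⟨b, hb, hne⟩ := h2.exists_ne a
    rcases hX a ha b hb hne.symm with h | h | h
    · exact Or.inl h.1
    · exact Or.inr (Or.inl h.1)
    · exact Or.inr (Or.inr h.1)
  by_cases hw : ∃ a ∈ X, a ∈ 𝒯.w K
  · obtain ⟨a, ha, haw⟩ := hw
    left
    intro b hb
    by_cases hab : a = b
    · exact hab ▸ haw
    · rcases hX a ha b hb hab with h | h | h
      · exact h.2
      · exact absurd h.1 (𝒯.disjoint_charts haw).1
      · exact absurd h.1 (𝒯.disjoint_charts haw).2
  · right
    by_cases hl : X ⊆ 𝒯.left K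
    · exact Or.inl hl
    · right
      obtain ⟨a, ha, hal⟩ := Finset.not_subset.1 hl
      intro b hb
      by_cases hab : a = b
      · subst hab
        rcases hmem a ha with h | h | h
        · exact absurd ⟨a, ha, h⟩ hw
        · exact absurd h hal
        · exact h
      · rcases hX a ha b hb hab with h | h | h
        · exact absurd ⟨a, ha, h.1⟩ hw
        · exact absurd h.1 hal
        · exact h.2

theorem fold_chart (hS : S.X = Set.univ) {K : ℕ} {A : Finset ℕ}
    (hA : A ⊆ 𝒯.w K ∨ A ⊆ 𝒯.left K ∨ A ⊆ 𝒯.right K) : IsQuasiEmbedding S S A (𝒯.fold K) := by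
  rcases hA with h | h | h
  · refine (isQuasiEmbedding_id (by simp [hS])).congr fun a ha => ?_
    exact (𝒯.fold_id K a (h ha)).symm
  · exact (𝒯.fold_left K).mono (by exact_mod_cast h)
  · exact (𝒯.fold_right K).mono (by exact_mod_cast h)

theorem fold_lt_fold {K a b : ℕ} (h : 𝒯.Old K a b) (hab : a < b) :
    𝒯.fold K a < 𝒯.fold K b := by
  rcases h with h | h | h
  · rwa [𝒯.fold_id K a h.1, 𝒯.fold_id K b h.2]
  · exact (𝒯.fold_left K).strictMono h.1 h.2 hab
  · exact (𝒯.fold_right K).strictMono h.1 h.2 hab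

theorem fold_ne_fold {K a b : ℕ} (h : 𝒯.Old K a b) (hab : a ≠ b) :
    𝒯.fold K a ≠ 𝒯.fold K b := by
  rcases lt_or_gt_of_ne hab with h' | h'
  · exact (𝒯.fold_lt_fold h h').ne
  · exact (𝒯.fold_lt_fold h.symm h').ne'

theorem fold_lt_fold_iff {K a b : ℕ} (h : 𝒯.Old K a b) :
    𝒯.fold K a < 𝒯.fold K b ↔ a < b := by
  rcases lt_trichotomy a b with hab | hab | hab
  · simp [hab, 𝒯.fold_lt_fold h hab]
  · simp [hab]
  · exact iff_of_false (𝒯.fold_lt_fold h.symm hab).not_gt hab.not_gt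

open Classical in
/-- The stage at which the pair `{a, b}`, or the pair of which it is an iterated copy, appeared. -/
noncomputable def birth : ℕ → ℕ → ℕ → ℕ
  | 0 => fun _ _ => 0
  | K + 1 => fun a b =>
    if 𝒯.Old K a b then birth K (𝒯.fold K a) (𝒯.fold K b) else K + 1

theorem birth_le (K a b : ℕ) : 𝒯.birth K a b ≤ K := by
  induction K generalizing a b with
  | zero => simp [birth]
  | succ K ih =>
    simp only [birth]
    split_ifs
    · exact (ih _ _).trans (Nat.le_succ K)
    · exact le_rfl

open Classical in
theorem birth_comm (K a b : ℕ) : 𝒯.birth K a b = 𝒯.birth K b a := by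
  induction K generalizing a b with
  | zero => simp [birth]
  | succ K ih =>
    simp only [birth]
    rw [ih (𝒯.fold K a)]
    exact if_congr 𝒯.old_comm rfl rfl

theorem birth_succ_of_old {K a b : ℕ} (h : 𝒯.Old K a b) :
    𝒯.birth (K + 1) a b = 𝒯.birth K (𝒯.fold K a) (𝒯.fold K b) := by
  simp [birth, h]

theorem old_of_birth_le {K a b : ℕ} (h : 𝒯.birth (K + 1) a b ≤ K) : 𝒯.Old K a b := by
  by_contra hn
  simp [birth, hn] at h

theorem birth_stable {K N a b : ℕ} (h : K ≤ N) (ha : a ∈ 𝒯.w K) (hb : b ∈ 𝒯.w K) :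
    𝒯.birth N a b = 𝒯.birth K a b := by
  induction N, h using Nat.le_induction with
  | base => rfl
  | succ N h ih =>
    rw [birth_succ_of_old 𝒯 (𝒯.old_of_mem (𝒯.mono h ha) (𝒯.mono h hb)),
      𝒯.fold_id N a (𝒯.mono h ha), 𝒯.fold_id N b (𝒯.mono h hb), ih]

/-! ### Lengths, points and branches -/

/-- The coordinate, relative to the beginning of a block, which belongs to the point `a`. -/
def pointCode (a : ℕ) : ℕ := 2 * a

/-- The coordinate, relative to the beginning of a block, which belongs to the index `i` and the
pair `{a, b}`. -/
def pairCode (i a b : ℕ) : ℕ := 2 * Nat.pair i (Nat.pair (min a b) (max a b)) + 1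

theorem pairCode_comm (i a b : ℕ) : pairCode i a b = pairCode i b a := by
  simp [pairCode, min_comm, max_comm]

theorem pointCode_inj {a b : ℕ} : pointCode a = pointCode b ↔ a = b := by
  simp [pointCode]

theorem pointCode_ne_pairCode (c i a b : ℕ) : pointCode c ≠ pairCode i a b := by
  unfold pointCode pairCode; omega

theorem pairCode_inj {i j a b c d : ℕ} :
    pairCode i a b = pairCode j c d ↔ i = j ∧ (a = c ∧ b = d ∨ a = d ∧ b = c) := by
  unfold pairCode
  constructor
  · intro h
    have h1 : Nat.pair i (Nat.pair (min a b) (max a b)) =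
      Nat.pair j (Nat.pair (min c d) (max c d)) := by omega
    rw [Nat.pair_eq_pair, Nat.pair_eq_pair] at h1
    obtain ⟨h1, h2, h3⟩ := h1
    refine ⟨h1, ?_⟩
    omega
  · rintro ⟨rfl, ⟨rfl, rfl⟩ | ⟨rfl, rfl⟩⟩
    · rfl
    · rw [min_comm, max_comm]

/-- The size of the block of new coordinates for the finite set `w`. -/
def blockSize (ι : ℕ) (w : Finset ℕ) : ℕ :=
  1 + ∑ a ∈ w, (pointCode a + ∑ b ∈ w, ∑ i ∈ Finset.range ι, pairCode i a b)

theorem pointCode_lt {ι : ℕ} {w : Finset ℕ} {a : ℕ} (ha : a ∈ w) :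
    pointCode a < blockSize ι w := by
  have := Finset.single_le_sum
    (f := fun a => pointCode a + ∑ b ∈ w, ∑ i ∈ Finset.range ι, pairCode i a b)
    (fun _ _ => Nat.zero_le _) ha
  simp only [blockSize] at *
  omega

theorem pairCode_lt {ι : ℕ} {w : Finset ℕ} {i a b : ℕ} (hi : i < ι) (ha : a ∈ w) (hb : b ∈ w) :
    pairCode i a b < blockSize ι w := by
  have h1 := Finset.single_le_sum
    (f := fun a => pointCode a + ∑ b ∈ w, ∑ i ∈ Finset.range ι, pairCode i a b)
    (fun _ _ => Nat.zero_le _) ha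
  have h2 := Finset.single_le_sum
    (f := fun b => ∑ i ∈ Finset.range ι, pairCode i a b) (fun _ _ => Nat.zero_le _) hb
  have h3 := Finset.single_le_sum
    (f := fun i => pairCode i a b) (fun _ _ => Nat.zero_le _) (Finset.mem_range.2 hi)
  simp only [blockSize] at *
  omega

/-- The beginning of the last block at stage `K`. -/
def start (ι : ℕ) : ℕ → ℕ
  | 0 => 0
  | K + 1 => start ι K + blockSize ι (𝒯.w K)

/-- The length reached at stage `K`. -/
def len (ι K : ℕ) : ℕ := 𝒯.start ι (K + 1)

theorem len_eq (ι K : ℕ) : 𝒯.len ι K = 𝒯.start ι K + blockSize ι (𝒯.w K) := rfl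

theorem start_succ (ι K : ℕ) : 𝒯.start ι (K + 1) = 𝒯.len ι K := rfl

theorem start_lt_len (ι K : ℕ) : 𝒯.start ι K < 𝒯.len ι K := by
  rw [len_eq]; unfold blockSize; omega

theorem len_strictMono (ι : ℕ) : StrictMono (𝒯.len ι) :=
  strictMono_nat_of_lt_succ fun K => by
    have := 𝒯.start_lt_len ι (K + 1)
    rwa [start_succ] at this

theorem len_pos (ι K : ℕ) : 0 < 𝒯.len ι K := (Nat.zero_le _).trans_lt (𝒯.start_lt_len ι K)

theorem le_len (ι K : ℕ) : K ≤ 𝒯.len ι K := (𝒯.len_strictMono ι).le_apply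

variable (ι : ℕ)

/-- The point attached to `a` at stage `K`, as an infinite sequence which vanishes from
`len K` on: on the last block it is the unit vector of `a`, and below it is the point attached to
`fold a` at the previous stage. -/
def pt : ℕ → ℕ → ℕ → ZMod 2
  | 0 => fun a p => if p = pointCode a then 1 else 0
  | K + 1 => fun a p =>
    if p < 𝒯.len ι K then pt K (𝒯.fold K a) p
    else if p = 𝒯.len ι K + pointCode a then 1 else 0

open Classical in
/-- The symmetric part of the branches attached to the pair `{a, b}` at stage `K`: on the last
block it is the unit vector of `i` and `{a, b}`. -/
noncomputable def sym : ℕ → ℕ → ℕ → ℕ → ℕ → ZMod 2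
  | 0 => fun i a b p => if p = pairCode i a b then 1 else 0
  | K + 1 => fun i a b p =>
    if p < 𝒯.len ι K then
      if 𝒯.Old K a b then sym K i (𝒯.fold K a) (𝒯.fold K b) p else 0
    else if p = 𝒯.len ι K + pairCode i a b then 1 else 0

/-- The branch attached to `i` and the ordered pair `(a, b)` at stage `K`. -/
noncomputable def br (K i a b : ℕ) : ℕ → ZMod 2 :=
  𝒯.sym ι K i a b + if a < b then 0 else 𝒯.pt ι K a + 𝒯.pt ι K b

open Classical in
theorem sym_comm (K i a b : ℕ) : 𝒯.sym ι K i a b = 𝒯.sym ι K i b a := by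
  induction K generalizing a b with
  | zero => ext p; simp only [sym, pairCode_comm i a b]
  | succ K ih =>
    ext p
    simp only [sym]
    rw [pairCode_comm i a b, ih (𝒯.fold K a)]
    exact if_congr Iff.rfl (if_congr 𝒯.old_comm rfl rfl) rfl

theorem pt_succ_of_lt {K a p : ℕ} (hp : p < 𝒯.len ι K) :
    𝒯.pt ι (K + 1) a p = 𝒯.pt ι K (𝒯.fold K a) p := by simp [pt, hp]

theorem sym_succ_of_lt {K i a b p : ℕ} (hp : p < 𝒯.len ι K) (h : 𝒯.Old K a b) :
    𝒯.sym ι (K + 1) i a b p = 𝒯.sym ι K i (𝒯.fold K a) (𝒯.fold K b) p := by simp [sym, hp, h]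

theorem br_succ_of_lt {K i a b p : ℕ} (hp : p < 𝒯.len ι K) (h : 𝒯.Old K a b) :
    𝒯.br ι (K + 1) i a b p = 𝒯.br ι K i (𝒯.fold K a) (𝒯.fold K b) p := by
  simp only [br, Pi.add_apply, 𝒯.sym_succ_of_lt ι hp h, 𝒯.fold_lt_fold_iff h]
  split_ifs
  · rfl
  · simp [𝒯.pt_succ_of_lt ι hp]

/-- On the last block, the points are the unit vectors of the codes of points. -/
theorem pt_start_add (K a c : ℕ) :
    𝒯.pt ι K a (𝒯.start ι K + c) = if c = pointCode a then 1 else 0 := by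
  cases K with
  | zero => simp [pt, start]
  | succ K => simp [pt, start_succ]

theorem sym_start_add (K i a b c : ℕ) :
    𝒯.sym ι K i a b (𝒯.start ι K + c) = if c = pairCode i a b then 1 else 0 := by
  cases K with
  | zero => simp [sym, start]
  | succ K => simp [sym, start_succ]

theorem pt_stable {K N a p : ℕ} (h : K ≤ N) (ha : a ∈ 𝒯.w K) (hp : p < 𝒯.len ι K) :
    𝒯.pt ι N a p = 𝒯.pt ι K a p := by
  induction N, h using Nat.le_induction with
  | base => rfl
  | succ N h ih =>
    rw [𝒯.pt_succ_of_lt ι (hp.trans_le ((𝒯.len_strictMono ι).monotone h)),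
      𝒯.fold_id N a (𝒯.mono h ha), ih]

theorem br_stable {K N i a b p : ℕ} (h : K ≤ N) (ha : a ∈ 𝒯.w K) (hb : b ∈ 𝒯.w K)
    (hp : p < 𝒯.len ι K) : 𝒯.br ι N i a b p = 𝒯.br ι K i a b p := by
  induction N, h using Nat.le_induction with
  | base => rfl
  | succ N h ih =>
    rw [𝒯.br_succ_of_lt ι (hp.trans_le ((𝒯.len_strictMono ι).monotone h))
      (𝒯.old_of_mem (𝒯.mono h ha) (𝒯.mono h hb)),
      𝒯.fold_id N a (𝒯.mono h ha), 𝒯.fold_id N b (𝒯.mono h hb), ih]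

theorem add_br (K i : ℕ) {a b : ℕ} (hab : a ≠ b) :
    𝒯.pt ι K a + 𝒯.br ι K i a b = 𝒯.pt ι K b + 𝒯.br ι K i b a := by
  have key : ∀ x y z : ZMod 2, x + z = y + (z + (y + x)) := by decide
  have key' : ∀ x y z : ZMod 2, x + (z + (x + y)) = y + z := by decide
  ext p
  rcases lt_or_gt_of_ne hab with h | h
  · simp [br, h, h.not_gt, 𝒯.sym_comm ι K i b a]
    exact key _ _ _
  · simp [br, h, h.not_gt, 𝒯.sym_comm ι K i b a]
    exact key' _ _ _

/-! ### Pulling back to an earlier stage -/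

/-- The composition of the retractions leading from stage `K + d` back to stage `K`. -/
def pull (K : ℕ) : ℕ → ℕ → ℕ
  | 0 => id
  | d + 1 => fun a => pull K d (𝒯.fold (K + d) a)

theorem pull_mem (K d : ℕ) {a : ℕ} (ha : a ∈ 𝒯.w (K + d)) : 𝒯.pull K d a ∈ 𝒯.w K := by
  induction d generalizing a with
  | zero => exact ha
  | succ d ih => exact ih (𝒯.fold_mem _ a ha)

theorem pt_pull (K d a : ℕ) {p : ℕ} (hp : p < 𝒯.len ι K) :
    𝒯.pt ι (K + d) a p = 𝒯.pt ι K (𝒯.pull K d a) p := by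
  induction d generalizing a with
  | zero => rfl
  | succ d ih =>
    rw [← add_assoc, 𝒯.pt_succ_of_lt ι
      (hp.trans_le ((𝒯.len_strictMono ι).monotone (Nat.le_add_right K d))), ih]
    rfl

theorem pull_pair (K d : ℕ) {a b : ℕ} (hb : 𝒯.birth (K + d) a b ≤ K) (hab : a ≠ b) :
    𝒯.pull K d a ≠ 𝒯.pull K d b ∧
    𝒯.birth K (𝒯.pull K d a) (𝒯.pull K d b) = 𝒯.birth (K + d) a b ∧
    ∀ i p, p < 𝒯.len ι K →
      𝒯.br ι K i (𝒯.pull K d a) (𝒯.pull K d b) p = 𝒯.br ι (K + d) i a b p := by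
  induction d generalizing a b with
  | zero => exact ⟨hab, rfl, fun i p _ => rfl⟩
  | succ d ih =>
    have hold : 𝒯.Old (K + d) a b := 𝒯.old_of_birth_le (hb.trans (Nat.le_add_right K d))
    have e := 𝒯.birth_succ_of_old hold
    obtain ⟨h1, h2, h3⟩ := ih (e.symm.trans_le hb) (𝒯.fold_ne_fold hold hab)
    refine ⟨h1, h2.trans e.symm, fun i p hp => (h3 i p hp).trans ?_⟩
    exact (𝒯.br_succ_of_lt ι
      (hp.trans_le ((𝒯.len_strictMono ι).monotone (Nat.le_add_right K d))) hold).symm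

/-- On a set all of whose pairs were born by stage `K`, pulling back to stage `K` is a
quasi-embedding. -/
theorem pull_quasiEmbedding (hS : S.X = Set.univ) (K d : ℕ) {X : Finset ℕ} (h2 : X.Nontrivial)
    (hX : ∀ a ∈ X, ∀ b ∈ X, a ≠ b → 𝒯.birth (K + d) a b ≤ K) :
    IsQuasiEmbedding S S X (𝒯.pull K d) := by
  induction d generalizing X with
  | zero => exact isQuasiEmbedding_id (by simp [hS])
  | succ d ih =>
    have hold : ∀ a ∈ X, ∀ b ∈ X, a ≠ b → 𝒯.Old (K + d) a b := fun a ha b hb hab =>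
      𝒯.old_of_birth_le ((hX a ha b hb hab).trans (Nat.le_add_right K d))
    have hf := 𝒯.fold_chart hS (𝒯.exists_chart h2 hold)
    have h2' : (X.image (𝒯.fold (K + d))).Nontrivial := by
      obtain ⟨a, ha, b, hb, hab⟩ := h2
      exact ⟨_, Finset.mem_image_of_mem _ ha, _, Finset.mem_image_of_mem _ hb,
        𝒯.fold_ne_fold (hold a ha b hb hab) hab⟩
    refine IsQuasiEmbedding.comp (ih h2' ?_) hf ?_
    · intro a ha b hb hab
      obtain ⟨a, ha', rfl⟩ := Finset.mem_image.1 ha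
      obtain ⟨b, hb', rfl⟩ := Finset.mem_image.1 hb
      have hab' : a ≠ b := fun h => hab (by rw [h])
      exact (𝒯.birth_succ_of_old (hold a ha' b hb' hab')).symm.trans_le (hX a ha' b hb' hab')
    · intro a ha
      exact Finset.mem_coe.2 (Finset.mem_image_of_mem _ ha)

/-- A point is not doubled over `Z` if its position over `Z` is the distinguished one and the rank
vanishes: the doubling would have occurred at a stage whose two copies meet in a set containing the
image of `Z`, which is what `guarded` excludes. -/
theorem not_doubled (hS : S.X = Set.univ) (K d : ℕ) {Z : Finset ℕ} {x y : ℕ} (hZ : Z.Nonempty)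
    (hx : x ∉ Z) (hy : y ∉ Z) (hxy : x ≠ y)
    (hX : ∀ a ∈ insert x Z, ∀ b ∈ insert x Z, a ≠ b → 𝒯.birth (K + d) a b ≤ K)
    (hY : ∀ a ∈ insert y Z, ∀ b ∈ insert y Z, a ≠ b → 𝒯.birth (K + d) a b ≤ K)
    (hpull : 𝒯.pull K d x = 𝒯.pull K d y) (hr : S.r (insert x Z) = 0) :
    S.k (insert x Z) ≠ countBelow Z x := by
  induction d generalizing x y Z with
  | zero => exact absurd hpull hxy
  | succ d ih =>
    have hle : K ≤ K + d := Nat.le_add_right K d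
    have hoX : ∀ a ∈ insert x Z, ∀ b ∈ insert x Z, a ≠ b → 𝒯.Old (K + d) a b :=
      fun a ha b hb hab => 𝒯.old_of_birth_le ((hX a ha b hb hab).trans hle)
    have hoY : ∀ a ∈ insert y Z, ∀ b ∈ insert y Z, a ≠ b → 𝒯.Old (K + d) a b :=
      fun a ha b hb hab => 𝒯.old_of_birth_le ((hY a ha b hb hab).trans hle)
    obtain ⟨z, hz⟩ := hZ
    have h2X : (insert x Z).Nontrivial :=
      ⟨x, by simp, z, by simp [hz], fun h => hx (h ▸ hz)⟩
    have h2Y : (insert y Z).Nontrivial :=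
      ⟨y, by simp, z, by simp [hz], fun h => hy (h ▸ hz)⟩
    have cX := 𝒯.exists_chart h2X hoX
    have cY := 𝒯.exists_chart h2Y hoY
    have hZX : Z ⊆ insert x Z := Finset.subset_insert x Z
    have hZY : Z ⊆ insert y Z := Finset.subset_insert y Z
    by_cases hold : 𝒯.Old (K + d) x y
    · -- no doubling at this stage
      have hf := 𝒯.fold_chart hS cX
      have hne : 𝒯.fold (K + d) x ≠ 𝒯.fold (K + d) y := 𝒯.fold_ne_fold hold hxy
      have hxZ : ∀ a ∈ Z, a ≠ x := fun a ha h => hx (h ▸ ha)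
      have hyZ : ∀ a ∈ Z, a ≠ y := fun a ha h => hy (h ▸ ha)
      have birthX : ∀ {W : Finset ℕ},
          (∀ a ∈ W, ∀ b ∈ W, a ≠ b → 𝒯.birth (K + (d + 1)) a b ≤ K) →
          (∀ a ∈ W, ∀ b ∈ W, a ≠ b → 𝒯.Old (K + d) a b) →
          ∀ a ∈ W.image (𝒯.fold (K + d)), ∀ b ∈ W.image (𝒯.fold (K + d)), a ≠ b →
            𝒯.birth (K + d) a b ≤ K := by
        intro W h1 h2 a ha b hb hab
        obtain ⟨a, ha', rfl⟩ := Finset.mem_image.1 ha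
        obtain ⟨b, hb', rfl⟩ := Finset.mem_image.1 hb
        have hab' : a ≠ b := fun h => hab (by rw [h])
        exact (𝒯.birth_succ_of_old (h2 a ha' b hb' hab')).symm.trans_le (h1 a ha' b hb' hab')
      have key := ih (Z := Z.image (𝒯.fold (K + d))) (x := 𝒯.fold (K + d) x)
        (y := 𝒯.fold (K + d) y) ⟨_, Finset.mem_image_of_mem _ hz⟩
        (by
          intro h
          obtain ⟨a, ha, h⟩ := Finset.mem_image.1 h
          exact 𝒯.fold_ne_fold (hoX a (hZX ha) x (by simp) (hxZ a ha)) (hxZ a ha) h)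
        (by
          intro h
          obtain ⟨a, ha, h⟩ := Finset.mem_image.1 h
          exact 𝒯.fold_ne_fold (hoY a (hZY ha) y (by simp) (hyZ a ha)) (hyZ a ha) h)
        hne
        (by rw [← Finset.image_insert]; exact birthX hX hoX)
        (by rw [← Finset.image_insert]; exact birthX hY hoY)
        hpull
      rw [← Finset.image_insert, hf.r_eq _ ⟨x, by simp⟩ (le_refl _),
        hf.k_eq _ ⟨x, by simp⟩ (le_refl _),
        countBelow_image hf.strictMono (by exact_mod_cast hZX) (by simp)] at key
      exact key hr
    · -- the two points lie in different copies
      have hcommon : ∀ A : Finset ℕ, A = 𝒯.w (K + d) ∨ A = 𝒯.left (K + d) ∨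
          A = 𝒯.right (K + d) → x ∈ A → y ∈ A → False := by
        rintro A (rfl | rfl | rfl) h1 h2
        · exact hold (Or.inl ⟨h1, h2⟩)
        · exact hold (Or.inr (Or.inl ⟨h1, h2⟩))
        · exact hold (Or.inr (Or.inr ⟨h1, h2⟩))
      have hzw : ∀ {A : Finset ℕ}, A = 𝒯.left (K + d) ∨ A = 𝒯.right (K + d) → z ∈ 𝒯.w (K + d) →
          z ∈ A → False := by
        rintro A (rfl | rfl) h1 h2
        · exact (𝒯.disjoint_charts h1).1 h2
        · exact (𝒯.disjoint_charts h1).2 h2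
      have xX : x ∈ insert x Z := by simp
      have yY : y ∈ insert y Z := by simp
      rcases cX with cX | cX | cX <;> rcases cY with cY | cY | cY
      · exact (hcommon _ (Or.inl rfl) (cX xX) (cY yY)).elim
      · exact (hzw (Or.inl rfl) (cX (hZX hz)) (cY (hZY hz))).elim
      · exact (hzw (Or.inr rfl) (cX (hZX hz)) (cY (hZY hz))).elim
      · exact (hzw (Or.inl rfl) (cY (hZY hz)) (cX (hZX hz))).elim
      · exact (hcommon _ (Or.inr (Or.inl rfl)) (cX xX) (cY yY)).elim
      · refine 𝒯.guarded (K + d) Z (Finset.subset_inter (hZX.trans cX) (hZY.trans cY)) x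
          (Finset.mem_union_left _ (cX xX)) (fun h => ?_) hr
        exact hcommon _ (Or.inr (Or.inr rfl)) (Finset.mem_inter.1 h).2 (cY yY)
      · exact (hzw (Or.inr rfl) (cY (hZY hz)) (cX (hZX hz))).elim
      · refine 𝒯.guarded (K + d) Z (Finset.subset_inter (hZY.trans cY) (hZX.trans cX)) x
          (Finset.mem_union_right _ (cX xX)) (fun h => ?_) hr
        exact hcommon _ (Or.inr (Or.inl rfl)) (Finset.mem_inter.1 h).1 (cY yY)
      · exact (hcommon _ (Or.inr (Or.inr rfl)) (cX xX) (cY yY)).elim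

/-! ### Independence on the last block -/

theorem br_start_add_pairCode (K i j a b c d : ℕ) :
    𝒯.br ι K i a b (𝒯.start ι K + pairCode j c d) =
      if pairCode i a b = pairCode j c d then 1 else 0 := by
  have h1 : ∀ e, 𝒯.pt ι K e (𝒯.start ι K + pairCode j c d) = 0 := fun e => by
    rw [pt_start_add, if_neg (pointCode_ne_pairCode _ _ _ _).symm]
  simp only [br, Pi.add_apply, sym_start_add]
  rw [show (if a < b then (0 : ℕ → ZMod 2) else 𝒯.pt ι K a + 𝒯.pt ι K b)
    (𝒯.start ι K + pairCode j c d) = 0 by split_ifs <;> simp [h1], add_zero]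
  exact if_congr eq_comm rfl rfl

theorem pt_start_add_pointCode (K a c : ℕ) :
    𝒯.pt ι K a (𝒯.start ι K + pointCode c) = if c = a then 1 else 0 := by
  rw [pt_start_add]; exact if_congr pointCode_inj rfl rfl

theorem pt_start_add_pairCode (K a i b c : ℕ) :
    𝒯.pt ι K a (𝒯.start ι K + pairCode i b c) = 0 := by
  rw [pt_start_add, if_neg (pointCode_ne_pairCode _ _ _ _).symm]

theorem start_add_pointCode_lt {K c : ℕ} (hc : c ∈ 𝒯.w K) :
    𝒯.start ι K + pointCode c < 𝒯.len ι K := by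
  rw [len_eq]; exact Nat.add_lt_add_left (pointCode_lt hc) _

theorem start_add_pairCode_lt {K i a b : ℕ} (hi : i < ι) (ha : a ∈ 𝒯.w K) (hb : b ∈ 𝒯.w K) :
    𝒯.start ι K + pairCode i a b < 𝒯.len ι K := by
  rw [len_eq]; exact Nat.add_lt_add_left (pairCode_lt hi ha hb) _

/-- The point attached to `a` at stage `K` as a finite sequence. -/
def node (K a : ℕ) : Node (𝒯.len ι K) := cantorRes (𝒯.pt ι K a) (𝒯.len ι K)

/-- The branch attached to `i` and `(a, b)` at stage `K` as a finite sequence. -/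
noncomputable def brNode (K i a b : ℕ) : Node (𝒯.len ι K) :=
  cantorRes (𝒯.br ι K i a b) (𝒯.len ι K)

/-- The coordinate of the point `c` in the last block at stage `K`. -/
def pointPos {K c : ℕ} (hc : c ∈ 𝒯.w K) : Fin (𝒯.len ι K) :=
  ⟨𝒯.start ι K + pointCode c, 𝒯.start_add_pointCode_lt ι hc⟩

/-- The coordinate of `i` and the pair `{a, b}` in the last block at stage `K`. -/
def pairPos {K i a b : ℕ} (hi : i < ι) (ha : a ∈ 𝒯.w K) (hb : b ∈ 𝒯.w K) :
    Fin (𝒯.len ι K) :=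
  ⟨𝒯.start ι K + pairCode i a b, 𝒯.start_add_pairCode_lt ι hi ha hb⟩

theorem node_pointPos {K c : ℕ} (hc : c ∈ 𝒯.w K) (a : ℕ) :
    𝒯.node ι K a (𝒯.pointPos ι hc) = if c = a then 1 else 0 :=
  𝒯.pt_start_add_pointCode ι K a c

theorem node_pairPos {K i b c : ℕ} (hi : i < ι) (hb : b ∈ 𝒯.w K) (hc : c ∈ 𝒯.w K) (a : ℕ) :
    𝒯.node ι K a (𝒯.pairPos ι hi hb hc) = 0 :=
  𝒯.pt_start_add_pairCode ι K a i b c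

theorem brNode_pairPos {K j c d : ℕ} (hj : j < ι) (hc : c ∈ 𝒯.w K) (hd : d ∈ 𝒯.w K)
    (i a b : ℕ) : 𝒯.brNode ι K i a b (𝒯.pairPos ι hj hc hd) =
      if pairCode i a b = pairCode j c d then 1 else 0 :=
  𝒯.br_start_add_pairCode ι K i j a b c d

theorem node_add_brNode (K i : ℕ) {a b : ℕ} (hab : a ≠ b) :
    𝒯.node ι K a + 𝒯.brNode ι K i a b = 𝒯.node ι K b + 𝒯.brNode ι K i b a := by
  ext p
  exact congrFun (𝒯.add_br ι K i hab) p

theorem node_injOn (K : ℕ) : InjOn (𝒯.node ι K) (𝒯.w K) := by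
  intro a ha b _ h
  have := congrFun h (𝒯.pointPos ι ha)
  rw [node_pointPos, node_pointPos] at this
  by_contra hne
  simp [hne] at this

/-- Two maps of a set of at least three elements into `w K` which differ, in terms of the attached
points, by a constant are equal: a nonzero vector is the sum of at most one pair of the attached
points. -/
theorem eq_of_node_add {α : Type*} {K : ℕ} {u : Finset α} (hu : 3 ≤ u.card) {f g : α → ℕ}
    (hf : ∀ x ∈ u, f x ∈ 𝒯.w K) (hg : ∀ x ∈ u, g x ∈ 𝒯.w K) (hinj : InjOn f u)
    {ρ ρ' : Node (𝒯.len ι K)}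
    (h : ∀ x ∈ u, 𝒯.node ι K (f x) + ρ = 𝒯.node ι K (g x) + ρ') : ∀ x ∈ u, f x = g x := by
  intro x hx
  by_contra hne
  classical
  have h1 : 1 < (u.erase x).card := by rw [Finset.card_erase_of_mem hx]; omega
  obtain ⟨y, hy, z, hz, hyz⟩ := Finset.one_lt_card.1 h1
  have key : ∀ y ∈ u.erase x, g y = f x ∧ f y = g x := by
    intro y hy
    obtain ⟨hyx, hyu⟩ := Finset.mem_erase.1 hy
    have e : ∀ p, 𝒯.node ι K (f x) p + 𝒯.node ι K (g x) p =
        𝒯.node ι K (f y) p + 𝒯.node ι K (g y) p := by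
      intro p
      have e1 := congrFun (h x hx) p
      have e2 := congrFun (h y hyu) p
      have aux : ∀ a b c d r s : ZMod 2, a + r = b + s → c + r = d + s → a + b = c + d := by decide
      exact aux _ _ _ _ _ _ e1 e2
    have e1 := e (𝒯.pointPos ι (hf x hx))
    have e2 := e (𝒯.pointPos ι (hg x hx))
    simp only [node_pointPos] at e1 e2
    have n1 : f x ≠ f y := fun h => hyx (hinj hx hyu h).symm
    rw [if_pos trivial, if_neg hne, if_neg n1] at e1
    have e3 : f x = g y := by
      by_contra hc
      simp [hc] at e1
    refine ⟨e3.symm, ?_⟩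
    rw [if_neg (Ne.symm hne), if_pos trivial, ← e3, if_neg (Ne.symm hne)] at e2
    by_contra hc
    simp [Ne.symm hc] at e2
  have hy' := Finset.mem_of_mem_erase hy
  have hz' := Finset.mem_of_mem_erase hz
  exact hyz (hinj hy' hz' ((key y hy).2.trans (key z hz).2.symm))

theorem node_linearIndependent (K : ℕ) :
    LinearIndependent (ZMod 2) (fun a : 𝒯.w K => 𝒯.node ι K a) := by
  rw [Fintype.linearIndependent_iff]
  intro g hg a
  have := congrFun hg (𝒯.pointPos ι a.2)
  simpa [Finset.sum_apply, node_pointPos, Subtype.coe_inj] using this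

theorem brNode_ne {K i j a b : ℕ} (hi : i < ι) (ha : a ∈ 𝒯.w K) (hb : b ∈ 𝒯.w K) (hij : i ≠ j)
    {c d : ℕ} : 𝒯.brNode ι K i a b ≠ 𝒯.brNode ι K j c d := by
  intro h
  have := congrFun h (𝒯.pairPos ι hi ha hb)
  rw [brNode_pairPos, brNode_pairPos, if_pos rfl, if_neg] at this
  · exact one_ne_zero this
  · rw [pairCode_inj]; exact fun h => hij h.1.symm

theorem brNode_swap_ne {K i a b : ℕ} (ha : a ∈ 𝒯.w K) (hb : b ∈ 𝒯.w K) (hab : a ≠ b) :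
    𝒯.brNode ι K i a b ≠ 𝒯.brNode ι K i b a := by
  intro h
  have e := 𝒯.node_add_brNode ι K i hab
  rw [h] at e
  exact hab (𝒯.node_injOn ι K ha hb (add_right_cancel e))

theorem res_node_pull (K d a : ℕ) (h : 𝒯.len ι K ≤ 𝒯.len ι (K + d)) :
    (𝒯.node ι (K + d) a).res h = 𝒯.node ι K (𝒯.pull K d a) := by
  ext p
  exact 𝒯.pt_pull ι K d a p.2

/-! ### The trees -/

/-- The tree of the initial segments of all branches attached to pairs born at stage `m`. -/
def tree (m : ℕ) : BinTree where
  level n := {x | ∃ K i a b, i < ι ∧ a ∈ 𝒯.w K ∧ b ∈ 𝒯.w K ∧ a ≠ b ∧ 𝒯.birth K a b = m ∧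
    n ≤ 𝒯.len ι K ∧ x = cantorRes (𝒯.br ι K i a b) n}
  closed := by
    rintro m n h _ ⟨K, i, a, b, hi, ha, hb, hab, hm, hn, rfl⟩
    exact ⟨K, i, a, b, hi, ha, hb, hab, hm, h.trans hn, rfl⟩

theorem brNode_mem_tree {K i a b : ℕ} (hi : i < ι) (ha : a ∈ 𝒯.w K) (hb : b ∈ 𝒯.w K)
    (hab : a ≠ b) : 𝒯.brNode ι K i a b ∈ (𝒯.tree ι (𝒯.birth K a b)).level (𝒯.len ι K) :=
  ⟨K, i, a, b, hi, ha, hb, hab, rfl, le_rfl, rfl⟩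

theorem tree_noMaximal (m : ℕ) : (𝒯.tree ι m).NoMaximal := by
  rintro n _ ⟨K, i, a, b, hi, ha, hb, hab, hm, hn, rfl⟩
  have hlt : n < 𝒯.len ι (K + 1) := hn.trans_lt (𝒯.len_strictMono ι (Nat.lt_succ_self K))
  have ha' := 𝒯.sub_succ K ha
  have hb' := 𝒯.sub_succ K hb
  refine ⟨_, hlt, 𝒯.brNode ι (K + 1) i a b,
    ⟨K + 1, i, a, b, hi, ha', hb', hab, ?_, le_rfl, rfl⟩, ?_⟩
  · rw [← hm]; exact 𝒯.birth_stable (Nat.le_succ K) ha hb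
  · ext p
    exact 𝒯.br_stable ι (Nat.le_succ K) ha hb (p.2.trans_le hn)

/-- At the lengths `len K` with `m ≤ K`, the `m`-th tree has no nodes beyond those visible at stage
`K`. -/
theorem exists_of_mem_tree {K m : ℕ} (hm : m ≤ K) {x : Node (𝒯.len ι K)}
    (hx : x ∈ (𝒯.tree ι m).level (𝒯.len ι K)) :
    ∃ i a b, i < ι ∧ a ∈ 𝒯.w K ∧ b ∈ 𝒯.w K ∧ a ≠ b ∧ 𝒯.birth K a b = m ∧
      x = 𝒯.brNode ι K i a b := by
  obtain ⟨N, i, a, b, hi, ha, hb, hab, hbm, hn, rfl⟩ := hx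
  obtain ⟨d, rfl⟩ := Nat.exists_eq_add_of_le ((𝒯.len_strictMono ι).le_iff_le.1 hn)
  obtain ⟨h1, h2, h3⟩ := 𝒯.pull_pair ι K d (hbm.trans_le hm) hab
  refine ⟨i, _, _, hi, 𝒯.pull_mem K d ha, 𝒯.pull_mem K d hb, h1, h2.trans hbm, ?_⟩
  ext p
  exact (h3 i p p.2).symm

/-- The point of the Cantor space attached to `a`. -/
def limPt (a : ℕ) : ℕ → ZMod 2 := fun p => 𝒯.pt ι (a + p + 1) a p

/-- The infinite branch attached to `i` and `(a, b)`. -/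
noncomputable def limBr (i a b : ℕ) : ℕ → ZMod 2 := fun p => 𝒯.br ι (a + b + p + 1) i a b p

theorem lt_len_of_lt {p K : ℕ} (h : p < K) : p < 𝒯.len ι K := h.trans_le (𝒯.le_len ι K)

theorem limPt_eq {K a p : ℕ} (ha : a ∈ 𝒯.w K) (hp : p < 𝒯.len ι K) :
    𝒯.limPt ι a p = 𝒯.pt ι K a p := by
  rw [← 𝒯.pt_stable ι (le_max_left K (a + p + 1)) ha hp, limPt]
  exact (𝒯.pt_stable ι (le_max_right K (a + p + 1)) (𝒯.mem_w (by omega))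
    (𝒯.lt_len_of_lt ι (by omega))).symm

theorem limBr_eq {K i a b p : ℕ} (ha : a ∈ 𝒯.w K) (hb : b ∈ 𝒯.w K) (hp : p < 𝒯.len ι K) :
    𝒯.limBr ι i a b p = 𝒯.br ι K i a b p := by
  rw [← 𝒯.br_stable ι (le_max_left K (a + b + p + 1)) ha hb hp, limBr]
  exact (𝒯.br_stable ι (le_max_right K (a + b + p + 1)) (𝒯.mem_w (by omega))
    (𝒯.mem_w (by omega)) (𝒯.lt_len_of_lt ι (by omega))).symm

theorem limPt_add_limBr (i : ℕ) {a b : ℕ} (hab : a ≠ b) :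
    𝒯.limPt ι a + 𝒯.limBr ι i a b = 𝒯.limPt ι b + 𝒯.limBr ι i b a := by
  ext p
  have ha : a ∈ 𝒯.w (a + b + p + 1) := 𝒯.mem_w (by omega)
  have hb : b ∈ 𝒯.w (a + b + p + 1) := 𝒯.mem_w (by omega)
  have hp : p < 𝒯.len ι (a + b + p + 1) := 𝒯.lt_len_of_lt ι (by omega)
  simp only [Pi.add_apply, 𝒯.limPt_eq ι ha hp, 𝒯.limPt_eq ι hb hp, 𝒯.limBr_eq ι ha hb hp,
    𝒯.limBr_eq ι hb ha hp]
  exact congrFun (𝒯.add_br ι _ i hab) p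

theorem limBr_mem_lim {K i a b : ℕ} (hi : i < ι) (ha : a ∈ 𝒯.w K) (hb : b ∈ 𝒯.w K)
    (hab : a ≠ b) : 𝒯.limBr ι i a b ∈ (𝒯.tree ι (𝒯.birth K a b)).lim := by
  intro n
  have ha' := 𝒯.mono (le_max_left K n) ha
  have hb' := 𝒯.mono (le_max_left K n) hb
  have hn : n ≤ 𝒯.len ι (max K n) := (le_max_right K n).trans (𝒯.le_len ι _)
  refine ⟨max K n, i, a, b, hi, ha', hb', hab, 𝒯.birth_stable (le_max_left K n) ha hb, hn, ?_⟩
  ext p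
  exact 𝒯.limBr_eq ι ha' hb' (p.2.trans_le hn)

/-! ### The bricks -/

/-- The brick of stage `K`. -/
noncomputable def brick (K : ℕ) : BrickData ι where
  w := 𝒯.w K
  n := 𝒯.len ι K
  η := 𝒯.node ι K
  h := fun _ a b => 𝒯.birth K a b
  g := fun i a b => 𝒯.brNode ι K i a b

end Tower

theorem BrickData.trace_h {ι : ℕ} (b : BrickData ι) {l : ℕ} (hl : l ≤ b.n) {v : Finset ℕ}
    (hv : InjOn (fun a => (b.η a).res hl) v) {x y : ℕ} (hx : x ∈ v) (hy : y ∈ v) (i : Fin ι) :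
    (b.trace hl v).h i ((b.η x).res hl) ((b.η y).res hl) = b.h i x y := by
  have e := hv.leftInvOn_invFunOn
  simp only [BrickData.trace]
  rw [e hx, e hy]

theorem BrickData.trace_g {ι : ℕ} (b : BrickData ι) {l : ℕ} (hl : l ≤ b.n) {v : Finset ℕ}
    (hv : InjOn (fun a => (b.η a).res hl) v) {x y : ℕ} (hx : x ∈ v) (hy : y ∈ v) (i : Fin ι) :
    (b.trace hl v).g i ((b.η x).res hl) ((b.η y).res hl) = (b.g i x y).res hl := by
  have e := hv.leftInvOn_invFunOn
  simp only [BrickData.trace]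
  rw [e hx, e hy]

/-- A criterion for membership in `M_{T,ι}` for a configuration parametrized by a finite set of
natural numbers. -/
theorem isConfig_of_param {ι : ℕ} {T : ℕ → BinTree} {m : Config ι} {v : Finset ℕ}
    {f : ℕ → Node m.len} {H : Fin ι → ℕ → ℕ → ℕ} {G : Fin ι → ℕ → ℕ → Node m.len}
    {P : ℕ → ℕ → ZMod 2} {B : Fin ι → ℕ → ℕ → ℕ → ZMod 2}
    (hf : InjOn f v) (hu : m.u = v.image f)
    (hh : ∀ i, ∀ a ∈ v, ∀ b ∈ v, m.h i (f a) (f b) = H i a b)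
    (hg : ∀ i, ∀ a ∈ v, ∀ b ∈ v, m.g i (f a) (f b) = G i a b)
    (hlen : 0 < m.len) (hcard : 2 ≤ v.card)
    (hmem : ∀ i, ∀ a ∈ v, ∀ b ∈ v, a ≠ b → G i a b ∈ (T (H i a b)).level m.len)
    (hadd : ∀ i, ∀ a ∈ v, ∀ b ∈ v, a ≠ b → f a + G i a b = f b + G i b a)
    (hne : ∀ i j, ∀ a ∈ v, ∀ b ∈ v, ∀ c d, i ≠ j → G i a b ≠ G j c d)
    (hswap : ∀ i, ∀ a ∈ v, ∀ b ∈ v, a ≠ b → G i a b ≠ G i b a)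
    (hP : ∀ a ∈ v, cantorRes (P a) m.len = f a)
    (hB : ∀ i, ∀ a ∈ v, ∀ b ∈ v, cantorRes (B i a b) m.len = G i a b)
    (hBlim : ∀ i, ∀ a ∈ v, ∀ b ∈ v, a ≠ b → B i a b ∈ (T (H i a b)).lim)
    (hPB : ∀ i, ∀ a ∈ v, ∀ b ∈ v, a ≠ b → P a + B i a b = P b + B i b a) : IsConfig T m := by
  have hpair : ∀ p ∈ m.u.offDiag, ∃ a ∈ v, ∃ b ∈ v, a ≠ b ∧ p = (f a, f b) := by
    rintro ⟨x, y⟩ hp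
    obtain ⟨hx, hy, hne⟩ := Finset.mem_offDiag.1 hp
    rw [hu] at hx hy
    obtain ⟨a, ha, rfl⟩ := Finset.mem_image.1 hx
    obtain ⟨b, hb, rfl⟩ := Finset.mem_image.1 hy
    exact ⟨a, ha, b, hb, fun h => hne (by rw [h]), rfl⟩
  refine ⟨hlen, ?_, ?_, ?_, ?_, ?_⟩
  · rwa [hu, Finset.card_image_of_injOn hf]
  · intro p hp i
    obtain ⟨a, ha, b, hb, hab, rfl⟩ := hpair p hp
    simp only [hh i a ha b hb, hg i a ha b hb]
    exact hmem i a ha b hb hab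
  · intro p hp i
    obtain ⟨a, ha, b, hb, hab, rfl⟩ := hpair p hp
    simp only [hg i a ha b hb, hg i b hb a ha]
    exact hadd i a ha b hb hab
  · intro p hp
    obtain ⟨a, ha, b, hb, hab, rfl⟩ := hpair p hp
    have e1 : ∀ i, m.g i (f a) (f b) = G i a b := fun i => hg i a ha b hb
    have e2 : ∀ i, m.g i (f b) (f a) = G i b a := fun i => hg i b hb a ha
    rintro (i | i) (j | j) hij <;> simp only [Sum.elim_inl, Sum.elim_inr, e1, e2] at hij
    · by_contra h
      exact hne i j a ha b hb a b (fun h' => h (by rw [h'])) hij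
    · exfalso
      by_cases h : i = j
      · subst h; exact hswap i a ha b hb hab hij
      · exact hne i j a ha b hb b a h hij
    · exfalso
      by_cases h : i = j
      · subst h; exact hswap i b hb a ha hab.symm hij
      · exact hne i j b hb a ha a b h hij
    · by_contra h
      exact hne i j b hb a ha b a (fun h' => h (by rw [h'])) hij
  · have e : ∀ a ∈ v, Function.invFunOn f v (f a) = a := fun a ha => hf.leftInvOn_invFunOn ha
    refine ⟨fun x => P (Function.invFunOn f v x),
      fun i x y => B i (Function.invFunOn f v x) (Function.invFunOn f v y), ?_, ?_⟩
    · intro x hx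
      rw [hu] at hx
      obtain ⟨a, ha, rfl⟩ := Finset.mem_image.1 hx
      simp only [e a ha]
      exact hP a ha
    · intro p hp i
      obtain ⟨a, ha, b, hb, hab, rfl⟩ := hpair p hp
      simp only [e a ha, e b hb, hh i a ha b hb, hg i a ha b hb]
      exact ⟨hB i a ha b hb, hBlim i a ha b hb hab, hPB i a ha b hb hab⟩

namespace Tower

variable {ε : Ordinal.{0}} {S : YZRSystem ε ℕ} (𝒯 : Tower S) (ι : ℕ)

theorem brick_injOn {K : ℕ} {v : Finset ℕ} (hv : v ⊆ 𝒯.w K) :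
    InjOn (fun a => ((𝒯.brick ι K).η a).res (le_refl (𝒯.brick ι K).n)) v :=
  (𝒯.node_injOn ι K).mono (by exact_mod_cast hv)

/-- The members of `w K` carry configurations, the infinite branches being the attached ones. -/
theorem trace_mem_configs {K : ℕ} {v : Finset ℕ} (hv : v ⊆ 𝒯.w K) (h2 : 2 ≤ v.card) :
    (𝒯.brick ι K).trace le_rfl v ∈ configs (𝒯.tree ι) ι := by
  have hinj := 𝒯.brick_injOn ι hv
  refine isConfig_of_param (m := (𝒯.brick ι K).trace le_rfl v) (v := v)
    (f := 𝒯.node ι K) (H := fun _ a b => 𝒯.birth K a b) (G := fun i a b => 𝒯.brNode ι K i a b)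
    (P := 𝒯.limPt ι) (B := fun i a b => 𝒯.limBr ι i a b)
    hinj rfl (fun i a ha b hb => (𝒯.brick ι K).trace_h le_rfl hinj ha hb i)
    (fun i a ha b hb => (𝒯.brick ι K).trace_g le_rfl hinj ha hb i)
    (𝒯.len_pos ι K) h2 ?_ ?_ ?_ ?_ ?_ ?_ ?_ ?_
  · exact fun i a ha b hb hab => 𝒯.brNode_mem_tree ι i.2 (hv ha) (hv hb) hab
  · exact fun i a ha b hb hab => 𝒯.node_add_brNode ι K i hab
  · exact fun i j a ha b hb c d hij =>
      𝒯.brNode_ne ι i.2 (hv ha) (hv hb) (fun h => hij (Fin.ext h))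
  · exact fun i a ha b hb hab => 𝒯.brNode_swap_ne ι (hv ha) (hv hb) hab
  · intro a ha
    ext p
    exact 𝒯.limPt_eq ι (hv ha) p.2
  · intro i a ha b hb
    ext p
    exact 𝒯.limBr_eq ι (hv ha) (hv hb) p.2
  · exact fun i a ha b hb hab => 𝒯.limBr_mem_lim ι i.2 (hv ha) (hv hb) hab
  · exact fun i a ha b hb hab => 𝒯.limPt_add_limBr ι i hab

/-- The last stage whose length does not exceed `l`. -/
theorem exists_stage {l : ℕ} (h : 𝒯.len ι 0 ≤ l) : ∃ K, ∀ M, 𝒯.len ι M ≤ l ↔ M ≤ K := by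
  refine ⟨Nat.findGreatest (fun M => 𝒯.len ι M ≤ l) l, fun M => ⟨fun hM => ?_, fun hM => ?_⟩⟩
  · exact Nat.le_findGreatest ((𝒯.le_len ι M).trans hM) hM
  · refine ((𝒯.len_strictMono ι).monotone hM).trans ?_
    exact Nat.findGreatest_spec (P := fun M => 𝒯.len ι M ≤ l) (Nat.zero_le l) h

/-- A map compatible with pulling back to stage `K`, between sets all of whose pairs were born by
that stage, is a quasi-embedding. -/
theorem quasiEmbedding_of_pull_eq (hS : S.X = Set.univ) {K d d' : ℕ} {v : Finset ℕ} {s : ℕ → ℕ}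
    (h2 : v.Nontrivial) (hv : ∀ a ∈ v, ∀ b ∈ v, a ≠ b → 𝒯.birth (K + d) a b ≤ K)
    (hs : ∀ a ∈ v, ∀ b ∈ v, a ≠ b → 𝒯.birth (K + d') (s a) (s b) ≤ K)
    (he : ∀ a ∈ v, 𝒯.pull K d' (s a) = 𝒯.pull K d a) : IsQuasiEmbedding S S v s := by
  have q1 := 𝒯.pull_quasiEmbedding hS K d h2 hv
  have hsne : ∀ a ∈ v, ∀ b ∈ v, a ≠ b → s a ≠ s b := by
    intro a ha b hb hab h
    refine hab (q1.strictMono.injOn ha hb ?_)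
    rw [← he a ha, ← he b hb, h]
  have q2 : IsQuasiEmbedding S S (v.image s) (𝒯.pull K d') := by
    refine 𝒯.pull_quasiEmbedding hS K d' ?_ ?_
    · obtain ⟨a, ha, b, hb, hab⟩ := h2
      exact ⟨_, Finset.mem_image_of_mem s ha, _, Finset.mem_image_of_mem s hb,
        hsne a ha b hb hab⟩
    · intro a ha b hb hab
      obtain ⟨a, ha', rfl⟩ := Finset.mem_image.1 ha
      obtain ⟨b, hb', rfl⟩ := Finset.mem_image.1 hb
      exact hs a ha' b hb' fun h => hab (by rw [h])
  have hl := q2.strictMono.injOn.leftInvOn_invFunOn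
  refine ((q2.inverse hl).comp q1 ?_).congr ?_
  · intro a ha
    exact ⟨s a, Finset.mem_coe.2 (Finset.mem_image_of_mem s ha), he a ha⟩
  · intro a ha
    simp only [Function.comp]
    rw [← he a ha]
    exact hl (Finset.mem_coe.2 (Finset.mem_image_of_mem s ha))

theorem pull_eq_pull {K d d' a b : ℕ} (ha : a ∈ 𝒯.w (K + d)) (hb : b ∈ 𝒯.w (K + d'))
    (h : ∀ p < 𝒯.len ι K, 𝒯.pt ι (K + d) a p = 𝒯.pt ι (K + d') b p) :
    𝒯.pull K d a = 𝒯.pull K d' b := by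
  refine 𝒯.node_injOn ι K (𝒯.pull_mem K d ha) (𝒯.pull_mem K d' hb) ?_
  ext p
  have := h p p.2
  rwa [𝒯.pt_pull ι K d a p.2, 𝒯.pt_pull ι K d' b p.2] at this

theorem nontrivial_of_three_le {v : Finset ℕ} (h : 3 ≤ v.card) : v.Nontrivial :=
  Finset.one_lt_card_iff_nontrivial.1 (by omega)

/-- Initial segments of length at least `len K` determine the pull-back to stage `K`. -/
theorem pull_eq_of_res_eq {K d d' l a b : ℕ} (ha : a ∈ 𝒯.w (K + d)) (hb : b ∈ 𝒯.w (K + d'))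
    (hK : 𝒯.len ι K ≤ l) (hl : l ≤ 𝒯.len ι (K + d)) (hl' : l ≤ 𝒯.len ι (K + d'))
    (h : (𝒯.node ι (K + d) a).res hl = (𝒯.node ι (K + d') b).res hl') :
    𝒯.pull K d a = 𝒯.pull K d' b :=
  𝒯.pull_eq_pull ι ha hb fun p hp => congrFun h ⟨p, hp.trans_le hK⟩

/-- A translation which carries the trace of `v₁` to that of `v₀` identifies their pull-backs to the
last stage not longer than `l`, since differences of nodes determine the nodes. -/
theorem brick_rigid (hS : S.X = Set.univ) (hι : 0 < ι) (N l : ℕ) (hl : l ≤ (𝒯.brick ι N).n)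
    (v₀ v₁ : Finset ℕ) (h₀ : (𝒯.brick ι N).Admissible (𝒯.tree ι) (𝒯.len ι) hl v₀)
    (h₁ : (𝒯.brick ι N).Admissible (𝒯.tree ι) (𝒯.len ι) hl v₁) (ρ : Node l)
    (hsame : ((𝒯.brick ι N).trace hl v₀).EssSame (((𝒯.brick ι N).trace hl v₁).translate ρ)) :
    ∃ π : ℕ → ℕ, StrictMonoOn π v₀ ∧ v₀.image π = v₁ ∧ IsQuasiEmbedding S S v₀ π ∧
      ∀ a ∈ v₀, ((𝒯.brick ι N).η a).res hl + ρ = ((𝒯.brick ι N).η (π a)).res hl := by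
  have hb : ∀ v, (𝒯.brick ι N).Admissible (𝒯.tree ι) (𝒯.len ι) hl v →
      ∀ a ∈ v, ∀ b ∈ v, a ≠ b → 𝒯.len ι (𝒯.birth N a b) ≤ l :=
    fun v hv a ha b hb hab => hv.c_le (a, b) (Finset.mem_offDiag.2 ⟨ha, hb, hab⟩) ⟨0, hι⟩
  have h2₀ := nontrivial_of_three_le h₀.three_le
  obtain ⟨a₀, ha₀, b₀, hb₀, hab₀⟩ := id h2₀
  obtain ⟨K, hK⟩ := 𝒯.exists_stage ι (((𝒯.len_strictMono ι).monotone (Nat.zero_le _)).trans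
    (hb v₀ h₀ a₀ ha₀ b₀ hb₀ hab₀))
  have hKl : 𝒯.len ι K ≤ l := (hK K).2 le_rfl
  obtain ⟨d, rfl⟩ := Nat.exists_eq_add_of_le ((𝒯.len_strictMono ι).le_iff_le.1 (hKl.trans hl))
  have hb₀ : ∀ a ∈ v₀, ∀ b ∈ v₀, a ≠ b → 𝒯.birth (K + d) a b ≤ K :=
    fun a ha b hb' hab => (hK _).1 (hb v₀ h₀ a ha b hb' hab)
  have hb₁ : ∀ a ∈ v₁, ∀ b ∈ v₁, a ≠ b → 𝒯.birth (K + d) a b ≤ K :=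
    fun a ha b hb' hab => (hK _).1 (hb v₁ h₁ a ha b hb' hab)
  obtain ⟨_, _, hu, -⟩ := hsame
  have hu' : v₀.image (fun a => (𝒯.node ι (K + d) a).res hl) =
      v₁.image (fun a => (𝒯.node ι (K + d) a).res hl + ρ) := by
    have e : (((𝒯.brick ι (K + d)).trace hl v₁).translate ρ).u.image
        (fun η => η.res (le_refl l)) =
        v₁.image (fun a => (𝒯.node ι (K + d) a).res hl + ρ) := by
      change (((v₁.image (fun a => (𝒯.node ι (K + d) a).res hl)).image
        (fun η => η + ρ)).image (fun η => η.res (le_refl l))) = _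
      simp only [Finset.image_image]
      rfl
    exact hu.trans e
  have hθ : ∀ a ∈ v₀, ∃ b ∈ v₁, (𝒯.node ι (K + d) b).res hl + ρ =
      (𝒯.node ι (K + d) a).res hl := by
    intro a ha
    have := Finset.mem_image_of_mem (fun a => (𝒯.node ι (K + d) a).res hl) ha
    rw [hu'] at this
    exact Finset.mem_image.1 this
  choose! θ hθv hθ using hθ
  have hpull : ∀ a ∈ v₀, 𝒯.pull K d a = 𝒯.pull K d (θ a) := by
    refine 𝒯.eq_of_node_add ι (K := K) h₀.three_le (ρ := 0)
      (ρ' := ρ.res hKl) (fun a ha => 𝒯.pull_mem K d (h₀.subset ha))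
      (fun a ha => 𝒯.pull_mem K d (h₁.subset (hθv a ha)))
      (𝒯.pull_quasiEmbedding hS K d h2₀ hb₀).strictMono.injOn ?_
    intro a ha
    have e := congrArg (Node.res hKl) (hθ a ha)
    rw [add_zero, ← 𝒯.res_node_pull ι K d a (hKl.trans hl),
      ← 𝒯.res_node_pull ι K d (θ a) (hKl.trans hl)]
    exact e.symm
  have hne : ∀ a ∈ v₀, ∀ b ∈ v₀, a ≠ b → θ a ≠ θ b := by
    intro a ha b hb' hab h
    have := hθ a ha
    rw [h, hθ b hb'] at this
    exact hab (h₀.inj ha hb' this.symm)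
  have hq : IsQuasiEmbedding S S v₀ θ := 𝒯.quasiEmbedding_of_pull_eq hS h2₀ hb₀
    (fun a ha b hb' hab => hb₁ _ (hθv a ha) _ (hθv b hb') (hne a ha b hb' hab))
    fun a ha => (hpull a ha).symm
  have hρ : ∀ x y : Node l, y + ρ = x → x + ρ = y := by
    rintro x y rfl
    ext p
    simp [add_assoc, CharTwo.add_self_eq_zero]
  refine ⟨θ, hq.strictMono, ?_, hq, fun a ha => hρ _ _ (hθ a ha)⟩
  ext b
  constructor
  · intro h
    obtain ⟨a, ha, rfl⟩ := Finset.mem_image.1 h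
    exact hθv a ha
  · intro h
    have := Finset.mem_image_of_mem (fun a => (𝒯.node ι (K + d) a).res hl + ρ) h
    rw [← hu'] at this
    obtain ⟨a, ha, e⟩ := Finset.mem_image.1 this
    have e2 : (𝒯.node ι (K + d) (θ a)).res hl = (𝒯.node ι (K + d) b).res hl :=
      add_right_cancel ((hθ a ha).trans e)
    exact Finset.mem_image.2 ⟨a, ha, h₁.inj (hθv a ha) h e2⟩

/-- If two elements `x ≠ y` lie over the same element `a` of `v`, and `s` chooses elements over
the other elements of `v`, then `s`, extended by `a ↦ x`, is a quasi-embedding, and `a` is not the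
distinguished element of `v` unless the rank of `v` is positive. -/
theorem doubled_over (hS : S.X = Set.univ) {K d d' : ℕ} {v : Finset ℕ} {s : ℕ → ℕ} {a y : ℕ}
    (h2 : v.Nontrivial) (ha : a ∈ v)
    (hv : ∀ a ∈ v, ∀ b ∈ v, a ≠ b → 𝒯.birth (K + d) a b ≤ K)
    (hs : ∀ a ∈ v, ∀ b ∈ v, a ≠ b → 𝒯.birth (K + d') (s a) (s b) ≤ K)
    (hy : ∀ b ∈ v, b ≠ a → 𝒯.birth (K + d') y (s b) ≤ K) (hne : s a ≠ y)
    (he : ∀ a ∈ v, 𝒯.pull K d' (s a) = 𝒯.pull K d a)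
    (hya : 𝒯.pull K d' y = 𝒯.pull K d a) (hr : S.r v = 0) : S.k v ≠ countBelow v a := by
  have hq := 𝒯.quasiEmbedding_of_pull_eq hS h2 hv hs he
  have hpv := 𝒯.pull_quasiEmbedding hS K d h2 hv
  have hZ : insert (s a) ((v.erase a).image s) = v.image s := by
    rw [← Finset.image_insert, Finset.insert_erase ha]
  have hcb : countBelow ((v.erase a).image s) (s a) = countBelow v a := by
    rw [countBelow_image hq.strictMono (by simp) ha]
    unfold countBelow
    congr 1
    ext b
    simp only [Finset.mem_filter, Finset.mem_erase]
    constructor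
    · rintro ⟨⟨-, h⟩, h'⟩; exact ⟨h, h'⟩
    · rintro ⟨h, h'⟩; exact ⟨⟨h'.ne, h⟩, h'⟩
  have hvne : v.Nonempty := ⟨a, ha⟩
  have hyZ : ∀ b ∈ v, b ≠ a → y ≠ s b := by
    rintro b hb hba rfl
    refine hba (hpv.strictMono.injOn hb ha ?_)
    rw [← he b hb, hya]
  obtain ⟨c, hc, hca⟩ := h2.exists_ne a
  have key := 𝒯.not_doubled hS K d' (Z := (v.erase a).image s) (x := s a) (y := y)
    ⟨s c, Finset.mem_image_of_mem s (Finset.mem_erase.2 ⟨hca, hc⟩)⟩ ?_ ?_ hne ?_ ?_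
    ((he a ha).trans hya.symm)
  · rw [hZ, hq.r_eq v hvne (le_refl _), hq.k_eq v hvne (le_refl _), hcb] at key
    exact key hr
  · intro h
    obtain ⟨b, hb, e⟩ := Finset.mem_image.1 h
    obtain ⟨hba, hb⟩ := Finset.mem_erase.1 hb
    exact hba (hq.strictMono.injOn hb ha e)
  · intro h
    obtain ⟨b, hb, e⟩ := Finset.mem_image.1 h
    obtain ⟨hba, hb⟩ := Finset.mem_erase.1 hb
    exact hyZ b hb hba e.symm
  · rw [hZ]
    intro x hx z hz hxz
    obtain ⟨x, hx', rfl⟩ := Finset.mem_image.1 hx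
    obtain ⟨z, hz', rfl⟩ := Finset.mem_image.1 hz
    exact hs x hx' z hz' fun h => hxz (by rw [h])
  · intro x hx z hz hxz
    rcases Finset.mem_insert.1 hx with hx | hx <;> rcases Finset.mem_insert.1 hz with hz | hz
    · exact absurd (hx.trans hz.symm) hxz
    · obtain ⟨z, hz', rfl⟩ := Finset.mem_image.1 hz
      rw [hx]
      exact hy z (Finset.mem_erase.1 hz').2 (Finset.mem_erase.1 hz').1
    · obtain ⟨x, hx', rfl⟩ := Finset.mem_image.1 hx
      rw [birth_comm, hz]
      exact hy x (Finset.mem_erase.1 hx').2 (Finset.mem_erase.1 hx').1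
    · obtain ⟨x, hx', rfl⟩ := Finset.mem_image.1 hx
      obtain ⟨z, hz', rfl⟩ := Finset.mem_image.1 hz
      exact hs x (Finset.mem_erase.1 hx').2 z (Finset.mem_erase.1 hz').2
        fun h => hxz (by rw [h])

/-- Essential extension preserves the stages of birth. -/
theorem len_birth_le_of_essExtends (hι : 0 < ι) {N l l' : ℕ} {hl : l ≤ (𝒯.brick ι N).n}
    {hl' : l' ≤ (𝒯.brick ι N).n} {v v' : Finset ℕ}
    (hv : (𝒯.brick ι N).Admissible (𝒯.tree ι) (𝒯.len ι) hl v)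
    (hv' : (𝒯.brick ι N).Admissible (𝒯.tree ι) (𝒯.len ι) hl' v')
    (hext : ((𝒯.brick ι N).trace hl v).EssExtends ((𝒯.brick ι N).trace hl' v'))
    {x y : ℕ} (hx : x ∈ v') (hy : y ∈ v') {a b : ℕ} (ha : a ∈ v) (hb : b ∈ v) (hab : a ≠ b)
    (hxa : (𝒯.node ι N x).res hl = (𝒯.node ι N a).res hl)
    (hyb : (𝒯.node ι N y).res hl = (𝒯.node ι N b).res hl) :
    𝒯.len ι (𝒯.birth N x y) ≤ l := by
  obtain ⟨hll, -, hext⟩ := hext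
  have hll : l ≤ l' := hll
  set B := 𝒯.brick ι N with hB
  have hxa' : ((B.η x).res hl').res hll = (B.η a).res hl := hxa
  have hyb' : ((B.η y).res hl').res hll = (B.η b).res hl := hyb
  have hne : (B.η a).res hl ≠ (B.η b).res hl := fun h => hab (hv.inj ha hb h)
  have hmem : ((B.η x).res hl', (B.η y).res hl') ∈ (B.trace hl' v').u.offDiag := by
    refine Finset.mem_offDiag.2 ⟨Finset.mem_image_of_mem _ hx, Finset.mem_image_of_mem _ hy, ?_⟩
    intro h
    have h' := congrArg (Node.res hll) h
    exact hne (hxa'.symm.trans (h'.trans hyb'))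
  obtain ⟨hrange, hh⟩ := hext _ hmem (by
    intro h
    exact hne (hxa'.symm.trans (h.trans hyb')))
  obtain ⟨i, hi⟩ := hrange.symm ▸ Set.mem_range_self (⟨0, hι⟩ : Fin ι)
  have h1 : ∀ j, (B.trace hl v).h j (((B.η x).res hl').res hll) (((B.η y).res hl').res hll) =
      𝒯.birth N a b := by
    intro j
    exact (congrArg₂ (fun X Y => (B.trace hl v).h j X Y) hxa' hyb').trans
      (B.trace_h hl hv.inj ha hb j)
  have h2 : ∀ j, (B.trace hl' v').h j ((B.η x).res hl') ((B.η y).res hl') = 𝒯.birth N x y :=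
    fun j => B.trace_h hl' hv'.inj hx hy j
  have h3 : ∀ j, (B.trace hl' v').h j ((B.η y).res hl') ((B.η x).res hl') = 𝒯.birth N y x :=
    fun j => B.trace_h hl' hv'.inj hy hx j
  have hc : 𝒯.len ι (𝒯.birth N a b) ≤ l :=
    hv.c_le (a, b) (Finset.mem_offDiag.2 ⟨ha, hb, hab⟩) ⟨0, hι⟩
  have e : 𝒯.birth N x y = 𝒯.birth N a b := by
    rcases Sym2.eq_iff.1 hi with h | h
    · exact ((h1 i).symm.trans (((hh i ⟨0, hι⟩).1 h.1).trans (h2 _))).symm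
    · rw [𝒯.birth_comm N x y]
      exact ((h1 i).symm.trans (((hh i ⟨0, hι⟩).2 h.1).trans (h3 _))).symm
  rwa [e]

/-- A configuration that extends the trace of `v` and contains two elements over the distinguished
point of `v` would double this point, although the rank of `v` vanishes. -/
theorem brick_no_split (hS : S.X = Set.univ) (hι : 0 < ι) (N l : ℕ) (hl : l ≤ (𝒯.brick ι N).n)
    (v : Finset ℕ) (hv : (𝒯.brick ι N).Admissible (𝒯.tree ι) (𝒯.len ι) hl v)
    (a : ℕ) (ha : a ∈ v) (hka : countBelow v a = S.k v) (hr : S.r v = 0) (n : Config ι)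
    (hn : n ∈ (𝒯.brick ι N).family (𝒯.tree ι) (𝒯.len ι))
    (hext : ((𝒯.brick ι N).trace hl v).EssExtends n) :
    {ν | ν ∈ n.u ∧ (((𝒯.brick ι N).η a).res hl).IsInitSeg ν}.ncard = 1 := by
  obtain ⟨l', hl', v', hv', rfl⟩ := hn
  have hbirth := fun {x y : ℕ} (hx : x ∈ v') (hy : y ∈ v') {a b : ℕ} (ha : a ∈ v) (hb : b ∈ v) =>
    𝒯.len_birth_le_of_essExtends ι hι hv hv' hext hx hy ha hb
  obtain ⟨hll, hu, -⟩ := hext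
  have hll : l ≤ l' := hll
  have hover : ∀ b ∈ v, ∃ x ∈ v', (𝒯.node ι N x).res hl = (𝒯.node ι N b).res hl := by
    intro b hb
    have h1 : (𝒯.node ι N b).res hl ∈ ((𝒯.brick ι N).trace hl v).u :=
      Finset.mem_image_of_mem _ hb
    rw [hu] at h1
    obtain ⟨ν, hν, e⟩ := Finset.mem_image.1 h1
    obtain ⟨x, hx, rfl⟩ := Finset.mem_image.1 hν
    exact ⟨x, hx, e⟩
  choose! s hsv hs using hover
  have hb : ∀ a ∈ v, ∀ b ∈ v, a ≠ b → 𝒯.len ι (𝒯.birth N a b) ≤ l :=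
    fun a ha b hb hab => hv.c_le (a, b) (Finset.mem_offDiag.2 ⟨ha, hb, hab⟩) ⟨0, hι⟩
  have h2 := nontrivial_of_three_le hv.three_le
  obtain ⟨c, hc, hca⟩ := h2.exists_ne a
  obtain ⟨K, hK⟩ := 𝒯.exists_stage ι (((𝒯.len_strictMono ι).monotone (Nat.zero_le _)).trans
    (hb a ha c hc hca.symm))
  have hKl : 𝒯.len ι K ≤ l := (hK K).2 le_rfl
  obtain ⟨d, rfl⟩ := Nat.exists_eq_add_of_le ((𝒯.len_strictMono ι).le_iff_le.1 (hKl.trans hl))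
  have hp : ∀ x ∈ v', ∀ b ∈ v, (𝒯.node ι (K + d) x).res hl = (𝒯.node ι (K + d) b).res hl →
      𝒯.pull K d x = 𝒯.pull K d b := fun x hx b hb h =>
    𝒯.pull_eq_of_res_eq ι (hv'.subset hx) (hv.subset hb) hKl hl hl h
  have hmemS : (𝒯.node ι (K + d) (s a)).res hl' ∈
      {ν | ν ∈ ((𝒯.brick ι (K + d)).trace hl' v').u ∧
        (((𝒯.brick ι (K + d)).η a).res hl).IsInitSeg ν} :=
    ⟨Finset.mem_image_of_mem _ (hsv a ha), hll, hs a ha⟩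
  rw [Set.ncard_eq_one]
  refine ⟨(𝒯.node ι (K + d) (s a)).res hl', Set.eq_singleton_iff_unique_mem.2 ⟨hmemS, ?_⟩⟩
  rintro ν ⟨hν, _, hνa⟩
  obtain ⟨y, hy, rfl⟩ := Finset.mem_image.1 hν
  have hνa : (𝒯.node ι (K + d) y).res hl = (𝒯.node ι (K + d) a).res hl := hνa
  by_contra hne
  have hsy : s a ≠ y := fun h => hne (by rw [h]; rfl)
  refine 𝒯.doubled_over hS (K := K) (d := d) (d' := d) (s := s) (y := y) h2 ha
    (fun a ha b hb' hab => (hK _).1 (hb a ha b hb' hab))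
    (fun a ha b hb hab => (hK _).1 (hbirth (hsv a ha) (hsv b hb) ha hb hab (hs a ha) (hs b hb)))
    (fun b hb hba => (hK _).1 (hbirth hy (hsv b hb) ha hb hba.symm hνa (hs b hb))) hsy
    (fun b hb => hp _ (hsv b hb) b hb (hs b hb)) (hp y hy a ha hνa) hr hka.symm

theorem isBrick (hS : S.X = Set.univ) (hι : 0 < ι) (N : ℕ) :
    IsBrick S (𝒯.tree ι) (𝒯.len ι) (𝒯.brick ι N) where
  three_le := 𝒯.three_le_card N
  n_pos := 𝒯.len_pos ι N
  linInd := 𝒯.node_linearIndependent ι N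
  c_le p _ _ := (𝒯.len_strictMono ι).monotone (𝒯.birth_le N p.1 p.2)
  g_mem p hp i := by
    obtain ⟨ha, hb, hab⟩ := Finset.mem_offDiag.1 hp
    exact ⟨_, 𝒯.brNode_mem_tree ι i.2 ha hb hab⟩
  top_mem := 𝒯.trace_mem_configs ι (le_refl _) ((by omega : 2 ≤ 3).trans (𝒯.three_le_card N))
  rigid := 𝒯.brick_rigid ι hS hι N
  no_split := 𝒯.brick_no_split ι hS hι N

theorem brick_below_succ (K : ℕ) : (𝒯.brick ι K).Below (𝒯.brick ι (K + 1)) := by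
  have hle : 𝒯.len ι K ≤ 𝒯.len ι (K + 1) := (𝒯.len_strictMono ι).monotone (Nat.le_succ K)
  refine ⟨𝒯.sub_succ K, hle, fun a ha => ⟨hle, ?_⟩, fun p hp i => ?_⟩
  · ext p
    exact 𝒯.pt_stable ι (Nat.le_succ K) ha p.2
  · obtain ⟨ha, hb, hab⟩ := Finset.mem_offDiag.1 hp
    refine ⟨𝒯.birth_stable (Nat.le_succ K) ha hb, hle, ?_⟩
    ext q
    exact 𝒯.br_stable ι (Nat.le_succ K) ha hb q.2

/-- The copy of an earlier brick along a section of the retraction onto `w N` lies below the brick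
of stage `N + 1`. -/
theorem brick_map_below {K N : ℕ} (hKN : K ≤ N) {w : Finset ℕ} (hw : w ⊆ 𝒯.w K) {φ : ℕ → ℕ}
    (hinj : InjOn φ w) (hφ : ∀ a ∈ w, 𝒯.fold N (φ a) = a)
    (hold : ∀ a ∈ w, ∀ b ∈ w, 𝒯.Old N (φ a) (φ b)) :
    (((𝒯.brick ι K).restrict w).map φ).Below ((𝒯.brick ι (N + 1)).restrict (w.image φ)) := by
  have hle : 𝒯.len ι K ≤ 𝒯.len ι N := (𝒯.len_strictMono ι).monotone hKN
  have hle' : 𝒯.len ι N ≤ 𝒯.len ι (N + 1) := (𝒯.len_strictMono ι).monotone (Nat.le_succ N)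
  have e : ∀ a ∈ w, Function.invFunOn φ w (φ a) = a := fun a ha => hinj.leftInvOn_invFunOn ha
  refine ⟨le_refl _, hle.trans hle', fun x hx => ?_, fun p hp i => ?_⟩
  · obtain ⟨a, ha, rfl⟩ := Finset.mem_image.1 hx
    refine ⟨hle.trans hle', ?_⟩
    have e1 : (((𝒯.brick ι K).restrict w).map φ).η (φ a) = 𝒯.node ι K a :=
      congrArg (𝒯.node ι K) (e a ha)
    rw [e1]
    ext p
    change 𝒯.pt ι (N + 1) (φ a) p = 𝒯.pt ι K a p
    have hp : (p : ℕ) < 𝒯.len ι N := p.2.trans_le hle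
    rw [𝒯.pt_succ_of_lt ι hp, hφ a ha]
    exact 𝒯.pt_stable ι hKN (hw ha) p.2
  · obtain ⟨x, y⟩ := p
    obtain ⟨hx, hy, hne⟩ := Finset.mem_offDiag.1 hp
    obtain ⟨a, ha, rfl⟩ := Finset.mem_image.1 hx
    obtain ⟨b, hb, rfl⟩ := Finset.mem_image.1 hy
    have e1 : (((𝒯.brick ι K).restrict w).map φ).h i (φ a) (φ b) = 𝒯.birth K a b := by
      change 𝒯.birth K _ _ = _
      exact congrArg₂ _ (e a ha) (e b hb)
    have e2 : (((𝒯.brick ι K).restrict w).map φ).g i (φ a) (φ b) = 𝒯.brNode ι K i a b := by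
      change 𝒯.brNode ι K i _ _ = _
      exact congrArg₂ _ (e a ha) (e b hb)
    constructor
    · rw [e1]
      change 𝒯.birth (N + 1) (φ a) (φ b) = _
      rw [birth_succ_of_old 𝒯 (hold a ha b hb), hφ a ha, hφ b hb]
      exact 𝒯.birth_stable hKN (hw ha) (hw hb)
    · rw [e2]
      refine ⟨hle.trans hle', ?_⟩
      ext p
      change 𝒯.br ι (N + 1) i (φ a) (φ b) p = 𝒯.br ι K i a b p
      have hp : (p : ℕ) < 𝒯.len ι N := p.2.trans_le hle
      rw [𝒯.br_succ_of_lt ι hp (hold a ha b hb), hφ a ha, hφ b hb]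
      exact 𝒯.br_stable ι hKN (hw ha) (hw hb) p.2

end Tower

/-! ### Systems on sets of natural numbers and cuteness -/

theorem image_preimage_of_subset_range {α β : Type*} [LinearOrder α]
    [LinearOrder β] (f : α ↪o β) {A : Set α} {w : Finset β}
    (hw : (w : Set β) ⊆ f '' A) : (w.preimage f f.injective.injOn).image f = w := by
  classical
  rw [Finset.image_preimage, Finset.filter_true_of_mem]
  intro x hx
  exact image_subset_range f A (hw hx)

section Systems

variable {ε : Ordinal.{0}} {α β : Type*} [LinearOrder α] [WellFoundedLT α]
  [LinearOrder β] [WellFoundedLT β]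

/-- The restriction of a system to a nonempty subset. -/
def YZRSystem.restrict (q : YZRSystem ε α) (A : Set α) (hA : A ⊆ q.X) (hne : A.Nonempty) :
    YZRSystem ε α where
  X := A
  r := q.r
  j := q.j
  k := q.k
  nonempty := hne
  r_le w hw hwA := q.r_le w hw (hwA.trans hA)
  r_anti u w hu huw hwA := q.r_anti u w hu huw (hwA.trans hA)
  r_singleton a ha := q.r_singleton a (hA ha)
  k_lt w hw hwA := q.k_lt w hw (hwA.trans hA)
  no_twin := by
    rintro w hw hwA a ha hk ⟨b, hb, h⟩
    exact q.no_twin w hw (hwA.trans hA) a ha hk ⟨b, hA hb, h⟩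

/-- The copy of a system along an order embedding. -/
noncomputable def YZRSystem.map (q : YZRSystem ε α) (f : α ↪o β) : YZRSystem ε β where
  X := f '' q.X
  r w := q.r (w.preimage f f.injective.injOn)
  j w := q.j (w.preimage f f.injective.injOn)
  k w := q.k (w.preimage f f.injective.injOn)
  nonempty := q.nonempty.image f
  r_le w hw hwA := by
    have e := image_preimage_of_subset_range f hwA
    refine q.r_le _ (Finset.image_nonempty.1 (e ▸ hw)) fun x hx => ?_
    exact (f.injective.mem_set_image).1 (hwA (Finset.mem_preimage.1 hx))
  r_anti u w hu huw hwA := by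
    have e := image_preimage_of_subset_range f ((Finset.coe_subset.2 huw).trans hwA)
    refine q.r_anti _ _ (Finset.image_nonempty.1 (e ▸ hu)) (fun x hx => ?_) fun x hx => ?_
    · exact Finset.mem_preimage.2 (huw (Finset.mem_preimage.1 hx))
    · exact (f.injective.mem_set_image).1 (hwA (Finset.mem_preimage.1 hx))
  r_singleton := by
    rintro _ ⟨a, ha, rfl⟩
    have : ({f a} : Finset β).preimage f f.injective.injOn = {a} := by ext; simp
    rw [this]; exact q.r_singleton a ha
  k_lt w hw hwA := by
    have e := image_preimage_of_subset_range f hwA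
    have h := q.k_lt _ (Finset.image_nonempty.1 (e ▸ hw)) (fun x hx =>
      (f.injective.mem_set_image).1 (hwA (Finset.mem_preimage.1 hx)))
    refine h.trans_eq ?_
    conv_rhs => rw [← e]
    rw [Finset.card_image_of_injective _ f.injective]
  no_twin := by
    rintro w hw hwA a ha hk ⟨b, hb, hbw, hkb, hj, hr⟩
    have e := image_preimage_of_subset_range f hwA
    have hcb : ∀ x, countBelow w (f x) = countBelow (w.preimage f f.injective.injOn) x := by
      intro x
      rw [← countBelow_image (A := Set.univ) (f.strictMono.strictMonoOn _) (by simp) (by simp), e]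
    obtain ⟨a, haX, rfl⟩ := hwA ha
    obtain ⟨b, hbX, rfl⟩ := hb
    rw [hcb] at hk hkb
    have e1 : (insert (f b) (w.erase (f a))).preimage f f.injective.injOn =
        insert b ((w.preimage f f.injective.injOn).erase a) := by ext; simp
    have e2 : (insert (f b) w).preimage f f.injective.injOn =
        insert b (w.preimage f f.injective.injOn) := by ext; simp
    rw [e1] at hj
    rw [e2] at hr
    exact q.no_twin _ (Finset.image_nonempty.1 (e ▸ hw))
      (fun x hx => (f.injective.mem_set_image).1 (hwA (Finset.mem_preimage.1 hx))) a
      (Finset.mem_preimage.2 ha) hk ⟨b, hbX, fun h => hbw (Finset.mem_preimage.1 h), hkb, hj, hr⟩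

theorem YZRSystem.isQuasiEmbedding_map (q : YZRSystem ε α) (f : α ↪o β) :
    IsQuasiEmbedding q (q.map f) q.X f := by
  have e : ∀ v : Finset α, (v.image f).preimage f f.injective.injOn = v := fun v => by ext; simp
  exact
  { subset := le_refl _
    mapsTo := fun _ hx => mem_image_of_mem f hx
    strictMono := f.strictMono.strictMonoOn _
    r_eq := fun v _ _ => congrArg q.r (e v)
    k_eq := fun v _ _ => congrArg q.k (e v)
    j_eq := fun v _ _ _ => congrArg q.j (e v) }

/-- Finite systems on sets of natural numbers embed into a cute system arbitrarily far out. -/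
theorem YZRSystem.IsCute.exists_quasiEmbedding {S : YZRSystem ε ℕ} (hS : S.IsCute)
    (q : YZRSystem ε ℕ) (hq : q.X.Finite) (M : ℕ) :
    ∃ φ : ℕ → ℕ, IsQuasiEmbedding q S q.X φ ∧ ∀ x ∈ q.X, M ≤ φ x := by
  let f : ℕ ↪o Ordinal.{0} := OrderEmbedding.ofStrictMono (fun n : ℕ => (n : Ordinal.{0}))
    fun a b h => Nat.cast_lt.2 h
  obtain ⟨φ, hφ, hM⟩ := hS.2 (q.map f) (hq.image f) M
  exact ⟨φ ∘ f, hφ.comp (q.isQuasiEmbedding_map f) fun x hx => mem_image_of_mem f hx,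
    fun x hx => hM _ (mem_image_of_mem f hx)⟩

/-- Finite sets of natural numbers can be moved arbitrarily far out by quasi-embeddings. -/
theorem YZRSystem.IsCute.exists_far {S : YZRSystem ε ℕ} (hS : S.IsCute) (U : Finset ℕ) (M : ℕ) :
    ∃ φ : ℕ → ℕ, IsQuasiEmbedding S S U φ ∧ ∀ x ∈ U, M ≤ φ x := by
  rcases U.eq_empty_or_nonempty with rfl | hU
  · exact ⟨id, isQuasiEmbedding_id (by simp), by simp⟩
  · have hUX : (U : Set ℕ) ⊆ S.X := by rw [hS.1]; exact Set.subset_univ _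
    obtain ⟨φ, hφ, hM⟩ := hS.exists_quasiEmbedding (S.restrict U hUX hU) U.finite_toSet M
    refine ⟨φ, ⟨hUX, hφ.mapsTo, hφ.strictMono, hφ.r_eq, hφ.k_eq, hφ.j_eq⟩, hM⟩

end Systems

/-! ### Existence of towers with amalgamation -/

/-- Two quasi-embeddings of a part `w'` of `w` into `U` which agree on `u` and send the other points
to disjoint sets, where doubling these points over subsets of `u` is not forbidden by a vanishing
rank. For `u = w'` the two maps coincide. -/
structure IsAmalgam {ε : Ordinal.{0}} (S : YZRSystem ε ℕ) (w u w' U : Finset ℕ)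
    (π₀ π₁ : ℕ → ℕ) : Prop where
  sub : w' ⊆ w
  sub' : u ⊆ w'
  guard : ∀ v ⊆ u, ∀ δ ∈ w' \ u, S.r (insert δ v) = 0 → S.k (insert δ v) ≠ countBelow v δ
  left : IsQuasiEmbedding S S w' π₀
  right : IsQuasiEmbedding S S w' π₁
  agree : ∀ a ∈ u, π₀ a = π₁ a
  disj : Disjoint ((w' \ u).image π₀) ((w' \ u).image π₁)
  left_mem : ∀ a ∈ w', π₀ a ∈ U
  right_mem : ∀ a ∈ w', π₁ a ∈ U

theorem IsAmalgam.eq {ε : Ordinal.{0}} {S : YZRSystem ε ℕ} {w u w' U : Finset ℕ}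
    {π₀ π₁ : ℕ → ℕ} (h : IsAmalgam S w u w' U π₀ π₁) {a b : ℕ} (ha : a ∈ w') (hb : b ∈ w')
    (hab : π₀ a = π₁ b) : a = b ∧ a ∈ u := by
  by_cases hau : a ∈ u
  · exact ⟨h.right.strictMono.injOn ha hb ((h.agree a hau).symm.trans hab), hau⟩
  · by_cases hbu : b ∈ u
    · have := h.left.strictMono.injOn ha hb (hab.trans (h.agree b hbu).symm)
      exact ⟨this, this ▸ hbu⟩
    · exfalso
      refine Finset.disjoint_left.1 h.disj
        (Finset.mem_image_of_mem π₀ (Finset.mem_sdiff.2 ⟨ha, hau⟩)) ?_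
      rw [hab]
      exact Finset.mem_image_of_mem π₁ (Finset.mem_sdiff.2 ⟨hb, hbu⟩)

/-- The conditions which the definition of a tower imposes on the step from `w` to `w₁`, where `K`
is the point to be included. -/
structure IsTowerStep {ε : Ordinal.{0}} (S : YZRSystem ε ℕ) (K : ℕ) (w w₁ L R : Finset ℕ)
    (fold : ℕ → ℕ) : Prop where
  sub : w ⊆ w₁
  mem : K ∈ w₁
  left_sub : L ⊆ w₁
  right_sub : R ⊆ w₁
  left_disj : Disjoint L w
  right_disj : Disjoint R w
  fold_mem : ∀ a ∈ w₁, fold a ∈ w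
  fold_id : ∀ a ∈ w, fold a = a
  fold_left : IsQuasiEmbedding S S L fold
  fold_right : IsQuasiEmbedding S S R fold
  guarded : ∀ v ⊆ L ∩ R, ∀ x ∈ L ∪ R, x ∉ L ∩ R →
    S.r (insert x v) = 0 → S.k (insert x v) ≠ countBelow v x

/-- A copy `π` of `U` in `w₁` realizes the amalgam of `π₀` and `π₁`: the two copies of `w'` become
parts of `L` and `R`, and `fold` inverts `π ∘ π₀` and `π ∘ π₁`. -/
def Realizes {ε : Ordinal.{0}} (S : YZRSystem ε ℕ) (w₁ L R : Finset ℕ) (fold : ℕ → ℕ)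
    (w' U : Finset ℕ) (π₀ π₁ : ℕ → ℕ) : Prop :=
  ∃ π : ℕ → ℕ, IsQuasiEmbedding S S U π ∧ U.image π ⊆ w₁ ∧
    ∀ a ∈ w', fold (π (π₀ a)) = a ∧ fold (π (π₁ a)) = a ∧ π (π₀ a) ∈ L ∧ π (π₁ a) ∈ R

theorem exists_step_of_isAmalgam {ε : Ordinal.{0}} {S : YZRSystem ε ℕ} (hS : S.IsCute) (K : ℕ)
    {w u w' U : Finset ℕ} {π₀ π₁ : ℕ → ℕ} (hw : w.Nonempty)
    (h : IsAmalgam S w u w' U π₀ π₁) :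
    ∃ (w₁ L R : Finset ℕ) (fold : ℕ → ℕ), IsTowerStep S K w w₁ L R fold ∧
      Realizes S w₁ L R fold w' U π₀ π₁ := by
  classical
  obtain ⟨base, hbase⟩ := hw
  obtain ⟨π, hπ, hM⟩ := hS.exists_far U (w.sup id + 1)
  have hnew : ∀ x ∈ U, π x ∉ w := by
    intro x hx hxw
    have h1 := Finset.le_sup (f := id) hxw
    have h2 := hM x hx
    simp only [id] at h1
    omega
  have hX : ∀ A : Set ℕ, A ⊆ S.X := fun A => by rw [hS.1]; exact Set.subset_univ _
  set L := w'.image (π ∘ π₀) with hL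
  set R := w'.image (π ∘ π₁) with hR
  have q₀ : IsQuasiEmbedding S S w' (π ∘ π₀) := hπ.comp h.left fun a ha => h.left_mem a ha
  have q₁ : IsQuasiEmbedding S S w' (π ∘ π₁) := hπ.comp h.right fun a ha => h.right_mem a ha
  let fold : ℕ → ℕ := fun x => if x ∈ w then x else
    if x ∈ L then Function.invFunOn (π ∘ π₀) w' x else
    if x ∈ R then Function.invFunOn (π ∘ π₁) w' x else base
  have hLw : ∀ x ∈ L, x ∉ w := by
    intro x hx
    obtain ⟨a, ha, rfl⟩ := Finset.mem_image.1 hx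
    exact hnew _ (h.left_mem a ha)
  have hRw : ∀ x ∈ R, x ∉ w := by
    intro x hx
    obtain ⟨a, ha, rfl⟩ := Finset.mem_image.1 hx
    exact hnew _ (h.right_mem a ha)
  have heq : ∀ a ∈ w', ∀ b ∈ w', π (π₀ a) = π (π₁ b) → a = b ∧ a ∈ u := fun a ha b hb hab =>
    h.eq ha hb (hπ.strictMono.injOn (h.left_mem a ha) (h.right_mem b hb) hab)
  have f₀ : ∀ a ∈ w', fold (π (π₀ a)) = a := by
    intro a ha
    have h1 : π (π₀ a) ∈ L := Finset.mem_image_of_mem (π ∘ π₀) ha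
    simp only [fold]
    rw [if_neg (hLw _ h1), if_pos h1]
    exact q₀.strictMono.injOn.leftInvOn_invFunOn ha
  have f₁ : ∀ a ∈ w', fold (π (π₁ a)) = a := by
    intro a ha
    by_cases h1 : π (π₁ a) ∈ L
    · obtain ⟨b, hb, e⟩ := Finset.mem_image.1 h1
      have e : π (π₀ b) = π (π₁ a) := e
      rw [← e, f₀ b hb]
      exact (heq b hb a ha e).1
    · have h2 : π (π₁ a) ∈ R := Finset.mem_image_of_mem (π ∘ π₁) ha
      simp only [fold]
      rw [if_neg (hRw _ h2), if_neg h1, if_pos h2]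
      exact q₁.strictMono.injOn.leftInvOn_invFunOn ha
  have hinter : ∀ x ∈ L ∩ R, ∃ a ∈ u, x = π (π₀ a) ∧ x = π (π₁ a) := by
    intro x hx
    obtain ⟨h1, h2⟩ := Finset.mem_inter.1 hx
    obtain ⟨a, ha, rfl⟩ := Finset.mem_image.1 h1
    obtain ⟨b, hb, e⟩ := Finset.mem_image.1 h2
    obtain ⟨rfl, hau⟩ := heq a ha b hb e.symm
    exact ⟨a, hau, rfl, e.symm⟩
  have hu : ∀ a ∈ u, π (π₀ a) ∈ L ∩ R := fun a ha => Finset.mem_inter.2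
    ⟨Finset.mem_image_of_mem (π ∘ π₀) (h.sub' ha),
      Finset.mem_image.2 ⟨a, h.sub' ha, by simp [h.agree a ha]⟩⟩
  have hguard : ∀ φ : ℕ → ℕ, IsQuasiEmbedding S S w' φ →
      (∀ x ∈ L ∩ R, ∃ a ∈ u, x = φ a) → ∀ v ⊆ L ∩ R, ∀ δ ∈ w' \ u,
      S.r (insert (φ δ) v) = 0 → S.k (insert (φ δ) v) ≠ countBelow v (φ δ) := by
    intro φ hφ hφu v hv δ hδ
    have hδ' := (Finset.mem_sdiff.1 hδ).1
    obtain ⟨v₀, hv₀, rfl⟩ : ∃ v₀ ⊆ u, v₀.image φ = v := by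
      refine ⟨u.filter (fun a => φ a ∈ v), Finset.filter_subset _ _, ?_⟩
      ext x
      simp only [Finset.mem_image, Finset.mem_filter]
      constructor
      · rintro ⟨a, ⟨-, h⟩, rfl⟩; exact h
      · intro hx
        obtain ⟨a, ha, rfl⟩ := hφu x (hv hx)
        exact ⟨a, ⟨ha, hx⟩, rfl⟩
    have hsub : ((insert δ v₀ : Finset ℕ) : Set ℕ) ⊆ w' := by
      intro x hx
      rcases Finset.mem_insert.1 hx with rfl | hx
      · exact hδ'
      · exact h.sub' (hv₀ hx)
    rw [← Finset.image_insert, hφ.r_eq _ ⟨δ, by simp⟩ hsub, hφ.k_eq _ ⟨δ, by simp⟩ hsub,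
      countBelow_image hφ.strictMono (fun x hx => h.sub' (hv₀ hx)) hδ']
    exact h.guard v₀ hv₀ δ hδ
  have hsubU : ∀ {x}, x ∈ L ∨ x ∈ R → x ∈ U.image π := by
    rintro x (hx | hx)
    · obtain ⟨a, ha, rfl⟩ := Finset.mem_image.1 hx
      exact Finset.mem_image_of_mem π (h.left_mem a ha)
    · obtain ⟨a, ha, rfl⟩ := Finset.mem_image.1 hx
      exact Finset.mem_image_of_mem π (h.right_mem a ha)
  refine ⟨insert K (w ∪ U.image π), L, R, fold, ?_, π, hπ, ?_, fun a ha => ⟨f₀ a ha, f₁ a ha,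
    Finset.mem_image_of_mem (π ∘ π₀) ha, Finset.mem_image_of_mem (π ∘ π₁) ha⟩⟩
  · refine
    { sub := fun x hx => Finset.mem_insert_of_mem (Finset.mem_union_left _ hx)
      mem := Finset.mem_insert_self _ _
      left_sub := fun x hx =>
        Finset.mem_insert_of_mem (Finset.mem_union_right _ (hsubU (Or.inl hx)))
      right_sub := fun x hx =>
        Finset.mem_insert_of_mem (Finset.mem_union_right _ (hsubU (Or.inr hx)))
      left_disj := Finset.disjoint_left.2 hLw
      right_disj := Finset.disjoint_left.2 hRw
      fold_mem := ?_
      fold_id := fun a ha => if_pos ha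
      fold_left := ?_
      fold_right := ?_
      guarded := ?_ }
    · intro a _
      by_cases h1 : a ∈ w
      · simpa only [fold, if_pos h1] using h1
      · by_cases h2 : a ∈ L
        · obtain ⟨b, hb, rfl⟩ := Finset.mem_image.1 h2
          simp only [Function.comp]
          rw [f₀ b hb]; exact h.sub hb
        · by_cases h3 : a ∈ R
          · obtain ⟨b, hb, rfl⟩ := Finset.mem_image.1 h3
            simp only [Function.comp]
            rw [f₁ b hb]; exact h.sub hb
          · simpa only [fold, if_neg h1, if_neg h2, if_neg h3] using hbase
    · have := q₀.inverse (ψ := fold) f₀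
      rwa [hL, Finset.coe_image]
    · have := q₁.inverse (ψ := fold) f₁
      rwa [hR, Finset.coe_image]
    · intro v hv x hx hxn
      rcases Finset.mem_union.1 hx with hx | hx
      · obtain ⟨δ, hδ, rfl⟩ := Finset.mem_image.1 hx
        refine hguard (π ∘ π₀) q₀ (fun y hy => ?_) v hv δ (Finset.mem_sdiff.2 ⟨hδ, fun hδu =>
          hxn (hu δ hδu)⟩)
        obtain ⟨a, ha, e, -⟩ := hinter y hy
        exact ⟨a, ha, e⟩
      · obtain ⟨δ, hδ, rfl⟩ := Finset.mem_image.1 hx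
        refine hguard (π ∘ π₁) q₁ (fun y hy => ?_) v hv δ (Finset.mem_sdiff.2 ⟨hδ, fun hδu =>
          hxn ?_⟩)
        · obtain ⟨a, ha, -, e⟩ := hinter y hy
          exact ⟨a, ha, e⟩
        · have := hu δ hδu
          rwa [h.agree δ hδu] at this
  · exact fun x hx => Finset.mem_insert_of_mem (Finset.mem_union_right _ hx)

theorem exists_step {ε : Ordinal.{0}} {S : YZRSystem ε ℕ} (hS : S.IsCute) (K : ℕ)
    {w : Finset ℕ} (hw : w.Nonempty) (u w' U : Finset ℕ) (π₀ π₁ : ℕ → ℕ) :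
    ∃ (w₁ L R : Finset ℕ) (fold : ℕ → ℕ), IsTowerStep S K w w₁ L R fold ∧
      (IsAmalgam S w u w' U π₀ π₁ → Realizes S w₁ L R fold w' U π₀ π₁) := by
  by_cases h : IsAmalgam S w u w' U π₀ π₁
  · obtain ⟨w₁, L, R, fold, h1, h2⟩ := exists_step_of_isAmalgam hS K hw h
    exact ⟨w₁, L, R, fold, h1, fun _ => h2⟩
  · have h0 : IsAmalgam S w ∅ ∅ ∅ id id :=
      ⟨by simp, by simp, by simp, isQuasiEmbedding_id (by simp), isQuasiEmbedding_id (by simp),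
        by simp, by simp, by simp, by simp⟩
    obtain ⟨w₁, L, R, fold, h1, -⟩ := exists_step_of_isAmalgam hS K hw h0
    exact ⟨w₁, L, R, fold, h1, fun h' => absurd h' h⟩

theorem exists_finsupp_eqOn (s : Finset ℕ) (f : ℕ → ℕ) : ∃ g : ℕ →₀ ℕ, ∀ a ∈ s, g a = f a := by
  classical
  refine ⟨Finsupp.onFinset s (fun a => if a ∈ s then f a else 0) ?_, ?_⟩
  · intro a ha
    by_contra h
    simp [h] at ha
  · intro a ha
    simp [ha]

theorem IsAmalgam.congr {ε : Ordinal.{0}} {S : YZRSystem ε ℕ} {w u w' U : Finset ℕ}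
    {π₀ π₁ φ₀ φ₁ : ℕ → ℕ} (h : IsAmalgam S w u w' U π₀ π₁) (e₀ : ∀ a ∈ w', φ₀ a = π₀ a)
    (e₁ : ∀ a ∈ w', φ₁ a = π₁ a) : IsAmalgam S w u w' U φ₀ φ₁ where
  sub := h.sub
  sub' := h.sub'
  guard := h.guard
  left := h.left.congr fun a ha => (e₀ a ha).symm
  right := h.right.congr fun a ha => (e₁ a ha).symm
  agree a ha := by rw [e₀ a (h.sub' ha), e₁ a (h.sub' ha), h.agree a ha]
  disj := by
    have i₀ : (w' \ u).image φ₀ = (w' \ u).image π₀ :=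
      Finset.image_congr fun a ha => e₀ a (Finset.mem_sdiff.1 ha).1
    have i₁ : (w' \ u).image φ₁ = (w' \ u).image π₁ :=
      Finset.image_congr fun a ha => e₁ a (Finset.mem_sdiff.1 ha).1
    rw [i₀, i₁]; exact h.disj
  left_mem a ha := by rw [e₀ a ha]; exact h.left_mem a ha
  right_mem a ha := by rw [e₁ a ha]; exact h.right_mem a ha

/-- Every amalgam of two copies of a part of a finite set of the tower is realized at some later
stage. -/
def Tower.IsUniversal {ε : Ordinal.{0}} {S : YZRSystem ε ℕ} (𝒯 : Tower S) : Prop :=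
  ∀ (n : ℕ) (u w' U : Finset ℕ) (π₀ π₁ : ℕ → ℕ), IsAmalgam S (𝒯.w n) u w' U π₀ π₁ →
    ∃ N ≥ n, Realizes S (𝒯.w (N + 1)) (𝒯.left N) (𝒯.right N) (𝒯.fold N) w' U π₀ π₁

/-- There is a universal tower: the countably many amalgams, coded by finitely supported maps, are
dealt with one at a time, each of them infinitely often. -/
theorem exists_tower {ε : Ordinal.{0}} {S : YZRSystem ε ℕ} (hS : S.IsCute) :
    ∃ 𝒯 : Tower S, 𝒯.IsUniversal := by
  obtain ⟨e, he⟩ := exists_surjective_nat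
    (Finset ℕ × Finset ℕ × Finset ℕ × (ℕ →₀ ℕ) × (ℕ →₀ ℕ))
  let t : ℕ → Finset ℕ × Finset ℕ × Finset ℕ × (ℕ →₀ ℕ) × (ℕ →₀ ℕ) :=
    fun K => e (Nat.unpair K).1
  have hstep := fun (K : ℕ) (w : Finset ℕ) (hw : w.Nonempty) =>
    exists_step hS K hw (t K).1 (t K).2.1 (t K).2.2.1 (t K).2.2.2.1 (t K).2.2.2.2
  choose! next L R fold hstep hreal using hstep
  let w : ℕ → Finset ℕ := fun K => Nat.rec (Finset.range 3) (fun K w => next K w) K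
  have hw_succ : ∀ K, w (K + 1) = next K (w K) := fun K => rfl
  have hne : ∀ K, (w K).Nonempty := by
    intro K
    induction K with
    | zero => exact ⟨0, by simp [w]⟩
    | succ K ih => exact ⟨K, (hstep K (w K) ih).mem⟩
  have hs : ∀ K, IsTowerStep S K (w K) (w (K + 1)) (L K (w K)) (R K (w K)) (fold K (w K)) :=
    fun K => hstep K (w K) (hne K)
  refine ⟨⟨w, fun K => L K (w K), fun K => R K (w K), fun K => fold K (w K), by simp [w],
    fun K => (hs K).sub, fun K => (hs K).mem, fun K => (hs K).left_sub, fun K => (hs K).right_sub,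
    fun K => (hs K).left_disj, fun K => (hs K).right_disj, fun K => (hs K).fold_mem,
    fun K => (hs K).fold_id, fun K => (hs K).fold_left, fun K => (hs K).fold_right,
    fun K => (hs K).guarded⟩, ?_⟩
  intro n u w' U π₀ π₁ h
  obtain ⟨φ₀, e₀⟩ := exists_finsupp_eqOn w' π₀
  obtain ⟨φ₁, e₁⟩ := exists_finsupp_eqOn w' π₁
  obtain ⟨i, hi⟩ := he (u, w', U, φ₀, φ₁)
  have hN : n ≤ Nat.pair i n := Nat.right_le_pair i n
  have htN : t (Nat.pair i n) = (u, w', U, φ₀, φ₁) := by simp [t, hi]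
  have hmono : w n ⊆ w (Nat.pair i n) :=
    monotone_nat_of_le_succ (f := w) (fun K => (hs K).sub) hN
  refine ⟨Nat.pair i n, hN, ?_⟩
  have hr := hreal (Nat.pair i n) (w (Nat.pair i n)) (hne _)
  rw [htN] at hr
  obtain ⟨π, h1, h2, h3⟩ := hr { h.congr e₀ e₁ with sub := h.sub.trans hmono }
  refine ⟨π, h1, h2, fun a ha => ?_⟩
  have := h3 a ha
  rwa [e₀ a ha, e₁ a ha] at this

theorem Tower.controlledAmalgamation {ε : Ordinal.{0}} {S : YZRSystem ε ℕ} (hS : S.X = Set.univ)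
    {ι : ℕ} (hι : 0 < ι) (𝒯 : Tower S)
    (h𝒯 : 𝒯.IsUniversal) :
    ControlledAmalgamation S ι (𝒯.tree ι) (𝒯.len ι) := by
  refine ⟨𝒯.brick ι, 𝒯.isBrick ι hS hι, 𝒯.brick_below_succ ι,
    fun a => ⟨a + 1, 𝒯.mem_w (Nat.lt_succ_self a)⟩, (𝒯.len_strictMono ι).tendsto_atTop, ?_, ?_⟩
  · intro n u w huw hw _ hguard π₀ π₁ h₀ h₁ hagree hdisj
    obtain ⟨N, hN, π, hπ, hsub, hfold⟩ := h𝒯 n u w (w.image π₀ ∪ w.image π₁) π₀ π₁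
      ⟨hw, huw, hguard, h₀, h₁, hagree, hdisj,
        fun a ha => Finset.mem_union_left _ (Finset.mem_image_of_mem _ ha),
        fun a ha => Finset.mem_union_right _ (Finset.mem_image_of_mem _ ha)⟩
    have inj₀ : InjOn (π ∘ π₀) w := fun a ha b hb hab => by
      rw [← (hfold a ha).1, ← (hfold b hb).1]; exact congrArg _ hab
    have inj₁ : InjOn (π ∘ π₁) w := fun a ha b hb hab => by
      rw [← (hfold a ha).2.1, ← (hfold b hb).2.1]; exact congrArg _ hab
    refine ⟨N + 1, π, hπ, hsub, 𝒯.brick_map_below ι hN hw inj₀ (fun a ha => (hfold a ha).1)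
      fun a ha b hb => Or.inr (Or.inl ⟨(hfold a ha).2.2.1, (hfold b hb).2.2.1⟩),
      𝒯.brick_map_below ι hN hw inj₁ (fun a ha => (hfold a ha).2.1)
      fun a ha b hb => Or.inr (Or.inr ⟨(hfold a ha).2.2.2, (hfold b hb).2.2.2⟩)⟩
  · intro n w hw _ π₀ u h₀ hu
    obtain ⟨N, hN, π, hπ, hsub, hfold⟩ := h𝒯 n w w u π₀ π₀
      ⟨hw, le_refl _, by simp, h₀, h₀, fun _ _ => rfl, by simp,
        fun a ha => hu (Finset.mem_image_of_mem _ ha),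
        fun a ha => hu (Finset.mem_image_of_mem _ ha)⟩
    have inj₀ : InjOn (π ∘ π₀) w := fun a ha b hb hab => by
      rw [← (hfold a ha).1, ← (hfold b hb).1]; exact congrArg _ hab
    exact ⟨N + 1, π, hπ, hsub, 𝒯.brick_map_below ι hN hw inj₀ (fun a ha => (hfold a ha).1)
      fun a ha b hb => Or.inr (Or.inl ⟨(hfold a ha).2.2.1, (hfold b hb).2.2.1⟩)⟩

/-! ### The rank -/

theorem ndrkGE_iff {ι : ℕ} (T : ℕ → BinTree) (α : Ordinal.{0}) (m : Config ι) :
    NdrkGE T α m ↔ ∀ β < α, ∀ ν ∈ m.u, ∃ n ∈ configs T ι, m.len < n.len ∧ m.Extends n ∧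
      NdrkGE T β n ∧ 2 ≤ {η | η ∈ n.u ∧ ν.IsInitSeg η}.ncard := by
  induction α using WellFoundedLT.induction generalizing m with
  | ind α ih =>
    rcases Ordinal.zero_or_succ_or_isSuccLimit α with rfl | ⟨γ, rfl⟩ | hlim
    · simp [NdrkGE]
    · have e : NdrkGE T (Order.succ γ) m ↔ ∀ ν ∈ m.u, ∃ n ∈ configs T ι, m.len < n.len ∧
          m.Extends n ∧ NdrkGE T γ n ∧ 2 ≤ {η | η ∈ n.u ∧ ν.IsInitSeg η}.ncard := by
        unfold NdrkGE
        rw [Order.succ_eq_add_one, Ordinal.limitRecOn_add_one]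
      have hγ : γ < Order.succ γ := Order.lt_succ γ
      rw [e]
      refine ⟨fun h β hβ ν hν => ?_, fun h => h γ hγ⟩
      obtain ⟨n, h1, h2, h3, h4, h5⟩ := h ν hν
      have hβγ : β ≤ γ := Order.lt_succ_iff.1 hβ
      refine ⟨n, h1, h2, h3, ?_, h5⟩
      rw [ih β hβ]
      rw [ih γ hγ] at h4
      exact fun δ hδ => h4 δ (hδ.trans_le hβγ)
    · have e : NdrkGE T α m ↔ ∀ β < α, NdrkGE T β m := by
        unfold NdrkGE
        rw [Ordinal.limitRecOn_limit _ _ _ _ hlim]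
      rw [e]
      constructor
      · intro h β hβ
        have hs : Order.succ β < α := hlim.succ_lt hβ
        exact (ih _ hs m).1 (h _ hs) β (Order.lt_succ β)
      · intro h β hβ
        rw [ih β hβ]
        exact fun γ hγ => h γ (hγ.trans hβ)

theorem NdrkGE.mono {ι : ℕ} {T : ℕ → BinTree} {α β : Ordinal.{0}} {m : Config ι}
    (h : NdrkGE T α m) (hβ : β ≤ α) : NdrkGE T β m := by
  rw [ndrkGE_iff] at h ⊢
  exact fun γ hγ => h γ (hγ.trans_le hβ)

/-- A criterion for the extension relation for configurations parametrized by finite sets of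
natural numbers. -/
theorem extends_of_param {ι : ℕ} {m n : Config ι} (hl : m.len ≤ n.len) {v w : Finset ℕ}
    {f : ℕ → Node m.len} {g : ℕ → Node n.len} {p : ℕ → ℕ} (hm : m.u = v.image f)
    (hn : n.u = w.image g) (hp : w.image p = v) (hgf : ∀ x ∈ w, (g x).res hl = f (p x))
    (hh : ∀ x ∈ w, ∀ y ∈ w, p x ≠ p y → ∀ i, m.h i (f (p x)) (f (p y)) = n.h i (g x) (g y) ∧
      m.g i (f (p x)) (f (p y)) = (n.g i (g x) (g y)).res hl) : m.Extends n := by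
  refine ⟨hl, ?_, ?_⟩
  · rw [hm, hn, ← hp, Finset.image_image, Finset.image_image]
    exact Finset.image_congr fun x hx => (hgf x hx).symm
  · rintro ⟨X, Y⟩ hXY hne i
    obtain ⟨hX, hY, -⟩ := Finset.mem_offDiag.1 hXY
    rw [hn] at hX hY
    obtain ⟨x, hx, rfl⟩ := Finset.mem_image.1 hX
    obtain ⟨y, hy, rfl⟩ := Finset.mem_image.1 hY
    simp only [hgf x hx, hgf y hy] at hne ⊢
    exact hh x hx y hy (fun h => hne (by rw [h])) i

/-! ### Doubling a point -/

section Doubling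

variable {ε : Ordinal.{0}}

/-- The set obtained from `w` by doubling `δ`; the element `x` of `w` is represented by `2 * x`,
and the second copy of `δ` by `2 * δ + 1`. -/
def doubledSet (w : Finset ℕ) (δ : ℕ) : Finset ℕ := insert (2 * δ + 1) (w.image (2 * ·))

/-- The set of elements of `w` represented in `A`. -/
def half (A : Finset ℕ) : Finset ℕ := A.image (· / 2)

theorem div_two_mem {w : Finset ℕ} {δ x : ℕ} (hδ : δ ∈ w) (hx : x ∈ doubledSet w δ) :
    x / 2 ∈ w := by
  rcases Finset.mem_insert.1 hx with rfl | hx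
  · rwa [show (2 * δ + 1) / 2 = δ by omega]
  · obtain ⟨y, hy, rfl⟩ := Finset.mem_image.1 hx
    simpa using hy

theorem half_subset {w A : Finset ℕ} {δ : ℕ} (hδ : δ ∈ w) (hA : A ⊆ doubledSet w δ) :
    half A ⊆ w := by
  intro y hy
  obtain ⟨x, hx, rfl⟩ := Finset.mem_image.1 hy
  exact div_two_mem hδ (hA hx)

theorem strictMonoOn_div_two {w A : Finset ℕ} {δ : ℕ} (hA : A ⊆ doubledSet w δ)
    (h : ¬(2 * δ ∈ A ∧ 2 * δ + 1 ∈ A)) : StrictMonoOn (· / 2) (A : Set ℕ) := by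
  intro x hx y hy hxy
  have hx' := hA hx
  have hy' := hA hy
  simp only [doubledSet, Finset.mem_insert, Finset.mem_image] at hx' hy'
  by_contra hlt
  have h1 : y = x + 1 ∧ x / 2 = y / 2 := by
    have : ¬ x / 2 < y / 2 := hlt
    omega
  have h2 : x = 2 * δ := by
    rcases hy' with hy' | ⟨z, hz, rfl⟩ <;> omega
  subst h2
  exact h ⟨hx, h1.1 ▸ hy⟩

open Classical in
/-- The system on the set obtained from `w` by doubling `δ` in which each of the two copies of `w`
carries the given system. The rank of the sets containing both copies of `δ` is cut down to at most
`β`, and their `j`-values are distinct from each other and from all others; both serve to exclude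
twins. -/
noncomputable def doubledSystem (S : YZRSystem ε ℕ) (hS : S.X = Set.univ) (w : Finset ℕ) (δ : ℕ)
    (hδ : δ ∈ w) (β : Ordinal.{0}) (hβ : β < S.r w) : YZRSystem ε ℕ where
  X := doubledSet w δ
  r A := if 2 * δ ∈ A ∧ 2 * δ + 1 ∈ A then min (S.r (half A)) β else S.r (half A)
  j A := if 2 * δ ∈ A ∧ 2 * δ + 1 ∈ A then 1 + ∑ B ∈ w.powerset, S.j B + Encodable.encode A
    else S.j (half A)
  k A := if 2 * δ ∈ A ∧ 2 * δ + 1 ∈ A then 0 else S.k (half A)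
  nonempty := ⟨2 * δ + 1, by simp [doubledSet]⟩
  r_le A hA hAX := by
    have h := S.r_le (half A) (hA.image _) (by simp [hS])
    split_ifs
    · exact (min_le_left _ _).trans h
    · exact h
  r_anti A B hA hAB hBX := by
    have h := S.r_anti (half A) (half B) (hA.image _) (Finset.image_subset_image hAB)
      (by simp [hS])
    by_cases h1 : 2 * δ ∈ A ∧ 2 * δ + 1 ∈ A
    · have h2 : 2 * δ ∈ B ∧ 2 * δ + 1 ∈ B := ⟨hAB h1.1, hAB h1.2⟩
      rw [if_pos h1, if_pos h2]
      exact min_le_min_right _ h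
    · rw [if_neg h1]
      split_ifs
      · exact (min_le_left _ _).trans h
      · exact h
  r_singleton a ha := by
    have h1 : ¬(2 * δ ∈ ({a} : Finset ℕ) ∧ 2 * δ + 1 ∈ ({a} : Finset ℕ)) := by
      simp only [Finset.mem_singleton]; omega
    rw [if_neg h1]
    exact S.r_singleton _ (by simp [hS])
  k_lt A hA hAX := by
    split_ifs with h
    · exact hA.card_pos
    · have h1 := S.k_lt (half A) (hA.image _) (by simp [hS])
      exact h1.trans_le Finset.card_image_le
  no_twin := by
    rintro A hA hAX a ha hk ⟨b, hb, hbA, hkb, hj, hr⟩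
    have hAX : A ⊆ doubledSet w δ := by exact_mod_cast hAX
    have hb : b ∈ doubledSet w δ := hb
    have hbA' : insert b A ⊆ doubledSet w δ := Finset.insert_subset hb hAX
    have hAb : insert b (A.erase a) ⊆ doubledSet w δ :=
      (Finset.insert_subset_insert b (Finset.erase_subset a A)).trans hbA'
    have hjle : ∀ B ⊆ doubledSet w δ, S.j (half B) ≤ ∑ B ∈ w.powerset, S.j B := fun B hB =>
      Finset.single_le_sum (f := S.j) (fun _ _ => Nat.zero_le _)
        (Finset.mem_powerset.2 (half_subset hδ hB))
    have j1 := hjle _ hAX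
    have j2 := hjle _ hAb
    by_cases h1 : 2 * δ ∈ A ∧ 2 * δ + 1 ∈ A
    · rw [if_pos h1] at hj
      by_cases h2 : 2 * δ ∈ insert b (A.erase a) ∧ 2 * δ + 1 ∈ insert b (A.erase a)
      · rw [if_pos h2] at hj
        have h3 := Encodable.encode_injective (Nat.add_left_cancel hj)
        exact hbA (h3 ▸ Finset.mem_insert_self b _)
      · rw [if_neg h2] at hj
        omega
    · rw [if_neg h1] at hj hk hkb hr
      by_cases h2 : 2 * δ ∈ insert b (A.erase a) ∧ 2 * δ + 1 ∈ insert b (A.erase a)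
      · rw [if_pos h2] at hj
        omega
      · rw [if_neg h2] at hj
        by_cases h3 : 2 * δ ∈ insert b A ∧ 2 * δ + 1 ∈ insert b A
        · rw [if_pos h3] at hr
          have h4 := S.r_anti (half A) w (hA.image _) (half_subset hδ hAX) (by simp [hS])
          exact absurd hr ((min_le_right _ _).trans_lt (hβ.trans_le h4)).ne
        · rw [if_neg h3] at hr
          have hm := strictMonoOn_div_two hbA' h3
          have hsub : (A : Set ℕ) ⊆ ((insert b A : Finset ℕ) : Set ℕ) := by simp
          have ha' : a ∈ ((insert b A : Finset ℕ) : Set ℕ) := hsub ha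
          have hb' : b ∈ ((insert b A : Finset ℕ) : Set ℕ) := by simp
          have e1 : half (insert b (A.erase a)) = insert (b / 2) ((half A).erase (a / 2)) := by
            unfold half
            rw [Finset.image_insert]
            congr 1
            ext y
            simp only [Finset.mem_image, Finset.mem_erase]
            constructor
            · rintro ⟨x, ⟨hxa, hx⟩, rfl⟩
              exact ⟨fun h => hxa (hm.injOn (hsub hx) ha' h), x, hx, rfl⟩
            · rintro ⟨hy, x, hx, rfl⟩
              exact ⟨x, ⟨fun h => hy (by rw [h]), hx⟩, rfl⟩
          have e2 : half (insert b A) = insert (b / 2) (half A) := Finset.image_insert _ _ _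
          rw [e1] at hj
          rw [e2] at hr
          refine S.no_twin (half A) (hA.image _) (by simp [hS]) (a / 2)
            (Finset.mem_image_of_mem _ ha) ?_ ⟨b / 2, by simp [hS], ?_, ?_, hj, hr⟩
          · rw [← hk]; exact countBelow_image hm hsub ha'
          · intro h
            obtain ⟨x, hx, e⟩ := Finset.mem_image.1 h
            exact hbA (hm.injOn (hsub hx) hb' e ▸ hx)
          · rw [← hkb]; exact countBelow_image hm hsub hb'

theorem isQuasiEmbedding_doubledSystem (S : YZRSystem ε ℕ) (hS : S.X = Set.univ) {w : Finset ℕ}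
    {δ : ℕ} (hδ : δ ∈ w) {β : Ordinal.{0}} (hβ : β < S.r w) {g : ℕ → ℕ}
    (hg : ∀ x ∈ w, g x ∈ doubledSet w δ) (hg' : ∀ x, g x / 2 = x) :
    IsQuasiEmbedding S (doubledSystem S hS w δ hδ β hβ) w g := by
  have hnot : ∀ v : Finset ℕ, ¬(2 * δ ∈ v.image g ∧ 2 * δ + 1 ∈ v.image g) := by
    rintro v ⟨h1, h2⟩
    obtain ⟨a, -, ha⟩ := Finset.mem_image.1 h1
    obtain ⟨b, -, hb⟩ := Finset.mem_image.1 h2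
    have e1 := hg' a
    have e2 := hg' b
    have : a = b := by omega
    subst this
    omega
  have hhalf : ∀ v : Finset ℕ, half (v.image g) = v := by
    intro v
    unfold half
    rw [Finset.image_image]
    conv_rhs => rw [← Finset.image_id (s := v)]
    exact Finset.image_congr fun x _ => hg' x
  exact
  { subset := by simp [hS]
    mapsTo := hg
    strictMono := fun a _ b _ hab => by
      have e1 := hg' a
      have e2 := hg' b
      by_contra h
      omega
    r_eq := fun v _ _ => (if_neg (hnot v)).trans (by rw [hhalf])
    k_eq := fun v _ _ => (if_neg (hnot v)).trans (by rw [hhalf])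
    j_eq := fun v _ _ _ => (if_neg (hnot v)).trans (by rw [hhalf]) }

/-- In a cute system every finite set `w` can be copied twice, the copies differing in the image of
a given element `δ` only, with union of rank at least a given `β < r w`. -/
theorem YZRSystem.IsCute.exists_doubling {S : YZRSystem ε ℕ} (hS : S.IsCute) {w : Finset ℕ}
    {δ : ℕ} (hδ : δ ∈ w) {β : Ordinal.{0}} (hβ : β < S.r w) :
    ∃ π₀ π₁ : ℕ → ℕ, IsQuasiEmbedding S S w π₀ ∧ IsQuasiEmbedding S S w π₁ ∧
      (∀ a ∈ w.erase δ, π₀ a = π₁ a) ∧ π₀ δ ≠ π₁ δ ∧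
      β ≤ S.r (w.image π₀ ∪ w.image π₁) := by
  classical
  set q := doubledSystem S hS.1 w δ hδ β hβ with hq
  obtain ⟨φ, hφ, -⟩ := hS.exists_quasiEmbedding q (doubledSet w δ).finite_toSet 0
  let g₁ : ℕ → ℕ := fun x => if x = δ then 2 * δ + 1 else 2 * x
  have m₀ : ∀ x ∈ w, 2 * x ∈ doubledSet w δ := fun x hx =>
    Finset.mem_insert_of_mem (Finset.mem_image_of_mem _ hx)
  have m₁ : ∀ x ∈ w, g₁ x ∈ doubledSet w δ := by
    intro x hx
    by_cases h : x = δ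
    · simp [g₁, h, doubledSet]
    · simpa [g₁, h] using m₀ x hx
  have q₀ := isQuasiEmbedding_doubledSystem S hS.1 hδ hβ (g := (2 * ·)) m₀
    (fun x => by simp)
  have q₁ := isQuasiEmbedding_doubledSystem S hS.1 hδ hβ (g := g₁) m₁
    (fun x => by by_cases h : x = δ <;> simp only [g₁, h, if_true, if_false] <;> omega)
  refine ⟨φ ∘ (2 * ·), φ ∘ g₁, hφ.comp q₀ m₀, hφ.comp q₁ m₁, ?_, ?_, ?_⟩
  · intro a ha
    simp [g₁, (Finset.mem_erase.1 ha).1]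
  · intro h
    have := hφ.strictMono.injOn (m₀ δ hδ) (m₁ δ hδ) h
    simp [g₁] at this
  · have hW : w.image (2 * ·) ∪ w.image g₁ ⊆ doubledSet w δ := by
      refine Finset.union_subset ?_ ?_
      · intro x hx
        obtain ⟨a, ha, rfl⟩ := Finset.mem_image.1 hx
        exact m₀ a ha
      · intro x hx
        obtain ⟨a, ha, rfl⟩ := Finset.mem_image.1 hx
        exact m₁ a ha
    rw [← Finset.image_image, ← Finset.image_image, ← Finset.image_union,
      hφ.r_eq _ ⟨2 * δ, Finset.mem_union_left _ (Finset.mem_image_of_mem _ hδ)⟩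
        (by exact_mod_cast hW)]
    have h1 : β < S.r (half (w.image (2 * ·) ∪ w.image g₁)) := hβ.trans_le
      (S.r_anti _ _ ⟨2 * δ / 2, Finset.mem_image_of_mem _
        (Finset.mem_union_left _ (Finset.mem_image_of_mem _ hδ))⟩ (half_subset hδ hW)
        (by simp [hS.1]))
    change β ≤ if _ then _ else _
    split_ifs
    · exact le_min h1.le le_rfl
    · exact h1.le

/-- A cute system contains sets of three elements of the largest possible rank. -/
theorem YZRSystem.IsCute.exists_rank_eq {S : YZRSystem ε ℕ} (hS : S.IsCute) (hε : 0 < ε) :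
    ∃ w : Finset ℕ, w.card = 3 ∧ S.r w = ε := by
  let q : YZRSystem ε ℕ :=
  { X := (Finset.range 3 : Finset ℕ)
    r := fun _ => ε
    j := fun A => Encodable.encode A
    k := fun _ => 0
    nonempty := ⟨0, by simp⟩
    r_le := fun _ _ _ => le_rfl
    r_anti := fun _ _ _ _ _ => le_rfl
    r_singleton := fun _ _ => hε
    k_lt := fun _ h _ => h.card_pos
    no_twin := by
      rintro w _ _ a _ _ ⟨b, -, hb, -, hj, -⟩
      exact hb (Encodable.encode_injective hj ▸ Finset.mem_insert_self b _) }
  obtain ⟨φ, hφ, -⟩ := hS.exists_quasiEmbedding q (Finset.finite_toSet _) 0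
  refine ⟨(Finset.range 3).image φ, ?_, hφ.r_eq _ (by simp) (le_refl _)⟩
  rw [Finset.card_image_of_injOn hφ.strictMono.injOn, Finset.card_range]

end Doubling

/-! ### The lower bound -/

namespace Tower

variable {ε : Ordinal.{0}} {S : YZRSystem ε ℕ}

/-- The configuration carried by `w` has rank at least the rank of `w` in the system: a point is
doubled by amalgamating two copies of `w`. -/
theorem ndrkGE_trace (hS : S.IsCute) (ι : ℕ) (𝒯 : Tower S)
    (h𝒯 : 𝒯.IsUniversal) (α : Ordinal.{0}) : ∀ (K : ℕ) (w : Finset ℕ), w ⊆ 𝒯.w K → 3 ≤ w.card → α ≤ S.r w →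
      NdrkGE (𝒯.tree ι) α ((𝒯.brick ι K).trace le_rfl w) := by
  induction α using WellFoundedLT.induction with
  | ind α ih =>
    intro K w hw h3 hα
    rw [ndrkGE_iff]
    intro β hβ ν hν
    obtain ⟨δ, hδ, rfl⟩ := Finset.mem_image.1 hν
    obtain ⟨π₀, π₁, q₀, q₁, hagree, hne, hr⟩ := hS.exists_doubling hδ (hβ.trans_le hα)
    have hsd : ∀ x ∈ w \ w.erase δ, x = δ := by
      intro x hx
      obtain ⟨h1, h2⟩ := Finset.mem_sdiff.1 hx
      by_contra h
      exact h2 (Finset.mem_erase.2 ⟨h, h1⟩)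
    obtain ⟨N, hN, π, hπ, hsub, hfold⟩ := h𝒯 K (w.erase δ) w (w.image π₀ ∪ w.image π₁) π₀ π₁
      { sub := hw
        sub' := Finset.erase_subset _ _
        guard := by
          intro v hv x hx h0
          exfalso
          obtain rfl := hsd x hx
          have hsub : insert x v ⊆ w := Finset.insert_subset hδ
            (hv.trans (Finset.erase_subset _ _))
          have := S.r_anti _ w ⟨x, Finset.mem_insert_self x v⟩ hsub (by simp [hS.1])
          rw [h0] at this
          exact absurd (hβ.trans_le (hα.trans this)) (not_lt_of_ge (zero_le))
        left := q₀
        right := q₁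
        agree := hagree
        disj := by
          rw [Finset.disjoint_left]
          intro x hx hx'
          obtain ⟨a, ha, rfl⟩ := Finset.mem_image.1 hx
          obtain ⟨b, hb, e⟩ := Finset.mem_image.1 hx'
          rw [hsd a ha, hsd b hb] at e
          exact hne e.symm
        left_mem := fun a ha => Finset.mem_union_left _ (Finset.mem_image_of_mem _ ha)
        right_mem := fun a ha => Finset.mem_union_right _ (Finset.mem_image_of_mem _ ha) }
    -- the union of the two copies carries the required extension
    set W := (w.image π₀ ∪ w.image π₁).image π with hW
    have hmem : ∀ x ∈ W, ∃ a ∈ w, x = π (π₀ a) ∨ x = π (π₁ a) := by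
      intro x hx
      obtain ⟨y, hy, rfl⟩ := Finset.mem_image.1 hx
      rcases Finset.mem_union.1 hy with hy | hy
      · obtain ⟨a, ha, rfl⟩ := Finset.mem_image.1 hy
        exact ⟨a, ha, Or.inl rfl⟩
      · obtain ⟨a, ha, rfl⟩ := Finset.mem_image.1 hy
        exact ⟨a, ha, Or.inr rfl⟩
    have hW₀ : ∀ a ∈ w, π (π₀ a) ∈ W := fun a ha =>
      Finset.mem_image_of_mem π (Finset.mem_union_left _ (Finset.mem_image_of_mem _ ha))
    have hW₁ : ∀ a ∈ w, π (π₁ a) ∈ W := fun a ha =>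
      Finset.mem_image_of_mem π (Finset.mem_union_right _ (Finset.mem_image_of_mem _ ha))
    have himage : W.image (𝒯.fold N) = w := by
      ext a
      constructor
      · intro h
        obtain ⟨x, hx, rfl⟩ := Finset.mem_image.1 h
        obtain ⟨a, ha, rfl | rfl⟩ := hmem x hx
        · rwa [(hfold a ha).1]
        · rwa [(hfold a ha).2.1]
      · intro h
        exact Finset.mem_image.2 ⟨_, hW₀ a h, (hfold a h).1⟩
    have hW3 : 3 ≤ W.card := by
      refine h3.trans ?_
      conv_lhs => rw [← himage]
      exact Finset.card_image_le
    have hrW : β ≤ S.r W := by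
      rw [hW, hπ.r_eq _ _ (le_refl _)]
      · exact hr
      · exact ⟨_, Finset.mem_union_left _ (Finset.mem_image_of_mem _ hδ)⟩
    have hlt : 𝒯.len ι K < 𝒯.len ι (N + 1) := 𝒯.len_strictMono ι (Nat.lt_succ_of_le hN)
    have hlt' : 𝒯.len ι K ≤ 𝒯.len ι N := (𝒯.len_strictMono ι).monotone hN
    have hinj := 𝒯.brick_injOn ι hw
    have hinjW := 𝒯.brick_injOn ι hsub
    have hfoldw : ∀ x ∈ W, 𝒯.fold N x ∈ w := fun x hx => himage ▸ Finset.mem_image_of_mem _ hx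
    have hnode : ∀ x ∈ W, (𝒯.node ι (N + 1) x).res hlt.le = 𝒯.node ι K (𝒯.fold N x) := by
      intro x hx
      ext p
      change 𝒯.pt ι (N + 1) x p = 𝒯.pt ι K (𝒯.fold N x) p
      rw [𝒯.pt_succ_of_lt ι (p.2.trans_le hlt')]
      exact 𝒯.pt_stable ι hN (hw (hfoldw x hx)) p.2
    have hold : ∀ x ∈ W, ∀ y ∈ W, 𝒯.fold N x ≠ 𝒯.fold N y → 𝒯.Old N x y := by
      intro x hx y hy hxy
      obtain ⟨a, ha, hxa⟩ := hmem x hx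
      obtain ⟨b, hb, hyb⟩ := hmem y hy
      have ea : 𝒯.fold N x = a := by
        rcases hxa with rfl | rfl
        · exact (hfold a ha).1
        · exact (hfold a ha).2.1
      have eb : 𝒯.fold N y = b := by
        rcases hyb with rfl | rfl
        · exact (hfold b hb).1
        · exact (hfold b hb).2.1
      rw [ea, eb] at hxy
      have hside : (x = π (π₀ a) ∧ y = π (π₀ b)) ∨ (x = π (π₁ a) ∧ y = π (π₁ b)) := by
        by_cases haδ : a = δ
        · have hb' : π₀ b = π₁ b :=
            hagree b (Finset.mem_erase.2 ⟨fun h => hxy (haδ.trans h.symm), hb⟩)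
          rw [hb'] at hyb ⊢
          rcases hxa with h | h
          · exact Or.inl ⟨h, hyb.elim id id⟩
          · exact Or.inr ⟨h, hyb.elim id id⟩
        · have ha' : π₀ a = π₁ a := hagree a (Finset.mem_erase.2 ⟨haδ, ha⟩)
          rw [ha'] at hxa ⊢
          rcases hyb with h | h
          · exact Or.inl ⟨hxa.elim id id, h⟩
          · exact Or.inr ⟨hxa.elim id id, h⟩
      rcases hside with ⟨rfl, rfl⟩ | ⟨rfl, rfl⟩
      · exact Or.inr (Or.inl ⟨(hfold a ha).2.2.1, (hfold b hb).2.2.1⟩)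
      · exact Or.inr (Or.inr ⟨(hfold a ha).2.2.2, (hfold b hb).2.2.2⟩)
    refine ⟨(𝒯.brick ι (N + 1)).trace le_rfl W,
      𝒯.trace_mem_configs ι hsub ((by omega : 2 ≤ 3).trans hW3), hlt, ?_,
      ih β hβ (N + 1) W hsub hW3 hrW, ?_⟩
    · refine extends_of_param (m := (𝒯.brick ι K).trace le_rfl w)
        (n := (𝒯.brick ι (N + 1)).trace le_rfl W) hlt.le (v := w) (w := W) (f := 𝒯.node ι K)
        (g := 𝒯.node ι (N + 1)) (p := 𝒯.fold N) rfl rfl himage hnode ?_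
      intro x hx y hy hxy i
      have ho := hold x hx y hy hxy
      have h1 : ((𝒯.brick ι K).trace le_rfl w).h i (𝒯.node ι K (𝒯.fold N x))
          (𝒯.node ι K (𝒯.fold N y)) = 𝒯.birth K (𝒯.fold N x) (𝒯.fold N y) :=
        (𝒯.brick ι K).trace_h le_rfl hinj (hfoldw x hx) (hfoldw y hy) i
      have h2 : ((𝒯.brick ι K).trace le_rfl w).g i (𝒯.node ι K (𝒯.fold N x))
          (𝒯.node ι K (𝒯.fold N y)) = 𝒯.brNode ι K i (𝒯.fold N x) (𝒯.fold N y) :=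
        (𝒯.brick ι K).trace_g le_rfl hinj (hfoldw x hx) (hfoldw y hy) i
      have h3 : ((𝒯.brick ι (N + 1)).trace le_rfl W).h i (𝒯.node ι (N + 1) x)
          (𝒯.node ι (N + 1) y) = 𝒯.birth (N + 1) x y :=
        (𝒯.brick ι (N + 1)).trace_h le_rfl hinjW hx hy i
      have h4 : ((𝒯.brick ι (N + 1)).trace le_rfl W).g i (𝒯.node ι (N + 1) x)
          (𝒯.node ι (N + 1) y) = 𝒯.brNode ι (N + 1) i x y :=
        (𝒯.brick ι (N + 1)).trace_g le_rfl hinjW hx hy i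
      rw [h1, h2, h3, h4]
      constructor
      · rw [𝒯.birth_succ_of_old ho]
        exact (𝒯.birth_stable hN (hw (hfoldw x hx)) (hw (hfoldw y hy))).symm
      · ext p
        change 𝒯.br ι K i (𝒯.fold N x) (𝒯.fold N y) p = 𝒯.br ι (N + 1) i x y p
        rw [𝒯.br_succ_of_lt ι (p.2.trans_le hlt') ho]
        exact (𝒯.br_stable ι hN (hw (hfoldw x hx)) (hw (hfoldw y hy)) p.2).symm
    · have hfin : {η | η ∈ ((𝒯.brick ι (N + 1)).trace le_rfl W).u ∧
          (((𝒯.brick ι K).η δ).res le_rfl).IsInitSeg η}.Finite :=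
        (Finset.finite_toSet _).subset fun x hx => hx.1
      refine (Set.one_lt_ncard hfin).2 ⟨𝒯.node ι (N + 1) (π (π₀ δ)), ?_,
        𝒯.node ι (N + 1) (π (π₁ δ)), ?_, ?_⟩
      · refine ⟨Finset.mem_image_of_mem _ (hW₀ δ hδ), hlt.le, ?_⟩
        have := hnode _ (hW₀ δ hδ)
        rw [(hfold δ hδ).1] at this
        exact this
      · refine ⟨Finset.mem_image_of_mem _ (hW₁ δ hδ), hlt.le, ?_⟩
        have := hnode _ (hW₁ δ hδ)
        rw [(hfold δ hδ).2.1] at this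
        exact this
      · intro h
        refine hne (hπ.strictMono.injOn ?_ ?_
          (𝒯.node_injOn ι (N + 1) (hsub (hW₀ δ hδ)) (hsub (hW₁ δ hδ)) h))
        · exact Finset.mem_union_left _ (Finset.mem_image_of_mem _ hδ)
        · exact Finset.mem_union_right _ (Finset.mem_image_of_mem _ hδ)

theorem le_ndrkTree (hS : S.IsCute) (hε : 0 < ε) (ι : ℕ) (𝒯 : Tower S)
    (h𝒯 : 𝒯.IsUniversal) :
    (ε : WithTop Ordinal.{0}) ≤ ndrkTree (𝒯.tree ι) ι := by
  obtain ⟨w, hw3, hr⟩ := hS.exists_rank_eq hε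
  have hw : w ⊆ 𝒯.w (w.sup id + 1) := fun x hx =>
    𝒯.mem_w (Nat.lt_succ_of_le (Finset.le_sup (f := id) hx))
  have h1 := 𝒯.ndrkGE_trace hS ι h𝒯 ε (w.sup id + 1) w hw hw3.ge hr.ge
  have h2 := 𝒯.trace_mem_configs ι hw (by omega)
  refine le_trans ?_ (le_iSup₂ (f := fun m _ => ndrk (𝒯.tree ι) m) _ h2)
  exact le_sSup ⟨ε, h1, rfl⟩

end Tower

/-! ### Translates of the attached points -/

/-- A family of at least four distinct two-element sets which meet pairwise has a common element:
the only other pairwise meeting families are the triangles. -/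
theorem exists_common_mem {α : Type*} {t : Finset α} (ht : 4 ≤ t.card) {L : α → Finset ℕ}
    (h2 : ∀ x ∈ t, (L x).card = 2)
    (hmeet : ∀ x ∈ t, ∀ y ∈ t, x ≠ y → L x ≠ L y ∧ ∃ a, a ∈ L x ∧ a ∈ L y) :
    ∃ a, ∀ x ∈ t, a ∈ L x := by
  classical
  obtain ⟨x, hx, y, hy, hxy⟩ := Finset.one_lt_card.1 (by omega : 1 < t.card)
  obtain ⟨hne, a, hax, hay⟩ := hmeet x hx y hy hxy
  by_contra hcon
  push Not at hcon
  obtain ⟨z, hz, haz⟩ := hcon a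
  have hzx : z ≠ x := fun h => haz (h ▸ hax)
  have hzy : z ≠ y := fun h => haz (h ▸ hay)
  obtain ⟨s, hs, hsn⟩ : ∃ s ∈ t, s ∉ ({x, y, z} : Finset α) := by
    by_contra h
    push Not at h
    have := (Finset.card_le_card h).trans Finset.card_le_three
    omega
  simp only [Finset.mem_insert, Finset.mem_singleton, not_or] at hsn
  obtain ⟨hsx, hsy, hsz⟩ := hsn
  -- a set with two elements is determined by any two of its members
  have pair : ∀ x ∈ t, ∀ p q, p ∈ L x → q ∈ L x → p ≠ q → L x = {p, q} := by
    intro x hx p q hp hq hpq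
    refine (Finset.eq_of_subset_of_card_le ?_ ?_).symm
    · intro r hr
      rcases Finset.mem_insert.1 hr with rfl | hr
      · exact hp
      · rwa [Finset.mem_singleton.1 hr]
    · rw [h2 x hx, Finset.card_pair hpq]
  obtain ⟨-, b, hbz, hbx⟩ := hmeet z hz x hx hzx
  obtain ⟨-, c, hcz, hcy⟩ := hmeet z hz y hy hzy
  have hab : a ≠ b := fun h => haz (h ▸ hbz)
  have hac : a ≠ c := fun h => haz (h ▸ hcz)
  have Lx := pair x hx a b hax hbx hab
  have Ly := pair y hy a c hay hcy hac
  have hbc : b ≠ c := fun h => hne (by rw [Lx, Ly, h])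
  have Lz := pair z hz b c hbz hcz hbc
  obtain ⟨nx, p, hp, hpx⟩ := hmeet s hs x hx hsx
  obtain ⟨ny, q, hq, hqy⟩ := hmeet s hs y hy hsy
  obtain ⟨nz, r, hr, hrz⟩ := hmeet s hs z hz hsz
  rw [Lx, Finset.mem_insert, Finset.mem_singleton] at hpx
  rw [Ly, Finset.mem_insert, Finset.mem_singleton] at hqy
  rw [Lz, Finset.mem_insert, Finset.mem_singleton] at hrz
  have hall : ¬(a ∈ L s ∧ b ∈ L s) ∧ ¬(a ∈ L s ∧ c ∈ L s) ∧ ¬(b ∈ L s ∧ c ∈ L s) :=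
    ⟨fun h => nx ((pair s hs a b h.1 h.2 hab).trans Lx.symm),
      fun h => ny ((pair s hs a c h.1 h.2 hac).trans Ly.symm),
      fun h => nz ((pair s hs b c h.1 h.2 hbc).trans Lz.symm)⟩
  rcases hpx with rfl | rfl <;> rcases hqy with rfl | rfl <;> rcases hrz with rfl | rfl <;> tauto

namespace Tower

variable {ε : Ordinal.{0}} {S : YZRSystem ε ℕ} (𝒯 : Tower S) (ι : ℕ)

theorem node_add_self {n : ℕ} (x : Node n) : x + x = 0 := by
  ext p; exact CharTwo.add_self_eq_zero _

theorem node_eq_add_of_add_eq {n : ℕ} {x y z : Node n} (h : x + y = z) : y = x + z := by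
  rw [← h, ← add_assoc, node_add_self, zero_add]

theorem node_add_eq_iff {K a b c d : ℕ} (ha : a ∈ 𝒯.w K) (hb : b ∈ 𝒯.w K) (hab : a ≠ b)
    (h : 𝒯.node ι K a + 𝒯.node ι K b = 𝒯.node ι K c + 𝒯.node ι K d) :
    (a = c ∧ b = d) ∨ (a = d ∧ b = c) := by
  have e1 := congrFun h (𝒯.pointPos ι ha)
  have e2 := congrFun h (𝒯.pointPos ι hb)
  simp only [Pi.add_apply, node_pointPos, if_true, if_neg hab, if_neg hab.symm] at e1 e2
  have h1 : a = c ∨ a = d := by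
    by_contra hc
    rw [not_or] at hc
    simp [hc.1, hc.2] at e1
  have h2 : b = c ∨ b = d := by
    by_contra hc
    rw [not_or] at hc
    simp [hc.1, hc.2] at e2
  rcases h1 with rfl | rfl <;> rcases h2 with rfl | rfl
  · exact absurd rfl hab
  · exact Or.inl ⟨rfl, rfl⟩
  · exact Or.inr ⟨rfl, rfl⟩
  · exact absurd rfl hab

/-- The symmetric part of the branches attached to `i` and `{a, b}` as a finite sequence. -/
noncomputable def symNode (K i a b : ℕ) : Node (𝒯.len ι K) :=
  cantorRes (𝒯.sym ι K i a b) (𝒯.len ι K)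

theorem symNode_comm (K i a b : ℕ) : 𝒯.symNode ι K i a b = 𝒯.symNode ι K i b a := by
  unfold symNode; rw [sym_comm]

theorem symNode_pairPos {K j c d : ℕ} (hj : j < ι) (hc : c ∈ 𝒯.w K) (hd : d ∈ 𝒯.w K)
    (i a b : ℕ) : 𝒯.symNode ι K i a b (𝒯.pairPos ι hj hc hd) =
      if pairCode i a b = pairCode j c d then 1 else 0 :=
  (𝒯.sym_start_add ι K i a b (pairCode j c d)).trans (if_congr eq_comm rfl rfl)

theorem brNode_eq (K i a b : ℕ) : 𝒯.brNode ι K i a b = 𝒯.symNode ι K i a b ∨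
    𝒯.brNode ι K i a b = 𝒯.symNode ι K i a b + (𝒯.node ι K a + 𝒯.node ι K b) := by
  by_cases h : a < b
  · left; ext p; simp [brNode, symNode, br, cantorRes, h]
  · right; ext p; simp [brNode, symNode, node, br, cantorRes, h]

theorem brNode_swap (K i : ℕ) {a b : ℕ} (hab : a ≠ b) :
    𝒯.brNode ι K i b a = 𝒯.brNode ι K i a b + (𝒯.node ι K a + 𝒯.node ι K b) := by
  have h := 𝒯.node_add_brNode ι K i hab
  have := node_eq_add_of_add_eq h.symm
  rw [this]; abel

/-- `x` is a branch of stage `K` of the pair `(a, b)`. -/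
def IsBr (K : ℕ) (x : Node (𝒯.len ι K)) (j a b : ℕ) : Prop :=
  j < ι ∧ a ∈ 𝒯.w K ∧ b ∈ 𝒯.w K ∧ a ≠ b ∧ x = 𝒯.brNode ι K j a b

theorem isBr_of_pairCode_eq {K : ℕ} {x : Node (𝒯.len ι K)} {i j a b c d : ℕ}
    (h : 𝒯.IsBr ι K x j c d) (hcode : pairCode j c d = pairCode i a b) :
    x = 𝒯.brNode ι K i a b ∨ x = 𝒯.brNode ι K i b a := by
  obtain ⟨-, -, -, -, rfl⟩ := h
  obtain ⟨rfl, ⟨rfl, rfl⟩ | ⟨rfl, rfl⟩⟩ := pairCode_inj.1 hcode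
  · exact Or.inl rfl
  · exact Or.inr rfl

/-- If a difference `d` of two branches involves the branches of `i` and `{a, b}`, then so does
each pair of branches with that difference. -/
theorem exists_of_pairPos_eq_one {K : ℕ} {x y d : Node (𝒯.len ι K)} {i a b : ℕ} (hi : i < ι)
    (ha : a ∈ 𝒯.w K) (hb : b ∈ 𝒯.w K) (hx : ∃ j c e, 𝒯.IsBr ι K x j c e)
    (hy : ∃ j c e, 𝒯.IsBr ι K y j c e) (hxy : x + y = d) (hd : d (𝒯.pairPos ι hi ha hb) = 1) :
    (x = 𝒯.brNode ι K i a b ∨ x = 𝒯.brNode ι K i b a) ∨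
      (y = 𝒯.brNode ι K i a b ∨ y = 𝒯.brNode ι K i b a) := by
  obtain ⟨j, c, e, hx⟩ := hx
  obtain ⟨j', c', e', hy⟩ := hy
  by_cases h1 : pairCode j c e = pairCode i a b
  · exact Or.inl (𝒯.isBr_of_pairCode_eq ι hx h1)
  · by_cases h2 : pairCode j' c' e' = pairCode i a b
    · exact Or.inr (𝒯.isBr_of_pairCode_eq ι hy h2)
    · exfalso
      obtain ⟨-, -, -, -, rfl⟩ := hx
      obtain ⟨-, -, -, -, rfl⟩ := hy
      rw [← hxy, Pi.add_apply, brNode_pairPos, brNode_pairPos, if_neg h1, if_neg h2] at hd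
      exact zero_ne_one ((add_zero (0 : ZMod 2)).symm.trans hd)

/-- The exceptional differences, which occur for two indices only: those of a branch of index `0`
and a branch of index `1` of the same pair. -/
def IsExceptional (K : ℕ) (d : Node (𝒯.len ι K)) (a b : ℕ) : Prop :=
  ι = 2 ∧ a ∈ 𝒯.w K ∧ b ∈ 𝒯.w K ∧
    (d = 𝒯.symNode ι K 0 a b + 𝒯.symNode ι K 1 a b ∨
      d = 𝒯.symNode ι K 0 a b + 𝒯.symNode ι K 1 a b + (𝒯.node ι K a + 𝒯.node ι K b))

/-- A vector which is in `ι` disjoint ways the difference of two branches is the difference of two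
attached points or exceptional. -/
theorem difference_cases (hι : 2 ≤ ι) {K : ℕ} {d : Node (𝒯.len ι K)}
    {x y : Fin ι → Node (𝒯.len ι K)} (hxy : ∀ i, x i + y i = d)
    (hinj : Function.Injective (Sum.elim x y)) (hx : ∀ i, ∃ j a b, 𝒯.IsBr ι K (x i) j a b)
    (hy : ∀ i, ∃ j a b, 𝒯.IsBr ι K (y i) j a b) {j a b : ℕ}
    (h0 : 𝒯.IsBr ι K (x ⟨0, by omega⟩) j a b) :
    d = 𝒯.node ι K a + 𝒯.node ι K b ∨ ∃ a b, 𝒯.IsExceptional ι K d a b := by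
  have hxx : ∀ {i k}, x i = x k → i = k := fun h => Sum.inl_injective (hinj h)
  have hyy : ∀ {i k}, y i = y k → i = k := fun h => Sum.inr_injective (hinj h)
  have hxny : ∀ {i k}, x i ≠ y k := fun {i k} h => by
    have := hinj (a₁ := Sum.inl i) (a₂ := Sum.inr k) h
    simp at this
  obtain ⟨j', a', b', h0'⟩ := hy ⟨0, by omega⟩
  obtain ⟨hj, ha, hb, hab, ex⟩ := id h0
  obtain ⟨hj', ha', hb', hab', ey⟩ := id h0'
  by_cases hcode : pairCode j' a' b' = pairCode j a b
  · left
    rcases 𝒯.isBr_of_pairCode_eq ι h0' hcode with e | e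
    · exact absurd (ex.trans e.symm) hxny
    · rw [← hxy ⟨0, by omega⟩, ex, e, 𝒯.brNode_swap ι K j hab, ← add_assoc, node_add_self,
        zero_add]
  · right
    have hd : d (𝒯.pairPos ι hj ha hb) = 1 := by
      rw [← hxy ⟨0, by omega⟩, ex, ey, Pi.add_apply, brNode_pairPos, brNode_pairPos, if_pos rfl,
        if_neg hcode, add_zero]
    have hd' : d (𝒯.pairPos ι hj' ha' hb') = 1 := by
      rw [← hxy ⟨0, by omega⟩, ex, ey, Pi.add_apply, brNode_pairPos, brNode_pairPos, if_pos rfl,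
        if_neg (Ne.symm hcode), zero_add]
    -- every further index must use the remaining branch of each of the two pairs
    have key : ∀ i : Fin ι, i ≠ ⟨0, by omega⟩ →
        x i = 𝒯.brNode ι K j b a ∨ y i = 𝒯.brNode ι K j b a := by
      intro i hi
      rcases 𝒯.exists_of_pairPos_eq_one ι hj ha hb (hx i) (hy i) (hxy i) hd with
        (e | e) | (e | e)
      · exact absurd (hxx (e.trans ex.symm)) hi
      · exact Or.inl e
      · exact absurd (ex.trans e.symm) hxny
      · exact Or.inr e
    have key' : ∀ i : Fin ι, i ≠ ⟨0, by omega⟩ →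
        x i = 𝒯.brNode ι K j' b' a' ∨ y i = 𝒯.brNode ι K j' b' a' := by
      intro i hi
      rcases 𝒯.exists_of_pairPos_eq_one ι hj' ha' hb' (hx i) (hy i) (hxy i) hd' with
        (e | e) | (e | e)
      · exact absurd (e.trans ey.symm) hxny
      · exact Or.inl e
      · exact absurd (hyy (e.trans ey.symm)) hi
      · exact Or.inr e
    -- a branch can be used for one index only, so there is only one index besides `0`
    have hι2 : ι = 2 := by
      by_contra hne
      have h1 := key ⟨1, by omega⟩ (by simp)
      have h2 := key ⟨2, by omega⟩ (by simp)
      rcases h1 with h1 | h1 <;> rcases h2 with h2 | h2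
      · have := hxx (h1.trans h2.symm); simp at this
      · exact hxny (h1.trans h2.symm)
      · exact hxny (h2.trans h1.symm)
      · have := hyy (h1.trans h2.symm); simp at this
    have hne1 : 𝒯.brNode ι K j b a ≠ 𝒯.brNode ι K j' b' a' := by
      intro h
      have := congrFun h (𝒯.pairPos ι hj hb ha)
      rw [brNode_pairPos, brNode_pairPos, if_pos rfl, if_neg] at this
      · exact one_ne_zero this
      · rw [pairCode_comm j' b' a', pairCode_comm j b a]; exact hcode
    have hsum : 𝒯.brNode ι K j b a + 𝒯.brNode ι K j' b' a' = d := by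
      rcases key ⟨1, by omega⟩ (by simp) with h1 | h1 <;>
        rcases key' ⟨1, by omega⟩ (by simp) with h2 | h2
      · exact absurd (h1.symm.trans h2) hne1
      · rw [← h1, ← h2, hxy]
      · rw [← h1, ← h2, add_comm, hxy]
      · exact absurd (h1.symm.trans h2) hne1
    have hnodes : 𝒯.node ι K a + 𝒯.node ι K b = 𝒯.node ι K a' + 𝒯.node ι K b' := by
      have h1 := hxy ⟨0, by omega⟩
      rw [← hsum, ex, ey, 𝒯.brNode_swap ι K j hab, 𝒯.brNode_swap ι K j' hab'] at h1
      ext p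
      have h2 := congrFun h1 p
      simp only [Pi.add_apply] at h2 ⊢
      have aux : ∀ s t a b c d : ZMod 2, s + t = s + (a + b) + (t + (c + d)) → a + b = c + d := by
        decide
      exact aux _ _ _ _ _ _ h2
    have hpair := 𝒯.node_add_eq_iff ι ha hb hab hnodes
    have hjj : j ≠ j' := by
      rintro rfl
      apply hcode
      rw [pairCode_inj]
      rcases hpair with ⟨rfl, rfl⟩ | ⟨rfl, rfl⟩
      · exact ⟨rfl, Or.inl ⟨rfl, rfl⟩⟩
      · exact ⟨rfl, Or.inr ⟨rfl, rfl⟩⟩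
    refine ⟨a, b, hι2, ha, hb, ?_⟩
    have hsym : ∀ i, 𝒯.symNode ι K i a' b' = 𝒯.symNode ι K i a b := by
      intro i
      rcases hpair with ⟨rfl, rfl⟩ | ⟨rfl, rfl⟩
      · rfl
      · exact 𝒯.symNode_comm ι K i _ _
    have hs : 𝒯.symNode ι K j a b + 𝒯.symNode ι K j' a b =
        𝒯.symNode ι K 0 a b + 𝒯.symNode ι K 1 a b := by
      obtain ⟨rfl, rfl⟩ | ⟨rfl, rfl⟩ : (j = 0 ∧ j' = 1) ∨ (j = 1 ∧ j' = 0) := by omega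
      · rfl
      · exact add_comm _ _
    rw [← hs, ← hxy ⟨0, by omega⟩, ex, ey]
    have aux1 : ∀ s t e : Node (𝒯.len ι K), s + (t + e) = s + t + e := fun s t e => by abel
    have aux2 : ∀ s t e : Node (𝒯.len ι K), s + e + t = s + t + e := fun s t e => by abel
    have aux3 : ∀ s t e : Node (𝒯.len ι K), s + e + (t + e) = s + t := fun s t e => by
      rw [show s + e + (t + e) = s + t + (e + e) by abel, node_add_self, add_zero]
    rcases 𝒯.brNode_eq ι K j a b with e1 | e1 <;>
      rcases 𝒯.brNode_eq ι K j' a' b' with e2 | e2 <;> rw [e1, e2, hsym, ← hnodes.symm]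
    · exact Or.inl rfl
    · exact Or.inr (aux1 _ _ _)
    · exact Or.inr (aux2 _ _ _)
    · exact Or.inl (aux3 _ _ _)

/-- Among five vectors no exceptional difference occurs: all vectors would lie in one coset of a
group with four elements. -/
theorem not_isExceptional {K : ℕ} {α : Type*} {u : Finset α} (hu : 5 ≤ u.card)
    {f : α → Node (𝒯.len ι K)} (hf : InjOn f u)
    (h : ∀ x ∈ u, ∀ y ∈ u, x ≠ y → (∃ a b, f x + f y = 𝒯.node ι K a + 𝒯.node ι K b) ∨
      ∃ a b, 𝒯.IsExceptional ι K (f x + f y) a b) {x y : α} (hx : x ∈ u) (hy : y ∈ u) (a b : ℕ) :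
    ¬𝒯.IsExceptional ι K (f x + f y) a b := by
  classical
  rintro ⟨hι, ha, hb, hd⟩
  have h0 : 0 < ι := by omega
  set e := 𝒯.node ι K a + 𝒯.node ι K b with he
  set s := 𝒯.symNode ι K 0 a b + 𝒯.symNode ι K 1 a b with hs
  have hval : ∀ i c d, (𝒯.symNode ι K i c d) (𝒯.pairPos ι h0 ha hb) =
      if pairCode i c d = pairCode 0 a b then 1 else 0 := fun i c d =>
    𝒯.symNode_pairPos ι h0 ha hb i c d
  have hnode : ∀ c, 𝒯.node ι K c (𝒯.pairPos ι h0 ha hb) = 0 := fun c =>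
    𝒯.node_pairPos ι h0 ha hb c
  have h10 : ∀ c d, pairCode 1 c d ≠ pairCode 0 a b := fun c d h => by
    have := (pairCode_inj.1 h).1; omega
  have hd1 : (f x + f y) (𝒯.pairPos ι h0 ha hb) = 1 := by
    rcases hd with hd | hd <;> rw [hd] <;> simp [hs, he, hval, hnode, h10]
  have key : ∀ x ∈ u, ∀ y ∈ u, (f x + f y) (𝒯.pairPos ι h0 ha hb) = 1 →
      f x + f y = s ∨ f x + f y = s + e := by
    intro x hx y hy h1
    have hxy : x ≠ y := by
      rintro rfl
      rw [node_add_self] at h1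
      exact zero_ne_one h1
    rcases h x hx y hy hxy with ⟨c, d, hcd⟩ | ⟨c, d, -, hc, hd, hcd⟩
    · rw [hcd] at h1
      simp [hnode] at h1
    · have hcode : pairCode 0 c d = pairCode 0 a b := by
        by_contra hne
        rcases hcd with hcd | hcd <;> rw [hcd] at h1 <;> simp [hval, hnode, h10, hne] at h1
      obtain ⟨-, ⟨rfl, rfl⟩ | ⟨rfl, rfl⟩⟩ := pairCode_inj.1 hcode
      · exact hcd
      · rw [𝒯.symNode_comm ι K 0, 𝒯.symNode_comm ι K 1, add_comm (𝒯.node ι K c)] at hcd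
        exact hcd
  have hsub : u.image (fun z => f x + f z) ⊆ {0, e, s, s + e} := by
    intro v hv
    obtain ⟨z, hz, rfl⟩ := Finset.mem_image.1 hv
    simp only [Finset.mem_insert, Finset.mem_singleton]
    have hsplit : f x + f z = (f x + f y) + (f y + f z) := by
      rw [show (f x + f y) + (f y + f z) = f x + f z + (f y + f y) by abel, node_add_self,
        add_zero]
    by_cases h1 : (f x + f z) (𝒯.pairPos ι h0 ha hb) = 1
    · rcases key x hx z hz h1 with h2 | h2
      · exact Or.inr (Or.inr (Or.inl h2))
      · exact Or.inr (Or.inr (Or.inr h2))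
    · have h2 : (f y + f z) (𝒯.pairPos ι h0 ha hb) = 1 := by
        have e1 := congrFun hsplit (𝒯.pairPos ι h0 ha hb)
        rw [Pi.add_apply (f x + f y), hd1] at e1
        have aux : ∀ p q : ZMod 2, p = 1 + q → p ≠ 1 → q = 1 := by decide
        exact aux _ _ e1 h1
      have aux1 : s + (s + e) = e := by rw [← add_assoc, node_add_self, zero_add]
      have aux2 : s + e + s = e := by
        rw [show s + e + s = e + (s + s) by abel, node_add_self, add_zero]
      rcases hd with h3 | h3 <;> rcases key y hy z hz h2 with h4 | h4 <;> rw [hsplit, h3, h4]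
      · exact Or.inl (node_add_self _)
      · exact Or.inr (Or.inl aux1)
      · exact Or.inr (Or.inl aux2)
      · exact Or.inl (node_add_self _)
  have hcard := (Finset.card_le_card hsub).trans Finset.card_le_four
  rw [Finset.card_image_of_injOn] at hcard
  · omega
  · intro z hz z' hz' h
    exact hf hz hz' (add_left_cancel h)

/-- Five vectors all of whose differences are differences of attached points form a translate of a
set of attached points. -/
theorem exists_translate {K : ℕ} {α : Type*} {u : Finset α} (hu : 5 ≤ u.card)
    {f : α → Node (𝒯.len ι K)} (hf : InjOn f u)
    (h : ∀ x ∈ u, ∀ y ∈ u, x ≠ y → ∃ a ∈ 𝒯.w K, ∃ b ∈ 𝒯.w K, a ≠ b ∧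
      f x + f y = 𝒯.node ι K a + 𝒯.node ι K b) :
    ∃ (θ : α → ℕ) (ρ : Node (𝒯.len ι K)), (∀ x ∈ u, θ x ∈ 𝒯.w K) ∧ InjOn θ u ∧
      ∀ x ∈ u, 𝒯.node ι K (θ x) + ρ = f x := by
  classical
  obtain ⟨x₀, hx₀⟩ : u.Nonempty := Finset.card_pos.1 (by omega)
  have h' : ∀ y ∈ u.erase x₀, ∃ a b, a ∈ 𝒯.w K ∧ b ∈ 𝒯.w K ∧ a ≠ b ∧
      f x₀ + f y = 𝒯.node ι K a + 𝒯.node ι K b := by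
    intro y hy
    obtain ⟨a, ha, b, hb, hab, e⟩ := h x₀ hx₀ y (Finset.mem_of_mem_erase hy)
      (Finset.ne_of_mem_erase hy).symm
    exact ⟨a, b, ha, hb, hab, e⟩
  choose! A B hA hB hAB hsum using h'
  have hcard : 4 ≤ (u.erase x₀).card := by rw [Finset.card_erase_of_mem hx₀]; omega
  -- the pairs representing the differences from `f x₀` meet pairwise, since the difference of two
  -- of them is again represented by a pair
  obtain ⟨a, ha⟩ := exists_common_mem hcard (L := fun y => {A y, B y})
    (fun y hy => Finset.card_pair (hAB y hy)) (by
      intro y hy z hz hyz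
      have hdiff : f y + f z = (𝒯.node ι K (A y) + 𝒯.node ι K (B y)) +
          (𝒯.node ι K (A z) + 𝒯.node ι K (B z)) := by
        rw [← hsum y hy, ← hsum z hz,
          show f x₀ + f y + (f x₀ + f z) = f y + f z + (f x₀ + f x₀) by abel, node_add_self,
          add_zero]
      obtain ⟨c, hc, d, hd, hcd, e⟩ := h y (Finset.mem_of_mem_erase hy) z
        (Finset.mem_of_mem_erase hz) hyz
      rw [e] at hdiff
      constructor
      · intro hL
        have h1 : 𝒯.node ι K (A y) + 𝒯.node ι K (B y) = 𝒯.node ι K (A z) + 𝒯.node ι K (B z) := by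
          have e1 : ∑ t ∈ ({A y, B y} : Finset ℕ), 𝒯.node ι K t =
              ∑ t ∈ ({A z, B z} : Finset ℕ), 𝒯.node ι K t := by rw [hL]
          rwa [Finset.sum_pair (hAB y hy), Finset.sum_pair (hAB z hz)] at e1
        rw [h1, node_add_self] at hdiff
        have e2 := congrFun hdiff (𝒯.pointPos ι hc)
        simp [node_pointPos, hcd] at e2
      · by_contra hno
        push Not at hno
        simp only [Finset.mem_insert, Finset.mem_singleton] at hno
        have n1 : A y ≠ A z := fun h => hno (A y) (Or.inl rfl) (Or.inl h)
        have n2 : A y ≠ B z := fun h => hno (A y) (Or.inl rfl) (Or.inr h)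
        have n3 : B y ≠ A z := fun h => hno (B y) (Or.inr rfl) (Or.inl h)
        have n4 : B y ≠ B z := fun h => hno (B y) (Or.inr rfl) (Or.inr h)
        have n5 := hAB y hy
        have n6 := hAB z hz
        have m : ∀ t, t ∈ 𝒯.w K → t = A y ∨ t = B y ∨ t = A z → t = c ∨ t = d := by
          intro t ht htt
          have e2 := congrFun hdiff (𝒯.pointPos ι ht)
          simp only [Pi.add_apply, node_pointPos] at e2
          by_contra hc
          rw [not_or] at hc
          rcases htt with rfl | rfl | rfl
          · simp [hc.1, hc.2, n1, n2, n5] at e2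
          · simp [hc.1, hc.2, n3, n4, n5.symm] at e2
          · simp [hc.1, hc.2, n1.symm, n3.symm, n6] at e2
        have m1 := m _ (hA y hy) (Or.inl rfl)
        have m2 := m _ (hB y hy) (Or.inr (Or.inl rfl))
        have m3 := m _ (hA z hz) (Or.inr (Or.inr rfl))
        omega)
  have haw : ∀ y ∈ u.erase x₀, ∃ b ∈ 𝒯.w K, f x₀ + f y = 𝒯.node ι K a + 𝒯.node ι K b := by
    intro y hy
    have h1 := ha y hy
    simp only [Finset.mem_insert, Finset.mem_singleton] at h1
    rcases h1 with h1 | h1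
    · exact ⟨B y, hB y hy, h1 ▸ hsum y hy⟩
    · exact ⟨A y, hA y hy, by rw [hsum y hy, h1, add_comm]⟩
  have hamem : a ∈ 𝒯.w K := by
    obtain ⟨y, hy⟩ : (u.erase x₀).Nonempty := Finset.card_pos.1 (by omega)
    have h1 := ha y hy
    simp only [Finset.mem_insert, Finset.mem_singleton] at h1
    rcases h1 with rfl | rfl
    · exact hA y hy
    · exact hB y hy
  choose! θ hθw hθ using haw
  let θ' : α → ℕ := fun y => if y = x₀ then a else θ y
  have hθ' : ∀ x ∈ u, 𝒯.node ι K (θ' x) + (f x₀ + 𝒯.node ι K a) = f x := by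
    intro x hx
    by_cases hxx : x = x₀
    · subst hxx
      have e : θ' x = a := if_pos rfl
      rw [e, add_comm, add_assoc, node_add_self, add_zero]
    · simp only [θ', if_neg hxx]
      rw [node_eq_add_of_add_eq (hθ x (Finset.mem_erase.2 ⟨hxx, hx⟩))]
      abel
  refine ⟨θ', f x₀ + 𝒯.node ι K a, ?_, ?_, hθ'⟩
  · intro x hx
    by_cases hxx : x = x₀
    · simpa only [θ', if_pos hxx] using hamem
    · simpa only [θ', if_neg hxx] using hθw x (Finset.mem_erase.2 ⟨hxx, hx⟩)
  · intro x hx y hy hxy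
    refine hf hx hy ?_
    rw [← hθ' x hx, ← hθ' y hy, hxy]

/-- A configuration with at least five elements is, at some stage, the restriction of a translate
of a set of attached points, and its trees are determined by the stages of birth. -/
structure IsRep (m : Config ι) (hι : 0 < ι) (N : ℕ) (θ : Node m.len → ℕ) (ρ : Node m.len) :
    Prop where
  le : m.len ≤ 𝒯.len ι N
  mem : ∀ η ∈ m.u, θ η ∈ 𝒯.w N
  inj : InjOn θ m.u
  eq : ∀ η ∈ m.u, (𝒯.node ι N (θ η)).res le + ρ = η
  birth : ∀ η ∈ m.u, ∀ ν ∈ m.u, η ≠ ν → 𝒯.birth N (θ η) (θ ν) = m.h ⟨0, hι⟩ η ν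

/-- The infinite branches witnessing membership in `M_{T,ι}` are followed up to a late stage, where
the differences of the elements are differences of attached points. -/
theorem exists_isRep (hι : 2 ≤ ι) {m : Config ι} (hm : m ∈ configs (𝒯.tree ι) ι)
    (hu : 5 ≤ m.u.card) :
    ∃ (N : ℕ) (θ : Node m.len → ℕ) (ρ : Node m.len), 𝒯.IsRep ι m (by omega) N θ ρ := by
  classical
  obtain ⟨F, G, hF, hG⟩ := hm.branches
  -- a stage which is long enough and by which all trees involved have started
  set H : ℕ := ∑ p ∈ m.u.offDiag, ∑ i : Fin ι, m.h i p.1 p.2 with hH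
  have hle : ∀ p ∈ m.u.offDiag, ∀ i, m.h i p.1 p.2 ≤ H := fun p hp i =>
    (Finset.single_le_sum (f := fun i => m.h i p.1 p.2) (fun _ _ => Nat.zero_le _)
      (Finset.mem_univ i)).trans
      (Finset.single_le_sum (f := fun p => ∑ i : Fin ι, m.h i p.1 p.2)
        (fun _ _ => Nat.zero_le _) hp)
  set N := max H m.len with hN
  have hlen : m.len ≤ 𝒯.len ι N := (le_max_right H m.len).trans (𝒯.le_len ι N)
  let f : Node m.len → Node (𝒯.len ι N) := fun η => cantorRes (F η) (𝒯.len ι N)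
  have hfres : ∀ η ∈ m.u, (f η).res hlen = η := fun η hη => hF η hη
  have hfinj : InjOn f m.u := fun η hη ν hν h => by rw [← hfres η hη, ← hfres ν hν, h]
  let x : Node m.len → Node m.len → Fin ι → Node (𝒯.len ι N) :=
    fun η ν i => cantorRes (G i η ν) (𝒯.len ι N)
  have hx : ∀ η ∈ m.u, ∀ ν ∈ m.u, η ≠ ν → ∀ i, ∃ j a b, 𝒯.IsBr ι N (x η ν i) j a b ∧
      𝒯.birth N a b = m.h i η ν := by
    intro η hη ν hν hne i
    have hp : (η, ν) ∈ m.u.offDiag := Finset.mem_offDiag.2 ⟨hη, hν, hne⟩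
    have h1 := (hG _ hp i).2.1 (𝒯.len ι N)
    obtain ⟨j, a, b, hj, ha, hb, hab, hbirth, e⟩ :=
      𝒯.exists_of_mem_tree ι ((hle _ hp i).trans (le_max_left H m.len)) h1
    exact ⟨j, a, b, ⟨hj, ha, hb, hab, e⟩, hbirth⟩
  have hcases : ∀ η ∈ m.u, ∀ ν ∈ m.u, η ≠ ν → ∀ j a b,
      𝒯.IsBr ι N (x η ν ⟨0, by omega⟩) j a b →
      f η + f ν = 𝒯.node ι N a + 𝒯.node ι N b ∨ ∃ a b, 𝒯.IsExceptional ι N (f η + f ν) a b := by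
    intro η hη ν hν hne j a b h0
    have hp : (η, ν) ∈ m.u.offDiag := Finset.mem_offDiag.2 ⟨hη, hν, hne⟩
    have hp' : (ν, η) ∈ m.u.offDiag := Finset.mem_offDiag.2 ⟨hν, hη, hne.symm⟩
    refine 𝒯.difference_cases ι hι (d := f η + f ν) (x := x η ν) (y := x ν η) (fun i => ?_) ?_
      (fun i => ?_) (fun i => ?_) h0
    · ext p
      have e := congrFun (hG _ hp i).2.2 p
      have aux : ∀ a b c d : ZMod 2, a + b = c + d → b + d = a + c := by decide
      exact aux _ _ _ _ e
    · intro s t hst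
      refine hm.no_rep _ hp ?_
      have e : ∀ s, (Sum.elim (x η ν) (x ν η) s).res hlen =
          Sum.elim (fun i => m.g i η ν) (fun i => m.g i ν η) s := by
        rintro (i | i)
        · exact (hG _ hp i).1
        · exact (hG _ hp' i).1
      exact (e s).symm.trans ((congrArg (Node.res hlen) hst).trans (e t))
    · obtain ⟨j, a, b, h, -⟩ := hx η hη ν hν hne i
      exact ⟨j, a, b, h⟩
    · obtain ⟨j, a, b, h, -⟩ := hx ν hν η hη hne.symm i
      exact ⟨j, a, b, h⟩
  have hD : ∀ η ∈ m.u, ∀ ν ∈ m.u, η ≠ ν → ∃ a ∈ 𝒯.w N, ∃ b ∈ 𝒯.w N, a ≠ b ∧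
      f η + f ν = 𝒯.node ι N a + 𝒯.node ι N b ∧ 𝒯.birth N a b = m.h ⟨0, by omega⟩ η ν := by
    intro η hη ν hν hne
    obtain ⟨j, a, b, h0, hb⟩ := hx η hη ν hν hne ⟨0, by omega⟩
    refine ⟨a, h0.2.1, b, h0.2.2.1, h0.2.2.2.1, ?_, hb⟩
    refine (hcases η hη ν hν hne j a b h0).resolve_right ?_
    rintro ⟨a', b', hex⟩
    refine 𝒯.not_isExceptional ι hu hfinj ?_ hη hν a' b' hex
    intro η hη ν hν hne
    obtain ⟨j, a, b, h0, -⟩ := hx η hη ν hν hne ⟨0, by omega⟩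
    exact (hcases η hη ν hν hne j a b h0).imp_left fun h => ⟨a, b, h⟩
  obtain ⟨θ, ρ, hθ, hθinj, hρ⟩ := 𝒯.exists_translate ι hu hfinj fun η hη ν hν hne => by
    obtain ⟨a, ha, b, hb, hab, e, -⟩ := hD η hη ν hν hne
    exact ⟨a, ha, b, hb, hab, e⟩
  refine ⟨N, θ, ρ.res hlen, hlen, hθ, hθinj, fun η hη => ?_, fun η hη ν hν hne => ?_⟩
  · exact (congrArg (Node.res hlen) (hρ η hη)).trans (hfres η hη)
  · obtain ⟨a, ha, b, hb, hab, e, hbirth⟩ := hD η hη ν hν hne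
    have e1 : 𝒯.node ι N a + 𝒯.node ι N b = 𝒯.node ι N (θ η) + 𝒯.node ι N (θ ν) := by
      rw [← e, ← hρ η hη, ← hρ ν hν,
        show 𝒯.node ι N (θ η) + ρ + (𝒯.node ι N (θ ν) + ρ) =
          𝒯.node ι N (θ η) + 𝒯.node ι N (θ ν) + (ρ + ρ) by abel, node_add_self, add_zero]
    rcases 𝒯.node_add_eq_iff ι ha hb hab e1 with ⟨rfl, rfl⟩ | ⟨rfl, rfl⟩
    · exact hbirth
    · rw [birth_comm]; exact hbirth

end Tower

/-! ### Extensions of configurations -/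

section Extensions

variable {ι : ℕ} {T : ℕ → BinTree}

/-- The configuration with the set `u` replaced by `u'`. -/
def Config.sub (m : Config ι) (u' : Finset (Node m.len)) : Config ι := { m with u := u' }

theorem Config.sub_mem_configs {m : Config ι} (hm : m ∈ configs T ι) {u' : Finset (Node m.len)}
    (hu' : u' ⊆ m.u) (h2 : 2 ≤ u'.card) : m.sub u' ∈ configs T ι := by
  have hp : u'.offDiag ⊆ m.u.offDiag := Finset.offDiag_mono hu'
  obtain ⟨F, G, hF, hG⟩ := hm.branches
  exact
  { len_pos := hm.len_pos
    two_le := h2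
    g_mem := fun p h => hm.g_mem p (hp h)
    add_eq := fun p h => hm.add_eq p (hp h)
    no_rep := fun p h => hm.no_rep p (hp h)
    branches := ⟨F, G, fun η hη => hF η (hu' hη), fun p h => hG p (hp h)⟩ }

theorem Config.Extends.len_le {m n : Config ι} (h : m.Extends n) : m.len ≤ n.len := h.1

theorem Config.Extends.u_eq {m n : Config ι} (h : m.Extends n) :
    m.u = n.u.image (fun x => x.res h.len_le) := h.choose_spec.1

theorem Config.Extends.res_mem {m n : Config ι} (h : m.Extends n) {x : Node n.len}
    (hx : x ∈ n.u) : x.res h.len_le ∈ m.u :=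
  h.u_eq.symm ▸ Finset.mem_image_of_mem (fun x : Node n.len => x.res h.len_le) hx

theorem Config.Extends.exists_lift {m n : Config ι} (h : m.Extends n) {η : Node m.len}
    (hη : η ∈ m.u) : ∃ x ∈ n.u, x.res h.len_le = η :=
  Finset.mem_image.1 (h.u_eq.subset hη)

theorem Config.Extends.h_eq {m n : Config ι} (h : m.Extends n) {x y : Node n.len} (hx : x ∈ n.u)
    (hy : y ∈ n.u) (hne : x.res h.len_le ≠ y.res h.len_le) (i : Fin ι) :
    n.h i x y = m.h i (x.res h.len_le) (y.res h.len_le) :=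
  (h.choose_spec.2 (x, y) (Finset.mem_offDiag.2 ⟨hx, hy, 
    fun e => hne (congrArg (Node.res h.len_le) e)⟩) hne i).1.symm

theorem Config.Extends.card_le {m n : Config ι} (h : m.Extends n) : m.u.card ≤ n.u.card :=
  (congrArg Finset.card h.u_eq).trans_le Finset.card_image_le

theorem Config.Extends.injOn {m n : Config ι} (h : m.Extends n) (hc : n.u.card ≤ m.u.card) :
    InjOn (fun x : Node n.len => x.res h.len_le) n.u :=
  Finset.card_image_iff.1 (le_antisymm Finset.card_image_le
    (hc.trans_eq (congrArg Finset.card h.u_eq)))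

theorem Config.extends_refl (m : Config ι) : m.Extends m :=
  ⟨le_rfl, Finset.image_id.symm, fun _ _ _ _ => ⟨rfl, rfl⟩⟩

theorem Config.Extends.trans {m n p : Config ι} (h : m.Extends n) (h' : n.Extends p) :
    m.Extends p := by
  obtain ⟨hl, hu, hg⟩ := h
  obtain ⟨hl', hu', hg'⟩ := h'
  refine ⟨hl.trans hl', ?_, ?_⟩
  · rw [hu, hu', Finset.image_image]
    rfl
  · rintro ⟨x, y⟩ hxy hne i
    obtain ⟨hx, hy, -⟩ := Finset.mem_offDiag.1 hxy
    have hne' : x.res hl' ≠ y.res hl' := fun e => hne (congrArg (Node.res hl) e)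
    have h1 := hg' (x, y) hxy hne' i
    have h2 := hg (x.res hl', y.res hl') (Finset.mem_offDiag.2 ⟨?_, ?_, hne'⟩) hne i
    · exact ⟨h2.1.trans h1.1, h2.2.trans (congrArg (Node.res hl) h1.2)⟩
    · rw [hu']; exact Finset.mem_image_of_mem _ hx
    · rw [hu']; exact Finset.mem_image_of_mem _ hy

theorem Config.Extends.sub {m n : Config ι} (h : m.Extends n) {u' : Finset (Node m.len)}
    {U : Finset (Node n.len)} (hU : U ⊆ n.u)
    (hu' : u' = U.image (fun x => x.res h.len_le)) : (m.sub u').Extends (n.sub U) :=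
  ⟨h.len_le, hu', fun p hp => h.choose_spec.2 p (Finset.offDiag_mono hU hp)⟩

/-- The rank does not decrease when `u` is replaced by a subset with at least two elements. -/
theorem NdrkGE.sub {α : Ordinal.{0}} {m : Config ι} {u' : Finset (Node m.len)} (hu' : u' ⊆ m.u)
    (h2 : 2 ≤ u'.card) (h : NdrkGE T α m) : NdrkGE T α (m.sub u') := by
  induction α using WellFoundedLT.induction generalizing m with
  | ind α ih =>
    rw [ndrkGE_iff] at h ⊢
    intro β hβ ν hν
    obtain ⟨n, hn, hlt, hext, hr, hc⟩ := h β hβ ν (hu' hν)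
    obtain ⟨U, hU⟩ : ∃ U : Finset (Node n.len), ∀ x, x ∈ U ↔ x ∈ n.u ∧ x.res hext.len_le ∈ u' :=
      ⟨@Finset.filter _ (fun x => x.res hext.len_le ∈ u') (Classical.decPred _) n.u,
        fun x => @Finset.mem_filter _ _ (Classical.decPred _) n.u x⟩
    have hUn : U ⊆ n.u := fun x hx => ((hU x).1 hx).1
    have him : u' = U.image (fun x => x.res hext.len_le) := by
      ext η
      constructor
      · intro hη
        obtain ⟨x, hx, e⟩ := hext.exists_lift (hu' hη)
        exact Finset.mem_image.2 ⟨x, (hU x).2 ⟨hx, e.symm ▸ hη⟩, e⟩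
      · intro hη
        obtain ⟨x, hx, e⟩ := Finset.mem_image.1 hη
        exact e ▸ ((hU x).1 hx).2
    have hU2 : 2 ≤ U.card := h2.trans ((congrArg Finset.card him).trans_le Finset.card_image_le)
    refine ⟨n.sub U, Config.sub_mem_configs hn hUn hU2, hlt, hext.sub hUn him,
      ih β hβ hUn hU2 hr, ?_⟩
    refine hc.trans_eq (congrArg Set.ncard ?_)
    ext x
    constructor
    · rintro ⟨hx, hl, e⟩
      exact ⟨(hU x).2 ⟨hx, e.symm ▸ hν⟩, hl, e⟩
    · rintro ⟨hx, he⟩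
      exact ⟨hUn hx, he⟩

/-- A step of the rank can be spent on increasing the length without splitting any element. -/
theorem NdrkGE.exists_longer {β : Ordinal.{0}} {m : Config ι} (hm : m ∈ configs T ι)
    (h : NdrkGE T (β + 1) m) : ∃ n ∈ configs T ι, m.Extends n ∧ m.len < n.len ∧
      n.u.card = m.u.card ∧ NdrkGE T β n := by
  have h2 := hm.two_le
  obtain ⟨ν, hν⟩ := Finset.card_pos.1 (by omega : 0 < m.u.card)
  obtain ⟨n, hn, hlt, hext, hr, -⟩ :=
    (ndrkGE_iff T _ m).1 h β (Order.lt_add_one_iff.2 le_rfl) ν hν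
  have hsec : ∀ η ∈ m.u, ∃ x ∈ n.u, x.res hext.len_le = η := fun η hη => hext.exists_lift hη
  choose! sec hmem hsec using hsec
  have hinj : InjOn sec m.u := fun η hη ν hν e => by rw [← hsec η hη, ← hsec ν hν, e]
  have hUn : m.u.image sec ⊆ n.u := Finset.image_subset_iff.2 hmem
  have hcard : (m.u.image sec).card = m.u.card := Finset.card_image_of_injOn hinj
  refine ⟨n.sub (m.u.image sec), Config.sub_mem_configs hn hUn (hcard ▸ h2), ?_, hlt, hcard,
    hr.sub hUn (hcard ▸ h2)⟩
  refine Config.Extends.sub (u' := m.u) hext hUn ?_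
  rw [Finset.image_image]
  ext η
  constructor
  · exact fun hη => Finset.mem_image.2 ⟨η, hη, hsec η hη⟩
  · intro hη
    obtain ⟨x, hx, e⟩ := Finset.mem_image.1 hη
    have e : (sec x).res hext.len_le = η := e
    rwa [← e, hsec x hx]

theorem NdrkGE.exists_long {α : Ordinal.{0}} (k : ℕ) {m : Config ι} (hm : m ∈ configs T ι)
    (h : NdrkGE T (α + k) m) : ∃ n ∈ configs T ι, m.Extends n ∧ m.len + k ≤ n.len ∧
      n.u.card = m.u.card ∧ NdrkGE T α n := by
  induction k generalizing m with
  | zero => exact ⟨m, hm, m.extends_refl, le_rfl, rfl, by simpa using h⟩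
  | succ k ih =>
    have e : α + ((k + 1 : ℕ) : Ordinal.{0}) = α + k + 1 := by
      rw [Nat.cast_add, Nat.cast_one, add_assoc]
    rw [e] at h
    obtain ⟨n, hn, hext, hlt, hc, hr⟩ := h.exists_longer hm
    obtain ⟨p, hp, hext', hle, hc', hr'⟩ := ih hn hr
    exact ⟨p, hp, hext.trans hext', by omega, hc'.trans hc, hr'⟩

/-- A step of the rank can be spent on increasing the number of elements. -/
theorem NdrkGE.exists_more {β : Ordinal.{0}} {m : Config ι} (hm : m ∈ configs T ι)
    (h : NdrkGE T (β + 1) m) : ∃ n ∈ configs T ι, m.Extends n ∧ m.u.card + 1 ≤ n.u.card ∧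
      NdrkGE T β n := by
  have h2 := hm.two_le
  obtain ⟨ν, hν⟩ := Finset.card_pos.1 (by omega : 0 < m.u.card)
  obtain ⟨n, hn, -, hext, hr, hc⟩ :=
    (ndrkGE_iff T _ m).1 h β (Order.lt_add_one_iff.2 le_rfl) ν hν
  refine ⟨n, hn, hext, ?_, hr⟩
  by_contra hcon
  obtain ⟨x, ⟨hx, _, ex⟩, y, ⟨hy, _, ey⟩, hxy⟩ :=
    (Set.one_lt_ncard_iff_nontrivial_and_finite.1 hc).1
  exact hxy (hext.injOn (by omega) hx hy (ex.trans ey.symm))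

end Extensions

/-! ### The upper bound for the rank -/

theorem exists_countBelow_eq {α : Type*} [LinearOrder α] {v : Finset α} {k : ℕ} (hk : k < v.card) :
    ∃ a ∈ v, countBelow v a = k := by
  set φ := v.orderEmbOfFin rfl
  have him : (Finset.univ : Finset (Fin v.card)).image φ = v := by
    rw [← Finset.coe_inj]
    simp [φ]
  refine ⟨φ ⟨k, hk⟩, Finset.orderEmbOfFin_mem _ _ _, ?_⟩
  have := countBelow_image (A := Set.univ) (φ.strictMono.strictMonoOn Set.univ)
    (v := Finset.univ) (by simp) (Set.mem_univ (⟨k, hk⟩ : Fin v.card))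
  rw [him] at this
  rw [this, countBelow, Finset.filter_gt_eq_Iio, Fin.card_Iio]

namespace Tower

variable {ε : Ordinal.{0}} {S : YZRSystem ε ℕ} (𝒯 : Tower S) (ι : ℕ)

/-- Doubling the distinguished element of a set, while all pairs but the new one remain copies of
old pairs, decreases the rank. This is where the condition `no_twin` on the system is used. -/
theorem rank_lt_of_doubled (hS : S.X = Set.univ) {K d d' : ℕ} {v : Finset ℕ} {s : ℕ → ℕ} {a y : ℕ}
    (h2 : v.Nontrivial) (ha : a ∈ v)
    (hv : ∀ a ∈ v, ∀ b ∈ v, a ≠ b → 𝒯.birth (K + d) a b ≤ K)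
    (hs : ∀ a ∈ v, ∀ b ∈ v, a ≠ b → 𝒯.birth (K + d') (s a) (s b) ≤ K)
    (hy : ∀ b ∈ v, b ≠ a → 𝒯.birth (K + d') y (s b) ≤ K) (hlt : y < s a)
    (he : ∀ a ∈ v, 𝒯.pull K d' (s a) = 𝒯.pull K d a)
    (hya : 𝒯.pull K d' y = 𝒯.pull K d a) (hk : countBelow v a = S.k v) :
    S.r (insert y (v.image s)) < S.r v := by
  have hvne : v.Nonempty := ⟨a, ha⟩
  have hr : 0 < S.r v := by
    rw [pos_iff_ne_zero]
    exact fun h => 𝒯.doubled_over hS h2 ha hv hs hy hlt.ne' he hya h hk.symm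
  have q := 𝒯.quasiEmbedding_of_pull_eq hS h2 hv hs he
  -- `y` is a second candidate for the value at `a`
  set s' := Function.update s a y with hs'
  have s'a : s' a = y := Function.update_self ..
  have s'b : ∀ b, b ≠ a → s' b = s b := fun b hb => Function.update_of_ne hb ..
  have q' : IsQuasiEmbedding S S v s' := by
    refine 𝒯.quasiEmbedding_of_pull_eq hS (K := K) (d := d) (d' := d') h2 hv ?_ ?_
    · intro b hb c hc hbc
      rcases eq_or_ne b a with rfl | hba
      · rw [s'a, s'b c hbc.symm]
        exact hy c hc hbc.symm
      · rcases eq_or_ne c a with rfl | hca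
        · rw [s'a, s'b b hba, birth_comm]
          exact hy b hb hba
        · rw [s'b b hba, s'b c hca]
          exact hs b hb c hc hbc
    · intro b hb
      rcases eq_or_ne b a with rfl | hba
      · rw [s'a, hya]
      · rw [s'b b hba, he b hb]
  have hX : v.image s = insert (s a) ((v.erase a).image s) := by
    rw [← Finset.image_insert, Finset.insert_erase ha]
  have hsa : s a ∉ (v.erase a).image s := by
    intro h
    obtain ⟨b, hb, e⟩ := Finset.mem_image.1 h
    obtain ⟨hba, hb⟩ := Finset.mem_erase.1 hb
    exact hba (q.strictMono.injOn hb ha e)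
  have hY : v.image s' = insert y ((v.erase a).image s) := by
    conv_lhs => rw [← Finset.insert_erase ha]
    rw [Finset.image_insert, s'a]
    congr 1
    exact Finset.image_congr fun b hb => s'b b (Finset.mem_erase.1 hb).1
  have hyX : y ∉ v.image s := by
    intro h
    obtain ⟨b, hb, e⟩ := Finset.mem_image.1 h
    rcases eq_or_ne b a with rfl | hba
    · exact hlt.ne e.symm
    · exact hba (q'.strictMono.injOn hb ha (by rw [s'a, s'b b hba, e]))
  have hcX : countBelow (v.image s) y = S.k (v.image s) := by
    have e1 : countBelow (v.image s) y = countBelow (v.image s') y := by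
      rw [hX, hY]
      unfold countBelow
      rw [Finset.filter_insert, Finset.filter_insert, if_neg hlt.not_gt, if_neg (lt_irrefl y)]
    rw [e1, ← s'a, countBelow_image q'.strictMono (le_refl _) ha, hk,
      q.k_eq v hvne (le_refl _)]
  have hrX : S.r (v.image s) = S.r v := q.r_eq v hvne (le_refl _)
  refine lt_of_le_of_ne (hrX ▸ S.r_anti _ _ (hvne.image s) (Finset.subset_insert y _)
    (by simp [hS])) fun h => ?_
  refine S.no_twin (v.image s) (hvne.image s) (by simp [hS]) (s a)
    (Finset.mem_image_of_mem s ha) ?_ ⟨y, by simp [hS], hyX, hcX, ?_, h.trans hrX.symm⟩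
  · rw [countBelow_image q.strictMono (le_refl _) ha, hk, q.k_eq v hvne (le_refl _)]
  · have : (v.image s).erase (s a) = (v.erase a).image s := by
      rw [hX, Finset.erase_insert hsa]
    rw [this, ← hY, q'.j_eq v hvne (le_refl _) hr, q.j_eq v hvne (le_refl _) hr]

/-- If all pairs of `m` were born by a stage `K` which the length of `m` has passed, then an
extension of `m` in which the distinguished element is split has smaller rank. -/
theorem IsRep.rank_lt (hS : S.X = Set.univ) {m n : Config ι} {hι : 0 < ι} {K N N' : ℕ}
    {θ : Node m.len → ℕ} {ρ : Node m.len} {θ' : Node n.len → ℕ} {ρ' : Node n.len}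
    (hm : 𝒯.IsRep ι m hι N θ ρ) (hn : 𝒯.IsRep ι n hι N' θ' ρ') (hu : 5 ≤ m.u.card)
    (hK : 𝒯.len ι K ≤ m.len)
    (hh : ∀ η ∈ m.u, ∀ ν ∈ m.u, η ≠ ν → m.h ⟨0, hι⟩ η ν ≤ K) (hext : m.Extends n)
    {ν : Node m.len} (hν : ν ∈ m.u)
    (hk : countBelow (m.u.image θ) (θ ν) = S.k (m.u.image θ))
    {x₁ x₂ : Node n.len} (hx₁ : x₁ ∈ n.u) (hx₂ : x₂ ∈ n.u) (e₁ : x₁.res hext.len_le = ν)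
    (e₂ : x₂.res hext.len_le = ν) (hlt : θ' x₂ < θ' x₁) :
    S.r (n.u.image θ') < S.r (m.u.image θ) := by
  have hsec : ∀ η ∈ m.u, ∃ x ∈ n.u, x.res hext.len_le = η ∧ (η = ν → x = x₁) := by
    intro η hη
    rcases eq_or_ne η ν with rfl | hne
    · exact ⟨x₁, hx₁, e₁, fun _ => rfl⟩
    · obtain ⟨x, hx, e⟩ := hext.exists_lift hη
      exact ⟨x, hx, e, fun h => absurd h hne⟩
  choose! sec hmem hsec hsecν using hsec
  obtain ⟨d, rfl⟩ := Nat.exists_eq_add_of_le ((𝒯.len_strictMono ι).le_iff_le.1 (hK.trans hm.le))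
  obtain ⟨d', rfl⟩ := Nat.exists_eq_add_of_le
    ((𝒯.len_strictMono ι).le_iff_le.1 ((hK.trans hext.len_le).trans hn.le))
  have hcard : (m.u.image θ).card = m.u.card := Finset.card_image_of_injOn hm.inj
  have h2 : (m.u.image θ).Nontrivial := nontrivial_of_three_le (by omega)
  have hv : ∀ a ∈ m.u.image θ, ∀ b ∈ m.u.image θ, a ≠ b → 𝒯.birth (K + d) a b ≤ K := by
    intro a ha b hb hab
    obtain ⟨η, hη, rfl⟩ := Finset.mem_image.1 ha
    obtain ⟨η', hη', rfl⟩ := Finset.mem_image.1 hb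
    have hne : η ≠ η' := fun h => hab (by rw [h])
    rw [hm.birth η hη η' hη' hne]
    exact hh η hη η' hη' hne
  have hbirth : ∀ x ∈ n.u, ∀ y ∈ n.u, x.res hext.len_le ≠ y.res hext.len_le →
      𝒯.birth (K + d') (θ' x) (θ' y) ≤ K := by
    intro x hx y hy hne
    rw [hn.birth x hx y hy fun h => hne (by rw [h]), hext.h_eq hx hy hne]
    exact hh _ (hext.res_mem hx) _ (hext.res_mem hy) hne
  have hpulln : ∀ x ∈ n.u, 𝒯.node ι K (𝒯.pull K d' (θ' x)) + ρ'.res (hK.trans hext.len_le) =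
      x.res (hK.trans hext.len_le) := by
    intro x hx
    rw [← 𝒯.res_node_pull ι K d' _ ((hK.trans hext.len_le).trans hn.le)]
    exact congrArg (Node.res (hK.trans hext.len_le)) (hn.eq x hx)
  have hpullm : ∀ η ∈ m.u, 𝒯.node ι K (𝒯.pull K d (θ η)) + ρ.res hK = η.res hK := by
    intro η hη
    rw [← 𝒯.res_node_pull ι K d _ (hK.trans hm.le)]
    exact congrArg (Node.res hK) (hm.eq η hη)
  have hres : ∀ x : Node n.len, x.res (hK.trans hext.len_le) = (x.res hext.len_le).res hK :=
    fun _ => rfl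
  have hpull : ∀ η ∈ m.u, 𝒯.pull K d (θ η) = 𝒯.pull K d' (θ' (sec η)) := by
    refine 𝒯.eq_of_node_add ι (K := K) (by omega) (ρ := ρ.res hK)
      (ρ' := ρ'.res (hK.trans hext.len_le)) (fun η hη => 𝒯.pull_mem K d (hm.mem η hη))
      (fun η hη => 𝒯.pull_mem K d' (hn.mem _ (hmem η hη))) ?_ ?_
    · intro η hη η' hη' e
      exact hm.inj hη hη' ((𝒯.pull_quasiEmbedding hS K d h2 hv).strictMono.injOn
        (Finset.mem_coe.2 (Finset.mem_image_of_mem θ hη))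
        (Finset.mem_coe.2 (Finset.mem_image_of_mem θ hη')) e)
    · intro η hη
      rw [hpullm η hη, hpulln _ (hmem η hη), hres, hsec η hη]
  have hρ : ρ.res hK = ρ'.res (hK.trans hext.len_le) := by
    refine add_left_cancel ((hpullm ν hν).trans ?_)
    rw [hpull ν hν, hpulln _ (hmem ν hν), hres, hsec ν hν]
  have hpull₂ : 𝒯.pull K d' (θ' x₂) = 𝒯.pull K d (θ ν) := by
    refine 𝒯.node_injOn ι K (𝒯.pull_mem K d' (hn.mem _ hx₂)) (𝒯.pull_mem K d (hm.mem ν hν)) ?_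
    refine add_right_cancel (b := ρ.res hK) ?_
    rw [hpullm ν hν, hρ, hpulln _ hx₂, hres, e₂]
  -- `s` sends the point representing `η` to the point representing its chosen extension
  let s : ℕ → ℕ := fun a => θ' (sec (Function.invFunOn θ m.u a))
  have hsθ : ∀ η ∈ m.u, s (θ η) = θ' (sec η) := fun η hη =>
    congrArg (fun x => θ' (sec x)) (hm.inj.leftInvOn_invFunOn hη)
  have hsν : s (θ ν) = θ' x₁ := by rw [hsθ ν hν, hsecν ν hν rfl]
  have key := 𝒯.rank_lt_of_doubled hS (K := K) (d := d) (d' := d') (s := s) (a := θ ν)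
    (y := θ' x₂) h2 (Finset.mem_image_of_mem θ hν) hv ?_ ?_ (hsν ▸ hlt) ?_ hpull₂ hk
  · refine lt_of_le_of_lt (S.r_anti _ _ (Finset.insert_nonempty _ _) ?_ (by simp [hS])) key
    refine Finset.insert_subset (Finset.mem_image_of_mem θ' hx₂) ?_
    intro b hb
    obtain ⟨a, ha, rfl⟩ := Finset.mem_image.1 hb
    obtain ⟨η, hη, rfl⟩ := Finset.mem_image.1 ha
    rw [hsθ η hη]
    exact Finset.mem_image_of_mem θ' (hmem η hη)
  · intro a ha b hb hab
    obtain ⟨η, hη, rfl⟩ := Finset.mem_image.1 ha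
    obtain ⟨η', hη', rfl⟩ := Finset.mem_image.1 hb
    rw [hsθ η hη, hsθ η' hη']
    refine hbirth _ (hmem η hη) _ (hmem η' hη') ?_
    rw [hsec η hη, hsec η' hη']
    exact fun h => hab (by rw [h])
  · intro b hb hne
    obtain ⟨η, hη, rfl⟩ := Finset.mem_image.1 hb
    rw [hsθ η hη]
    refine hbirth _ hx₂ _ (hmem η hη) ?_
    rw [e₂, hsec η hη]
    exact fun h => hne (by rw [h])
  · intro a ha
    obtain ⟨η, hη, rfl⟩ := Finset.mem_image.1 ha
    rw [hsθ η hη, hpull η hη]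

/-- A configuration of rank at least `γ + ω` has an extension of rank at least `γ`, without
splitting, whose length has passed the stages of birth of all its pairs. -/
theorem exists_long_extension {T : ℕ → BinTree} {γ : Ordinal.{0}} {m : Config ι} (hι : 0 < ι)
    (hm : m ∈ configs T ι) (h : NdrkGE T (γ + ω) m) :
    ∃ n ∈ configs T ι, m.Extends n ∧ n.u.card = m.u.card ∧ NdrkGE T γ n ∧
      ∃ K, 𝒯.len ι K ≤ n.len ∧ ∀ η ∈ n.u, ∀ ν ∈ n.u, η ≠ ν → n.h ⟨0, hι⟩ η ν ≤ K := by
  set K := ∑ p ∈ m.u.offDiag, m.h ⟨0, hι⟩ p.1 p.2 with hK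
  obtain ⟨n, hn, hext, hlen, hc, hr⟩ := (h.mono (β := γ + (𝒯.len ι K : ℕ))
    (by gcongr; exact (Ordinal.natCast_lt_omega0 _).le)).exists_long (𝒯.len ι K) hm
  refine ⟨n, hn, hext, hc, hr, K, by omega, fun η hη ν hν hne => ?_⟩
  have hne' : η.res hext.len_le ≠ ν.res hext.len_le := fun e =>
    hne (hext.injOn hc.le hη hν e)
  rw [hext.h_eq hη hν hne']
  exact Finset.single_le_sum (f := fun p : Node m.len × Node m.len => m.h ⟨0, hι⟩ p.1 p.2)
    (a := (η.res hext.len_le, ν.res hext.len_le)) (fun _ _ => Nat.zero_le _)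
    (Finset.mem_offDiag.2 ⟨hext.res_mem hη, hext.res_mem hν, hne'⟩)

/-- The rank of a represented configuration whose length has passed all stages of birth is bounded
in terms of the value of `r` at the set of points representing it. -/
theorem not_ndrkGE_of_isRep (hS : S.X = Set.univ) (hι : 2 ≤ ι) (r : Ordinal.{0}) {m : Config ι}
    (hu : 5 ≤ m.u.card) {K N : ℕ}
    {θ : Node m.len → ℕ} {ρ : Node m.len} (hrep : 𝒯.IsRep ι m (by omega) N θ ρ)
    (hK : 𝒯.len ι K ≤ m.len)
    (hh : ∀ η ∈ m.u, ∀ ν ∈ m.u, η ≠ ν → m.h ⟨0, by omega⟩ η ν ≤ K)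
    (hr : S.r (m.u.image θ) = r) : ¬ NdrkGE (𝒯.tree ι) (ω * (r + 1) + 1) m := by
  induction r using WellFoundedLT.induction generalizing m K N with
  | ind r ih =>
    intro h
    have hne : (m.u.image θ).Nonempty := (Finset.card_pos.1 (by omega)).image θ
    obtain ⟨a, ha, hk⟩ := exists_countBelow_eq (S.k_lt (m.u.image θ) hne (by simp [hS]))
    obtain ⟨ν, hν, rfl⟩ := Finset.mem_image.1 ha
    obtain ⟨n, hn, -, hext, hnr, hc⟩ :=
      (ndrkGE_iff _ _ m).1 h (ω * (r + 1)) (Order.lt_add_one_iff.2 le_rfl) ν hν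
    obtain ⟨x, ⟨hx, _, ex⟩, y, ⟨hy, _, ey⟩, hxy⟩ :=
      (Set.one_lt_ncard_iff_nontrivial_and_finite.1 hc).1
    -- the `ω` steps left after the splitting are spent on the length
    have e : ω * (r + 1) = ω * r + 1 + ω := by
      rw [mul_add_one, add_assoc, Ordinal.one_add_omega0]
    rw [e] at hnr
    obtain ⟨p, hp, hext', hpc, hpr, K', hK', hh'⟩ :=
      𝒯.exists_long_extension ι (by omega) hn hnr
    obtain ⟨x', hx', ex'⟩ := hext'.exists_lift hx
    obtain ⟨y', hy', ey'⟩ := hext'.exists_lift hy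
    have hmp := hext.trans hext'
    have hup : 5 ≤ p.u.card := hu.trans hmp.card_le
    obtain ⟨N', θ', ρ', hrep'⟩ := 𝒯.exists_isRep ι hι hp hup
    have hxν : x'.res hmp.len_le = ν := (congrArg (Node.res hext.len_le) ex').trans ex
    have hyν : y'.res hmp.len_le = ν := (congrArg (Node.res hext.len_le) ey').trans ey
    have hlt : S.r (p.u.image θ') < S.r (m.u.image θ) := by
      have hne' : θ' x' ≠ θ' y' := fun h => hxy <| by
        rw [← ex', ← ey', hrep'.inj hx' hy' h]
      rcases lt_or_gt_of_ne hne' with h | h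
      · exact IsRep.rank_lt 𝒯 ι hS hrep hrep' hu hK hh hmp hν hk hy' hx' hyν hxν h
      · exact IsRep.rank_lt 𝒯 ι hS hrep hrep' hu hK hh hmp hν hk hx' hy' hxν hyν h
    rw [hr] at hlt
    refine ih _ hlt hup hrep' hK' hh' rfl (hpr.mono ?_)
    gcongr
    exact Order.add_one_le_iff.2 hlt

theorem ndrkTree_le (hS : S.X = Set.univ) (hι : 2 ≤ ι) :
    ndrkTree (𝒯.tree ι) ι ≤ ((ω * (ε + 2) + 2 : Ordinal.{0}) : WithTop Ordinal.{0}) := by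
  refine iSup₂_le fun m hm => sSup_le ?_
  rintro _ ⟨α, hα, rfl⟩
  refine WithTop.coe_le_coe.2 (le_of_not_gt fun hlt => ?_)
  have e2 : (2 : Ordinal.{0}) = 1 + 1 := one_add_one_eq_two.symm
  have h3 : NdrkGE (𝒯.tree ι) (ω * (ε + 2) + 1 + 1 + 1) m := by
    refine NdrkGE.mono hα ?_
    rw [add_assoc (ω * (ε + 2)) (1 : Ordinal.{0}) 1, ← e2]
    exact Order.add_one_le_iff.2 hlt
  -- three splittings make the number of elements at least five
  obtain ⟨m₁, hm₁, -, hc₁, h₁⟩ := h3.exists_more hm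
  obtain ⟨m₂, hm₂, -, hc₂, h₂⟩ := h₁.exists_more hm₁
  obtain ⟨m₃, hm₃, -, hc₃, h₃⟩ := h₂.exists_more hm₂
  have hc := hm.two_le
  have e : ω * (ε + 2) = ω * (ε + 1) + 1 + ω := by
    rw [e2, ← add_assoc, mul_add_one, add_assoc (ω * (ε + 1)), Ordinal.one_add_omega0]
  rw [e] at h₃
  obtain ⟨n, hn, -, hcn, hr, K, hK, hh⟩ := 𝒯.exists_long_extension ι (by omega) hm₃ h₃
  have hu : 5 ≤ n.u.card := by omega
  obtain ⟨N, θ, ρ, hrep⟩ := 𝒯.exists_isRep ι hι hn hu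
  refine 𝒯.not_ndrkGE_of_isRep ι hS hι _ hu hrep hK hh rfl (hr.mono ?_)
  gcongr
  exact S.r_le _ ((Finset.card_pos.1 (by omega)).image θ) (by simp [hS])

end Tower

theorem mainTheorem2 (ε : Ordinal.{0}) (hε_pos : 0 < ε) (hε_lt : ε < Ordinal.omega 1)
    (ι : ℕ) (hι : 2 ≤ ι) (S : YZRSystem ε ℕ) (hS : S.IsCute) :
    ∃ (T : ℕ → BinTree) (c : ℕ → ℕ),
      (∀ m, (T m).NoMaximal) ∧
      ControlledAmalgamation S ι T c ∧
      (ε : WithTop Ordinal.{0}) ≤ ndrkTree T ι ∧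
      ndrkTree T ι ≤ ((Ordinal.omega0 * (ε + 2) + 2 : Ordinal.{0}) : WithTop Ordinal.{0}) := by
  obtain ⟨𝒯, h𝒯⟩ := exists_tower hS
  exact ⟨𝒯.tree ι, 𝒯.len ι, 𝒯.tree_noMaximal ι,
    𝒯.controlledAmalgamation hS.1 (by omega) h𝒯, Tower.le_ndrkTree hS hε_pos ι 𝒯 h𝒯,
    𝒯.ndrkTree_le ι hS.1 hι⟩
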